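/- **Setting.** Fix a set of quantum gates, each acting on $n\ge 1$ qubits by a unitary matrix. Types of the linear quantum $\lambda$-calculus are $A,B::=\mathtt{bit}\mid\mathtt{qbit}\mid 1\mid A\multimap B\mid A\otimes B$; terms are variables, abstractions, applications, $*$, $\mathtt{let}\,*=M\,\mathtt{in}\,N$, pairs, $\mathtt{let}\,(x,y)=M\,\mathtt{in}\,N$, if-then-else, and the operators $\mathtt{zero},\mathtt{one}:1\multimap\mathtt{bit}$, $\mathtt{discard}:\mathtt{bit}\multimap 1$, $\mathtt{new}:\mathtt{bit}\multimap\mathtt{qbit}$, $\mathtt{meas}:\mathtt{qbit}\multimap\mathtt{bit}$, and the $n$-qubit gates. Let $\pi$ be a derivation of a (multiplicative linear) typing judgement; in the if-then-else rule the guard is the first premise, and the two branches (second and third premise) share their context. The second premise is the branch of the value $0$, the third that of the value $1$. *Positions and tokens.* A position is an occurrence of an atom ($\mathtt{bit}$, $\mathtt{qbit}$ or $1$) in a judgement of $\pi$; it serves as a label. It is positive or negative according to its polarity (reversed to the left of $\multimap$ and in hypotheses). An address $\mathcal G$ is a partial function from labels to $\{0,1\}$. A token is a position with an address. For a set $\mathcal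 M$ of tokens, $\mathbf{ENV}(\mathcal M)$ assigns $\mathtt{bit}$ or $\mathtt{qbit}$ to the labels of the tokens of $\mathcal M$ on these types, leaving out tokens $(l,\mathcal G)$ with $l\in\mathrm{dom}(\mathcal G)$. $\mathbf{ENV}(\mathrm{NDATA}_\pi)$ is the environment of the negative occurrences of base types in the conclusion of $\pi$. *Circuits.* A circuit $C$ is a sequential composition of wire renamings (possibly none) and gates $\mathtt{zero},\mathtt{one},\mathtt{discard},\mathtt{new},\mathtt{meas}$ and unitary gates on labelled wires; $\Gamma\rhd C\rhd\Delta$ is the evident typing between environments (labels with base types). Each measurement carries an index. An extended circuit is a circuit $C$ or $C\mapsto^l(E_0,E_1)$ with a guard label $l$; guard labels are distinct along each path, and all measurement indices are distinct. Its addresses $@E$ are the sets of pairs $(l,b)$ read from the root to the leaves, and $E@\mathcal G$ is the leaf at $\mathcal G$. Typing $\Gamma\rhd E\rhd\mathcal J$, where $\mathcal J$ gives an environment for every address: for a node, $\Gamma\rhd C\rhd\Psi$ with $\Psi(l)=\mathtt{bit}$, and $E_0,E_1$ are typed from $\Psi\setminus l$. A super-address $s\in@^{\mathsf s}E$ is an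 address $\mathcal G_s\in@E$ together with a Boolean value for exactly those measurement indices that occur in the circuits along $\mathcal G_s$. The set $\mathrm{Ext}(S,\mathcal G,x)$ consists of the $s\cup\{(x,b)\}$, $b\in\{0,1\}$, for $s\in S$ with $\mathcal G_s=\mathcal G$, and of all $s\in S$ with $\mathcal G_s\neq\mathcal G$. *Semantics.* If $\Gamma$ has $n$ qubits and $k$ bits, $[\![\Gamma]\!]=(\mathbb C^{2^n\times 2^n})^{2^k}$. Each circuit acts by the usual completely positive maps; $E^{\sharp s}$ is the completely positive map obtained from $E$ by following the branches given by $s$, projecting each guard $l$ (which is then removed) to the value $s(l)$ and each measurement $\alpha$ to the outcome $s(\alpha)$. A register $m=[L,Q,v]$ is a list $L$ of distinct typed labels, a normalized state $Q$ of the qubits of $L$ and values $v$ for its bits; $|L|$ is $L$ seen as an environment, and $\mathtt{mix}(m)\in[\![|L|]\!]$ is $QQ^\dagger$ in the component of $v$ and $0$ in the others. *Reduction types.* A reduction type $a$ at address $\mathcal G$ is given by sets of tokens, those of $\mathcal M_0$ being at address $\mathcal G$, and is - *deterministic*, $(\mathcal M_0,\mathcal M_1)$: $\mathcal M_1$ arises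 from $\mathcal M_0$ either by finitely many (at least one) structural moves, or by moving the tokens on all inputs of one operator other than $\mathtt{meas}$ to its outputs. A structural move brings a token from a negative position of the conclusion or a positive position of a premise of some rule of $\pi$ to the corresponding position in that rule; moves into or out of the branch $b$ of an if-then-else require a token of address $\mathcal G$ on its guard, of label $l$, and $(l,b)\in\mathcal G$. Associated transformation of $E@\mathcal G$: append the wire renamings, or the gate; - *choice*, $(\mathcal M_0,\mathcal M_1,\mathcal M_1)$ with an index $\alpha$ not occurring in the circuit: one token of $\mathcal M_0$ moves through a $\mathtt{meas}$ operator, from $l$ to $r$. Associated transformation of $E@\mathcal G$: append a measurement of index $\alpha$; - *pseudo-deterministic*, $(\mathcal M_0,\mathcal M_1,\mathcal M_2)$: $\mathcal M_0$ contains a token on the guard of an if-then-else, of label $l\notin\mathrm{dom}(\mathcal G)$, and $\mathcal M_{1+b}$ is $\mathcal M_0$ with addresses $\mathcal G\cup\{(l,b)\}$. Associated transformation: $E@\mathcal G$ becomes $E@\mathcal G\mapsto^l(\mathrm{id},\mathrm{id})$. *QCSIAM.* A configuration is $\mathcal C=(\pi,\mathcal M,E)$ with tokens $\mathcal M$ whose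 addresses lie in $@E$, and an extended circuit with $\mathbf{ENV}(\mathrm{NDATA}_\pi)\rhd E\rhd(\mathcal G\mapsto\mathbf{ENV}(\mathcal M|_{\mathcal G}))$, where $\mathcal M|_{\mathcal G}$ is the set of tokens of address $\mathcal G$. For $\mathcal G\in @E$, $(\pi,\mathcal M,E)\to^a_{\mathcal G}(\pi,\mathcal M',E')$ holds if $\mathcal M|_{\mathcal G}=\mathcal M_0$, $\mathcal M'=(\mathcal M\setminus\mathcal M_0)\cup\bigcup_{i\geq1}\mathcal M_i$, and $E'$ is $E$ after the transformation associated with $a$ at $\mathcal G$. *QMSIAM.* A configuration is $(\pi,\mathcal M,m)$ where all tokens of $\mathcal M$ have the same address and $m=[L,Q,v]$ is a register with $|L|=\mathbf{ENV}(\mathcal M)$. An $E$-indexed coherent pseudo-distribution is a family $\mu=\{\mathcal C_s^{\mu_s}\}_{s\in@^{\mathsf s}E}$ of configurations $\mathcal C_s=(\pi,\mathcal M_s,m_s)$ with $\mu_s\in[0,1]$, $\sum_s\mu_s=1$, such that the tokens of $\mathcal C_s$ have address $\mathcal G_s$, and $\mathcal M_s=\mathcal M_t$ if $\mathcal G_s=\mathcal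 G_t$. For such $\mu$ and an $F$-indexed $\nu=\{\mathcal D_t^{\nu_t}\}$, and for $\mathcal G\in @E$, the parallel reduction $\mu\rightrightarrows^a_{\mathcal G}\nu$ holds if $F$ is $E$ after the transformation associated with $a$ at $\mathcal G$; every $s\not\supseteq\mathcal G$ in $@^{\mathsf s}E$ or in $@^{\mathsf s}F$ is in both, with $\mathcal C_s=\mathcal D_s$ and $\mu_s=\nu_s$; and, for all $s\in@^{\mathsf s}E$ with $s\supseteq\mathcal G$, $\mathcal C_s=(\pi,\mathcal M_0,m_s)$ and - ($a$ deterministic) $@^{\mathsf s}F=@^{\mathsf s}E$, $\mathcal D_s=(\pi,\mathcal M_1,m'_s)$, where $m'_s$ is $m_s$ after the renamings or the gate of $a$, and $\nu_s=\mu_s$; - ($a$ choice) $@^{\mathsf s}F=\mathrm{Ext}(@^{\mathsf s}E,\mathcal G,\alpha)$ and $\mathcal D_{s\cup\{(\alpha,b)\}}=(\pi,\mathcal M_1,m'_{s,b})$, where $m'_{s,b}$ has the state $Q^b$ and the additional bit $(r,b)$, the state of $m_s$ being $\lambda_0(Q^0\otimes|0\rangle)+\lambda_1(Q^1\otimes|1\rangle)$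 with the measured qubit $l$ written last, and $\nu_{s\cup\{(\alpha,b)\}}=|\lambda_b|^2\mu_s$; - ($a$ pseudo-deterministic) $@^{\mathsf s}F=\mathrm{Ext}(@^{\mathsf s}E,\mathcal G,l)$ and $\mathcal D_{s\cup\{(l,b)\}}=(\pi,\mathcal M_{1+b},m'_{s})$, where $m'_s$ is $m_s$ without the value $(l,b')$ that its classical register contains, and $\nu_{s\cup\{(l,b)\}}=\mu_s$ if $b=b'$ and $0$ otherwise. *The relation.* Let $m=[L,Q,v]$ be a register with $|L|=\mathbf{ENV}(\mathrm{NDATA}_\pi)$. For an $E$-indexed coherent pseudo-distribution $\mu$ and a QCSIAM configuration $\mathcal C=(\pi,\mathcal M,F)$, the relation $\mu\ \mathscr R^m_\pi\ \mathcal C$ holds when (index) $E=F$; (token) $\mathcal M_s=\mathcal M|_{\mathcal G_s}$ for all $s\in@^{\mathsf s}E$; (mixed state) $\mu_s\cdot\mathtt{mix}(m_s)=E^{\sharp s}(\mathtt{mix}(m))$ for all $s\in@^{\mathsf s}E$. **Theorem (bisimulation between the QMSIAM and the QCSIAM).** For every derivation $\pi$, extended circuit $E$, $E$-indexed coherent pseudo-distribution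 $\mu$ of QMSIAM configurations, QCSIAM configuration $\mathcal C$, register $m$, reduction type $a$ and address $\mathcal G\in@E$: 1. if $\mu\ \mathscr R^m_\pi\ \mathcal C$ and $\mathcal C\to^a_{\mathcal G}\mathcal C'$, then there is $\mu'$ such that $\mu\rightrightarrows^a_{\mathcal G}\mu'$ and $\mu'\ \mathscr R^m_\pi\ \mathcal C'$; 2. if $\mu\ \mathscr R^m_\pi\ \mathcal C$ and $\mu\rightrightarrows^a_{\mathcal G}\mu'$, then there is $\mathcal C'$ such that $\mathcal C\to^a_{\mathcal G}\mathcal C'$ and $\mu'\ \mathscr R^m_\pi\ \mathcal C'$. -/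

import Mathlib

namespace QSIAM

/-! ## Types, operators, terms and type derivations of the linear quantum lambda-calculus -/

/-- Base types. -/
inductive Base
  | bit
  | qbit
  deriving DecidableEq

/-- Types `A, B ::= bit | qbit | 1 | A ⊸ B | A ⊗ B`. -/
inductive Ty
  | base (B : Base)
  | unit
  | arr (A B : Ty)
  | tens (A B : Ty)

/-- Atomic types: a base type or `1`. -/
inductive Atom
  | base (B : Base)
  | unit
  deriving DecidableEq

/-- The atom of a type at a path (`false` = left, `true` = right component), together with its
polarity (`true` = positive); the left-hand side of `⊸` reverses polarities. -/
def Ty.atomAt : Ty → List Bool → Option (Atom × Bool)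
  | .base B, [] => some (.base B, true)
  | .unit, [] => some (.unit, true)
  | .arr A _, false :: w => (A.atomAt w).map fun q => (q.1, !q.2)
  | .arr _ B, true :: w => B.atomAt w
  | .tens A _, false :: w => A.atomAt w
  | .tens _ B, true :: w => B.atomAt w
  | _, _ => none

/-- A set of quantum gates: each gate acts on a positive number of qubits as a unitary matrix on
the computational basis (bit strings of length `arity`). -/
structure GateSet where
  Gate : Type
  arity : Gate → ℕ
  arity_pos : ∀ g, 0 < arity g
  mat : ∀ g, Matrix.unitaryGroup (Fin (arity g) → Bool) ℂ

/-- The predefined operators over a gate set. -/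
inductive Op (𝒬 : GateSet)
  | zero
  | one
  | discard
  | new
  | meas
  | gate (g : 𝒬.Gate)

variable {𝒬 : GateSet}

/-- Input types of an operator. -/
def Op.ins : Op 𝒬 → List Base
  | .zero => []
  | .one => []
  | .discard => [.bit]
  | .new => [.bit]
  | .meas => [.qbit]
  | .gate g => List.replicate (𝒬.arity g) .qbit

/-- Output types of an operator. -/
def Op.outs : Op 𝒬 → List Base
  | .zero => [.bit]
  | .one => [.bit]
  | .discard => []
  | .new => [.qbit]
  | .meas => [.bit]
  | .gate g => List.replicate (𝒬.arity g) .qbit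

/-- `B₁ ⊗ (B₂ ⊗ ⋯)`, which is `1` for the empty sequence. -/
def tensor : List Base → Ty
  | [] => .unit
  | [B] => .base B
  | B :: C :: l => .tens (.base B) (tensor (C :: l))

/-- The path of the `i`-th factor in an `n`-fold tensor product of base types. -/
def tensorPath (n i : ℕ) : List Bool :=
  List.replicate i true ++ (if i + 1 < n then [false] else [])

/-- The type of an operator as a constant of the calculus. -/
def Op.ty (c : Op 𝒬) : Ty := .arr (tensor c.ins) (tensor c.outs)

/-- Terms; variables are natural numbers. -/
inductive Tm (𝒬 : GateSet)
  | var (x : ℕ)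
  | lam (x : ℕ) (M : Tm 𝒬)
  | app (M N : Tm 𝒬)
  | star
  | letStar (M N : Tm 𝒬)
  | pair (M N : Tm 𝒬)
  | letPair (x y : ℕ) (M N : Tm 𝒬)
  | ite (M N P : Tm 𝒬)
  | op (c : Op 𝒬)

/-- Typing contexts: each variable has at most one type. -/
abbrev Ctx := ℕ → Option Ty

/-- `x : A`. -/
def Ctx.single (x : ℕ) (A : Ty) : Ctx := Function.update (fun _ => none) x (some A)

/-- `Γ, x : A`. -/
def Ctx.cons (Γ : Ctx) (x : ℕ) (A : Ty) : Ctx := Function.update Γ x (some A)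

/-- `Δ, Γ`. -/
def Ctx.union (Δ Γ : Ctx) : Ctx := fun x => (Δ x).or (Γ x)

/-- No variable is declared in both contexts. -/
def Ctx.Disj (Δ Γ : Ctx) : Prop := ∀ x, Δ x = none ∨ Γ x = none

/-- Type derivations of `Γ ⊢ M : A`. -/
inductive Deriv (𝒬 : GateSet) : Ctx → Tm 𝒬 → Ty → Type
  | var (x : ℕ) (A : Ty) : Deriv 𝒬 (Ctx.single x A) (.var x) A
  | lam {Δ : Ctx} {x : ℕ} {M : Tm 𝒬} {A B : Ty} (hx : Δ x = none)
      (d : Deriv 𝒬 (Δ.cons x A) M B) : Deriv 𝒬 Δ (.lam x M) (.arr A B)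
  | app {Δ Γ : Ctx} {M N : Tm 𝒬} {A B : Ty} (h : Ctx.Disj Δ Γ)
      (d₀ : Deriv 𝒬 Δ M (.arr A B)) (d₁ : Deriv 𝒬 Γ N A) :
      Deriv 𝒬 (Ctx.union Δ Γ) (.app M N) B
  | star : Deriv 𝒬 (fun _ => none) .star .unit
  | letStar {Δ Γ : Ctx} {M N : Tm 𝒬} {A : Ty} (h : Ctx.Disj Δ Γ)
      (d₀ : Deriv 𝒬 Δ M .unit) (d₁ : Deriv 𝒬 Γ N A) :
      Deriv 𝒬 (Ctx.union Δ Γ) (.letStar M N) A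
  | pair {Δ Γ : Ctx} {M N : Tm 𝒬} {A B : Ty} (h : Ctx.Disj Δ Γ)
      (d₀ : Deriv 𝒬 Δ M A) (d₁ : Deriv 𝒬 Γ N B) :
      Deriv 𝒬 (Ctx.union Δ Γ) (.pair M N) (.tens A B)
  | letPair {Δ Γ : Ctx} {x y : ℕ} {M N : Tm 𝒬} {A B C : Ty} (h : Ctx.Disj Δ Γ)
      (hxy : x ≠ y) (hx : Γ x = none) (hy : Γ y = none)
      (d₀ : Deriv 𝒬 Δ M (.tens A B)) (d₁ : Deriv 𝒬 ((Γ.cons x A).cons y B) N C) :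
      Deriv 𝒬 (Ctx.union Δ Γ) (.letPair x y M N) C
  | ite {Δ Γ : Ctx} {M N P : Tm 𝒬} {A : Ty} (h : Ctx.Disj Δ Γ)
      (d₀ : Deriv 𝒬 Δ M (.base .bit)) (d₁ : Deriv 𝒬 Γ N A) (d₂ : Deriv 𝒬 Γ P A) :
      Deriv 𝒬 (Ctx.union Δ Γ) (.ite M N P) A
  | op (c : Op 𝒬) : Deriv 𝒬 (fun _ => none) (.op c) c.ty

/-- A type derivation together with its conclusion `ctx ⊢ tm : ty`. -/
structure Derivation (𝒬 : GateSet) where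
  ctx : Ctx
  tm : Tm 𝒬
  ty : Ty
  tree : Deriv 𝒬 ctx tm ty

/-- The derivation of the `i`-th premise of the last rule. -/
def Derivation.prem : Derivation 𝒬 → ℕ → Option (Derivation 𝒬)
  | ⟨_, _, _, .lam _ d⟩, 0 => some ⟨_, _, _, d⟩
  | ⟨_, _, _, .app _ d _⟩, 0 => some ⟨_, _, _, d⟩
  | ⟨_, _, _, .app _ _ d⟩, 1 => some ⟨_, _, _, d⟩
  | ⟨_, _, _, .letStar _ d _⟩, 0 => some ⟨_, _, _, d⟩
  | ⟨_, _, _, .letStar _ _ d⟩, 1 => some ⟨_, _, _, d⟩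
  | ⟨_, _, _, .pair _ d _⟩, 0 => some ⟨_, _, _, d⟩
  | ⟨_, _, _, .pair _ _ d⟩, 1 => some ⟨_, _, _, d⟩
  | ⟨_, _, _, .letPair _ _ _ _ d _⟩, 0 => some ⟨_, _, _, d⟩
  | ⟨_, _, _, .letPair _ _ _ _ _ d⟩, 1 => some ⟨_, _, _, d⟩
  | ⟨_, _, _, .ite _ d _ _⟩, 0 => some ⟨_, _, _, d⟩
  | ⟨_, _, _, .ite _ _ d _⟩, 1 => some ⟨_, _, _, d⟩
  | ⟨_, _, _, .ite _ _ _ d⟩, 2 => some ⟨_, _, _, d⟩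
  | _, _ => none

/-- The sub-derivation at a node, a node being a list of premise indices read from the root. -/
def Derivation.subAt (π : Derivation 𝒬) : List ℕ → Option (Derivation 𝒬)
  | [] => some π
  | i :: p => (π.prem i).bind fun ρ => ρ.subAt p

/-- The operator introduced by the last rule, if that rule is an operator axiom. -/
def Derivation.opOf : Derivation 𝒬 → Option (Op 𝒬)
  | ⟨_, _, _, .op c⟩ => some c
  | _ => none

/-- The last rule is an if-then-else. -/
def Derivation.IsIte : Derivation 𝒬 → Prop
  | ⟨_, _, _, .ite _ _ _ _⟩ => True
  | _ => False

/-! ## Positions and the paths followed by tokens -/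

/-- A formula of a judgement: the type of the subject or the type of a variable. -/
inductive Place
  | concl
  | hyp (x : ℕ)
  deriving DecidableEq

/-- A position: the occurrence, in the judgement at `node`, of an atom given by a formula and a
path in it. -/
structure Pos where
  node : List ℕ
  place : Place
  path : List Bool
  deriving DecidableEq

/-- The atom at a position and its polarity in the judgement (hypotheses reverse polarities);
`none` if there is no such occurrence in the derivation. -/
def Derivation.occ (π : Derivation 𝒬) (σ : Pos) : Option (Atom × Bool) :=
  (π.subAt σ.node).bind fun ρ =>
    match σ.place with
    | .concl => ρ.ty.atomAt σ.path
    | .hyp x => (ρ.ctx x).bind fun B => (B.atomAt σ.path).map fun q => (q.1, !q.2)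

/-- A subformula in the conclusion (`prem = none`) or in a premise (`prem = some i`) of a rule. -/
structure Port where
  prem : Option ℕ
  place : Place
  pre : List Bool

/-- The position below a port of the rule at node `p`, at the path `w` inside the subformula. -/
def Port.pos (f : Port) (p : List ℕ) (w : List Bool) : Pos :=
  ⟨p ++ f.prem.toList, f.place, f.pre ++ w⟩

/-- Each hypothesis in `Γ` of the conclusion corresponds to the same hypothesis of premise `i`. -/
def hypLinks (Γ : Ctx) (i : ℕ) : Set (Port × Port) :=
  {q | ∃ x, Γ x ≠ none ∧ q = (⟨none, .hyp x, []⟩, ⟨some i, .hyp x, []⟩)}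

/-- Correspondences between equal subformulas in the conclusion and the premises of the last rule.
For an if-then-else, only those with the premise of the guard are listed. -/
def Derivation.links : Derivation 𝒬 → Set (Port × Port)
  | ⟨_, _, _, .var x _⟩ => {(⟨none, .hyp x, []⟩, ⟨none, .concl, []⟩)}
  | ⟨_, _, _, .lam (Δ := Δ) (x := x) _ _⟩ =>
      {(⟨none, .concl, [false]⟩, ⟨some 0, .hyp x, []⟩),
       (⟨none, .concl, [true]⟩, ⟨some 0, .concl, []⟩)} ∪ hypLinks Δ 0
  | ⟨_, _, _, .app (Δ := Δ) (Γ := Γ) _ _ _⟩ =>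
      {(⟨none, .concl, []⟩, ⟨some 0, .concl, [true]⟩),
       (⟨some 0, .concl, [false]⟩, ⟨some 1, .concl, []⟩)} ∪ hypLinks Δ 0 ∪ hypLinks Γ 1
  | ⟨_, _, _, .star⟩ => ∅
  | ⟨_, _, _, .letStar (Δ := Δ) (Γ := Γ) _ _ _⟩ =>
      {(⟨none, .concl, []⟩, ⟨some 1, .concl, []⟩)} ∪ hypLinks Δ 0 ∪ hypLinks Γ 1
  | ⟨_, _, _, .pair (Δ := Δ) (Γ := Γ) _ _ _⟩ =>
      {(⟨none, .concl, [false]⟩, ⟨some 0, .concl, []⟩),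
       (⟨none, .concl, [true]⟩, ⟨some 1, .concl, []⟩)} ∪ hypLinks Δ 0 ∪ hypLinks Γ 1
  | ⟨_, _, _, .letPair (Δ := Δ) (Γ := Γ) (x := x) (y := y) _ _ _ _ _ _⟩ =>
      {(⟨some 0, .concl, [false]⟩, ⟨some 1, .hyp x, []⟩),
       (⟨some 0, .concl, [true]⟩, ⟨some 1, .hyp y, []⟩),
       (⟨none, .concl, []⟩, ⟨some 1, .concl, []⟩)} ∪ hypLinks Δ 0 ∪ hypLinks Γ 1
  | ⟨_, _, _, .ite (Δ := Δ) _ _ _ _⟩ => hypLinks Δ 0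
  | ⟨_, _, _, .op _⟩ => ∅

/-- The correspondences of an if-then-else with its branch `b`: the branch of the value `0` is the
second premise, that of the value `1` the third one. -/
def Derivation.branchLinks : Derivation 𝒬 → Bool → Set (Port × Port)
  | ⟨_, _, _, .ite (Γ := Γ) _ _ _ _⟩, b =>
      {(⟨none, .concl, []⟩, ⟨some (cond b 2 1), .concl, []⟩)} ∪ hypLinks Γ (cond b 2 1)
  | _, _ => ∅

/-- Addresses, as partial functions from labels to `{0, 1}`. The label of a wire is the position
of the token on it. -/
abbrev Addr := Pos → Option Bool

/-- The empty address. -/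
def Addr.empty : Addr := fun _ => none

/-- `𝒢 ∪ {(l, b)}`. -/
def Addr.add (𝒢 : Addr) (l : Pos) (b : Bool) : Addr := Function.update 𝒢 l (some b)

/-- Inclusion of addresses. -/
def Addr.Sub (𝒢 ℋ : Addr) : Prop := ∀ l b, 𝒢 l = some b → ℋ l = some b

/-- Tokens: a position (which is also the label of the token) and an address. -/
abbrev Token := Pos × Addr

/-- The guard of the if-then-else at node `p`: the type `bit` of its first premise. -/
def guardPos (p : List ℕ) : Pos := ⟨p ++ [0], .concl, []⟩

/-- The correspondences at node `p` that are available at the address `𝒢`: those with branch `b` of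
an if-then-else require a token of address `𝒢` on its guard, of label `l`, and `(l, b) ∈ 𝒢`. -/
def activeLinks (ρ : Derivation 𝒬) (p : List ℕ) (𝒢 : Addr) (M : Set Token) : Set (Port × Port) :=
  ρ.links ∪
    {q | ∃ b, q ∈ ρ.branchLinks b ∧ (guardPos p, 𝒢) ∈ M ∧ 𝒢 (guardPos p) = some b}

/-- A token of address `𝒢` may move from `σ` to `τ`, two occurrences of the atom `a` that correspond
to each other in some rule. Tokens enter a rule through negative atoms of its conclusion and through
positive atoms of its premises. -/
def Derivation.Link (π : Derivation 𝒬) (𝒢 : Addr) (M : Set Token) (σ τ : Pos) (a : Atom) : Prop :=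
  ∃ (p : List ℕ) (ρ : Derivation 𝒬) (f g : Port) (w : List Bool),
    π.subAt p = some ρ ∧
    ((f, g) ∈ activeLinks ρ p 𝒢 M ∨ (g, f) ∈ activeLinks ρ p 𝒢 M) ∧
    σ = f.pos p w ∧ τ = g.pos p w ∧
    π.occ σ = some (a, f.prem.isSome) ∧ (∃ ε, π.occ τ = some (a, ε))

/-! ## Environments and circuits -/

/-- Environments, as partial functions from labels to base types. -/
abbrev Env := Pos → Option Base

/-- `Γ` is the union of `Θ` and of the list of assignments `xs`, with no label in common. -/
def Env.IsUnion (Γ Θ : Env) (xs : List (Pos × Base)) : Prop :=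
  (xs.map Prod.fst).Nodup ∧ (∀ e ∈ xs, Θ e.1 = none ∧ Γ e.1 = some e.2) ∧
    ∀ l, l ∉ xs.map Prod.fst → Γ l = Θ l

/-- `Γ` without the label `l`. -/
def Env.remove (Γ : Env) (l : Pos) : Env := Function.update Γ l none

/-- The environment of the bits and qubits of a set of tokens. A token on the guard of an
if-then-else whose value has been recorded in its address no longer carries a bit. -/
noncomputable def Derivation.env (π : Derivation 𝒬) (M : Set Token) : Env := fun l =>
  open Classical in
  if ∃ 𝒢, (l, 𝒢) ∈ M ∧ 𝒢 l = none then
    match π.occ l with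
    | some (.base B, _) => some B
    | _ => none
  else none

/-- The environment of the negative occurrences of base types in the conclusion. -/
def Derivation.inputEnv (π : Derivation 𝒬) : Env := fun l =>
  if l.node = [] then
    match π.occ l with
    | some (.base B, false) => some B
    | _ => none
  else none

/-- Circuits without if-then-else. A gate carries the labels of its input and output wires, and a
measurement also carries its index; `wire` is the renaming of one wire. -/
inductive Circ (𝒬 : GateSet)
  | id
  | wire (B : Base) (l r : Pos)
  | zero (r : Pos)
  | one (r : Pos)
  | discard (l : Pos)
  | new (l r : Pos)
  | meas (α : ℕ) (l r : Pos)
  | gate (g : 𝒬.Gate) (ls rs : Fin (𝒬.arity g) → Pos)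
  | seq (C D : Circ 𝒬)

/-- `Θ, ins ▷ c ▷ Θ, outs`. -/
def GateTyped (Γ : Env) (ins outs : List (Pos × Base)) (Δ : Env) : Prop :=
  ∃ Θ : Env, Γ.IsUnion Θ ins ∧ Δ.IsUnion Θ outs

/-- The typing `Γ ▷ C ▷ Δ` of circuits. -/
def Circ.Typed (Γ : Env) : Circ 𝒬 → Env → Prop
  | .id, Δ => Δ = Γ
  | .wire B l r, Δ => GateTyped Γ [(l, B)] [(r, B)] Δ
  | .zero r, Δ => GateTyped Γ [] [(r, .bit)] Δ
  | .one r, Δ => GateTyped Γ [] [(r, .bit)] Δ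
  | .discard l, Δ => GateTyped Γ [(l, .bit)] [] Δ
  | .new l r, Δ => GateTyped Γ [(l, .bit)] [(r, .qbit)] Δ
  | .meas _ l r, Δ => GateTyped Γ [(l, .qbit)] [(r, .bit)] Δ
  | .gate _ ls rs, Δ =>
      GateTyped Γ (List.ofFn fun i => (ls i, Base.qbit)) (List.ofFn fun i => (rs i, Base.qbit)) Δ
  | .seq C D, Δ => ∃ Ψ, C.Typed Γ Ψ ∧ D.Typed Ψ Δ

/-- The indices of the measurements of a circuit. -/
def Circ.measList : Circ 𝒬 → List ℕ
  | .meas α _ _ => [α]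
  | .seq C D => C.measList ++ D.measList
  | _ => []

/-- Extended circuits: a circuit `C`, or `C ↦ˡ (E, F)`. -/
inductive ExtCirc (𝒬 : GateSet)
  | leaf (C : Circ 𝒬)
  | node (C : Circ 𝒬) (l : Pos) (E F : ExtCirc 𝒬)

/-- The addresses of an extended circuit: the paths from the root to a leaf. -/
def ExtCirc.addrs : ExtCirc 𝒬 → Set Addr
  | .leaf _ => {Addr.empty}
  | .node _ l E F =>
      {𝒢 | ∃ ℋ ∈ E.addrs, 𝒢 = ℋ.add l false} ∪ {𝒢 | ∃ ℋ ∈ F.addrs, 𝒢 = ℋ.add l true}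

/-- Guard labels do not occur twice on a path. -/
def ExtCirc.GuardsDistinct : ExtCirc 𝒬 → Prop
  | .leaf _ => True
  | .node _ l E F =>
      (∀ 𝒢 ∈ E.addrs ∪ F.addrs, 𝒢 l = none) ∧ E.GuardsDistinct ∧ F.GuardsDistinct

/-- The indices of all measurements in the circuits of an extended circuit. -/
def ExtCirc.measList : ExtCirc 𝒬 → List ℕ
  | .leaf C => C.measList
  | .node C _ E F => C.measList ++ (E.measList ++ F.measList)

/-- Standing conventions on extended circuits: paths are partial functions, and distinct
measurements have distinct indices. -/
def ExtCirc.WF (E : ExtCirc 𝒬) : Prop := E.GuardsDistinct ∧ E.measList.Nodup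

/-- The circuit `E|_𝒢` met along the address `𝒢`, guards being discarded. -/
def ExtCirc.restrict (𝒢 : Addr) : ExtCirc 𝒬 → Circ 𝒬
  | .leaf C => C
  | .node C l E F =>
      match 𝒢 l with
      | some false => .seq (.seq C (.discard l)) (E.restrict 𝒢)
      | some true => .seq (.seq C (.discard l)) (F.restrict 𝒢)
      | none => C

/-- The extended circuit obtained by replacing the leaf `E@𝒢` by its image under `f`. -/
def ExtCirc.replaceAt (𝒢 : Addr) (f : Circ 𝒬 → ExtCirc 𝒬) : ExtCirc 𝒬 → ExtCirc 𝒬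
  | .leaf C => f C
  | .node C l E F =>
      match 𝒢 l with
      | some false => .node C l (E.replaceAt 𝒢 f) F
      | some true => .node C l E (F.replaceAt 𝒢 f)
      | none => .node C l E F

/-- The typing `Γ ▷ E ▷ 𝒥`, where `𝒥` gives the output environment of the leaf at each address. -/
def ExtCirc.Typed (Γ : Env) : ExtCirc 𝒬 → (Addr → Env) → Prop
  | .leaf C, 𝒥 => C.Typed Γ (𝒥 Addr.empty)
  | .node C l E F, 𝒥 =>
      ∃ Ψ : Env, C.Typed Γ Ψ ∧ Ψ l = some .bit ∧
        E.Typed (Ψ.remove l) (fun 𝒢 => 𝒥 (𝒢.add l false)) ∧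
        F.Typed (Ψ.remove l) (fun 𝒢 => 𝒥 (𝒢.add l true))

/-- Partial functions assigning Boolean values to guard labels and to measurement indices. -/
abbrev SAddr := Pos ⊕ ℕ → Option Bool

/-- `𝒢_s`, the restriction of `s` to guard labels. -/
def SAddr.addr (s : SAddr) : Addr := fun l => s (Sum.inl l)

/-- `s ∪ {(ℓ, b)}`. -/
def SAddr.add (s : SAddr) (ℓ : Pos ⊕ ℕ) (b : Bool) : SAddr := Function.update s ℓ (some b)

/-- The super-addresses of an extended circuit: `𝒢_s` is an address, and `s` is defined on exactly
those measurements that occur at the address `𝒢_s`. -/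
def ExtCirc.superAddrs (E : ExtCirc 𝒬) : Set SAddr :=
  {s | s.addr ∈ E.addrs ∧
    ∀ α : ℕ, (s (Sum.inr α)).isSome ↔ α ∈ (E.restrict s.addr).measList}

/-- The extension of a set of super-addresses at the address `𝒢` with a label or an index. -/
def superExt (S : Set SAddr) (𝒢 : Addr) (ℓ : Pos ⊕ ℕ) : Set SAddr :=
  {t | ∃ s ∈ S, s.addr = 𝒢 ∧ ∃ b, t = s.add ℓ b} ∪ {s ∈ S | s.addr ≠ 𝒢}

/-! ## Semantics -/

/-- The labels of type `B` in an environment. -/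
abbrev Env.Idx (Γ : Env) (B : Base) := {l : Pos // Γ l = some B}

/-- The interpretation `⟦Γ⟧` of an environment with `n` qubits and `k` bits, i.e. the product of
`2 ^ k` copies of the `2 ^ n × 2 ^ n` matrices. Coordinates are named by labels: a factor is given
by values for the bits, a row or column by values for the qubits. -/
abbrev Env.Sem (Γ : Env) :=
  (Γ.Idx .bit → Bool) → Matrix (Γ.Idx .qbit → Bool) (Γ.Idx .qbit → Bool) ℂ

/-- A common space for all the `⟦Γ⟧`: functions of values for bits, a row and a column, where the
values are given for all labels. -/
abbrev St := (Pos → Bool) → (Pos → Bool) → (Pos → Bool) → ℂ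

/-- The embedding of `⟦Γ⟧` in the common space: the functions that depend only on the values at the
labels of `Γ`. -/
def Env.embed (Γ : Env) (A : Γ.Sem) : St := fun v x y =>
  A (fun l => v l) (fun l => x l) (fun l => y l)

/-- The assignment `x` with the values at the labels `ls` replaced by `a`. -/
noncomputable def setAt {n : ℕ} (ls : Fin n → Pos) (a : Fin n → Bool) (x : Pos → Bool) :
    Pos → Bool := fun l =>
  open Classical in
  if h : ∃ i, ls i = l then a h.choose else x l

/-- `π_b^l`. -/
def projBit (l : Pos) (b : Bool) (ρ : St) : St := fun v x y => ρ (Function.update v l b) x y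

/-- The completely positive map `C^{♯s}`, as it acts on elements of `⟦Γ⟧` for `Γ ▷ C ▷ Δ`; a wire
not touched by a gate is left unchanged. On gates other than measurements this is `⟦c⟧`; a
measurement is projected to the outcome `s α`. -/
noncomputable def Circ.slice (s : SAddr) : Circ 𝒬 → St → St
  | .id, ρ => ρ
  | .wire .bit l r, ρ => fun v x y => ρ (Function.update v l (v r)) x y
  | .wire .qbit l r, ρ => fun v x y =>
      ρ v (Function.update x l (x r)) (Function.update y l (y r))
  | .zero r, ρ => fun v x y => if v r = false then ρ v x y else 0
  | .one r, ρ => fun v x y => if v r = true then ρ v x y else 0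
  | .discard l, ρ => fun v x y =>
      ρ (Function.update v l false) x y + ρ (Function.update v l true) x y
  | .new l r, ρ => fun v x y => if x r = y r then ρ (Function.update v l (x r)) x y else 0
  | .meas α l r, ρ => fun v x y =>
      match s (Sum.inr α) with
      | some b =>
          if v r = b then ρ v (Function.update x l (v r)) (Function.update y l (v r)) else 0
      | none => 0
  | .gate g ls rs, ρ => fun v x y =>
      ∑ a : Fin (𝒬.arity g) → Bool, ∑ b : Fin (𝒬.arity g) → Bool,
        (𝒬.mat g).1 (fun i => x (rs i)) a * ρ v (setAt ls a x) (setAt ls b y) *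
          (starRingEnd ℂ) ((𝒬.mat g).1 (fun i => y (rs i)) b)
  | .seq C D, ρ => D.slice s (C.slice s ρ)

/-- The completely positive map `E^{♯s}` of an extended circuit, zero if `s` is not defined on the
labels met. -/
noncomputable def ExtCirc.slice (s : SAddr) : ExtCirc 𝒬 → St → St
  | .leaf C, ρ => C.slice s ρ
  | .node C l E F, ρ =>
      match s (Sum.inl l) with
      | some false => E.slice s (projBit l false (C.slice s ρ))
      | some true => F.slice s (projBit l true (C.slice s ρ))
      | none => 0

/-! ## Quantum+classical registers -/

/-- The labels of type `B` in a list of assignments, in the order of the list. -/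
def labelsOf (L : List (Pos × Base)) (B : Base) : List Pos :=
  (L.filter fun e => e.2 = B).map Prod.fst

/-- Quantum+classical registers `[L, Q, v]`: a list of distinct labels with their types, a
normalized state of the qubits of `L`, and values for the bits of `L`. -/
structure Reg where
  L : List (Pos × Base)
  nodup : (L.map Prod.fst).Nodup
  Q : (Fin (labelsOf L .qbit).length → Bool) → ℂ
  norm_eq : ∑ z, ‖Q z‖ ^ 2 = 1
  v : Fin (labelsOf L .bit).length → Bool

/-- `|L|`, the list `L` seen as an environment. -/
def Reg.env (m : Reg) : Env := fun l =>
  if (l, Base.qbit) ∈ m.L then some .qbit else if (l, Base.bit) ∈ m.L then some .bit else none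

theorem Reg.mem_L_of_labelsOf (m : Reg) (B : Base) (i : Fin (labelsOf m.L B).length) :
    ((labelsOf m.L B).get i, B) ∈ m.L := by
  have h := List.get_mem (labelsOf m.L B) i
  simp only [labelsOf, List.mem_map, List.mem_filter, decide_eq_true_eq] at h
  obtain ⟨⟨l, B'⟩, ⟨h1, h2⟩, h3⟩ := h
  subst h2
  change l = _ at h3
  rw [h3] at h1
  exact h1

theorem Reg.env_of_mem (m : Reg) {l : Pos} {B : Base} (h : (l, B) ∈ m.L) : m.env l = some B := by
  cases B with
  | qbit => simp [Reg.env, h]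
  | bit =>
    have hq : (l, Base.qbit) ∉ m.L := by
      intro hq
      have := List.inj_on_of_nodup_map m.nodup h hq rfl
      simp at this
    simp [Reg.env, h, hq]

/-- The `i`-th label of type `B`, as a label of the environment. -/
def Reg.label (m : Reg) (B : Base) (i : Fin (labelsOf m.L B).length) : m.env.Idx B :=
  ⟨(labelsOf m.L B).get i, m.env_of_mem (m.mem_L_of_labelsOf B i)⟩

/-- The mixed state of a register: `Q Q†` in the factor of the bits `v`, with coordinates rearranged
from the order of `L` to the labels. -/
noncomputable def Reg.mix (m : Reg) : m.env.Sem := fun w =>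
  (Pi.single m.v 1 : (Fin (labelsOf m.L .bit).length → Bool) → ℂ) (fun i => w (m.label .bit i)) •
    (Matrix.vecMulVec m.Q (star m.Q)).submatrix
      (fun x i => x (m.label .qbit i)) (fun x i => x (m.label .qbit i))

/-- The amplitude of the state on a basis vector given by values for all labels. -/
def Reg.amp (m : Reg) (x : Pos → Bool) : ℂ := m.Q fun i => x ((labelsOf m.L .qbit).get i)

/-- The classical register, as a set of pairs of a label and a value. -/
def Reg.bits (m : Reg) : Set (Pos × Bool) :=
  {e | ∃ i, (labelsOf m.L .bit).get i = e.1 ∧ m.v i = e.2}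

/-- Replacement in `L` of the entry of label `l` by `e`. -/
def substEntry (l : Pos) (e : Pos × Base) (L : List (Pos × Base)) : List (Pos × Base) :=
  L.map fun q => if q.1 = l then e else q

/-- `m'` is obtained from `m` by applying a circuit without measurements. -/
def RegStep : Circ 𝒬 → Reg → Reg → Prop
  | .id, m, m' => m' = m
  | .wire B l r, m, m' =>
      (l, B) ∈ m.L ∧ m'.L = substEntry l (r, B) m.L ∧
      (∀ x, m'.amp x = m.amp (Function.update x l (x r))) ∧
      m'.bits = (fun e => (if e.1 = l then r else e.1, e.2)) '' m.bits
  | .zero r, m, m' =>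
      m'.L = m.L ++ [(r, .bit)] ∧ (∀ x, m'.amp x = m.amp x) ∧ m'.bits = insert (r, false) m.bits
  | .one r, m, m' =>
      m'.L = m.L ++ [(r, .bit)] ∧ (∀ x, m'.amp x = m.amp x) ∧ m'.bits = insert (r, true) m.bits
  | .discard l, m, m' =>
      (l, Base.bit) ∈ m.L ∧ m'.L = m.L.filter (fun e => e.1 ≠ l) ∧
      (∀ x, m'.amp x = m.amp x) ∧ m'.bits = {e ∈ m.bits | e.1 ≠ l}
  | .new l r, m, m' =>
      (l, Base.bit) ∈ m.L ∧ m'.L = substEntry l (r, .qbit) m.L ∧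
      ∃ b, (l, b) ∈ m.bits ∧ (∀ x, m'.amp x = if x r = b then m.amp x else 0) ∧
        m'.bits = m.bits \ {(l, b)}
  | .meas _ _ _, _, _ => False
  | .gate g ls rs, m, m' =>
      (∀ i, (ls i, Base.qbit) ∈ m.L) ∧
      (open Classical in m'.L = m.L.map fun q =>
        if h : ∃ i, ls i = q.1 then (rs h.choose, Base.qbit) else q) ∧
      (∀ x, m'.amp x =
        ∑ a : Fin (𝒬.arity g) → Bool, (𝒬.mat g).1 (fun i => x (rs i)) a * m.amp (setAt ls a x)) ∧
      m'.bits = m.bits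
  | .seq C D, m, m' => ∃ m₁, RegStep C m m₁ ∧ RegStep D m₁ m'

/-- The registers `m' 0`, `m' 1` result from `m` by measuring the qubit `l` into the bit `r`:
if `m` holds the state `λ₀ (Q⁰ ⊗ |0⟩) + λ₁ (Q¹ ⊗ |1⟩)`, the register `m' b` holds `Q^b` and the bit
`b`, and has probability `pr b = |λ_b|²`. -/
def RegMeas (l r : Pos) (m : Reg) (m' : Bool → Reg) (pr : Bool → ℝ) : Prop :=
  (l, Base.qbit) ∈ m.L ∧
  ∃ c : Bool → ℂ, ∀ b,
    (m' b).L = substEntry l (r, .bit) m.L ∧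
    (∀ x, m.amp (Function.update x l b) = c b * (m' b).amp x) ∧
    (m' b).bits = insert (r, b) m.bits ∧
    pr b = ‖c b‖ ^ 2

/-- `m'` is obtained from `m` by removing the value `(l, b)` contained in the classical register. -/
def RegRead (l : Pos) (b : Bool) (m m' : Reg) : Prop :=
  (l, b) ∈ m.bits ∧ m'.L = m.L.filter (fun e => e.1 ≠ l) ∧ (∀ x, m'.amp x = m.amp x) ∧
    m'.bits = m.bits \ {(l, b)}

/-! ## Rules of the machines, and reduction types -/

/-- The tokens after moving one token of address `𝒢` from `σ` to `τ`. -/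
def moveToken (𝒢 : Addr) (σ τ : Pos) (M : Set Token) : Set Token := (M \ {(σ, 𝒢)}) ∪ {(τ, 𝒢)}

/-- The input of an operator with (at most) one input at node `p`. -/
def opIn (p : List ℕ) : Pos := ⟨p, .concl, [false]⟩

/-- The output of an operator with (at most) one output at node `p`. -/
def opOut (p : List ℕ) : Pos := ⟨p, .concl, [true]⟩

/-- The inputs of an `n`-qubit gate at node `p`. -/
def gateIn (p : List ℕ) (n : ℕ) (i : Fin n) : Pos := ⟨p, .concl, false :: tensorPath n i⟩

/-- The outputs of an `n`-qubit gate at node `p`. -/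
def gateOut (p : List ℕ) (n : ℕ) (i : Fin n) : Pos := ⟨p, .concl, true :: tensorPath n i⟩

/-- The operator at a node. -/
def Derivation.opAt (π : Derivation 𝒬) (p : List ℕ) : Option (Op 𝒬) :=
  (π.subAt p).bind Derivation.opOf

/-- A finite, nonempty sequence of structural (including conditional) moves of tokens of address
`𝒢`, and the renaming of wires that it produces. -/
inductive Structural (π : Derivation 𝒬) (𝒢 : Addr) : Set Token → Circ 𝒬 → Set Token → Prop
  | data {M : Set Token} {σ τ : Pos} {B : Base} :
      (σ, 𝒢) ∈ M → π.Link 𝒢 M σ τ (.base B) →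
      Structural π 𝒢 M (.wire B σ τ) (moveToken 𝒢 σ τ M)
  | unit {M : Set Token} {σ τ : Pos} :
      (σ, 𝒢) ∈ M → π.Link 𝒢 M σ τ .unit → Structural π 𝒢 M .id (moveToken 𝒢 σ τ M)
  | trans {M₁ M₂ M₃ : Set Token} {C D : Circ 𝒬} :
      Structural π 𝒢 M₁ C M₂ → Structural π 𝒢 M₂ D M₃ → Structural π 𝒢 M₁ (.seq C D) M₃

/-- The circuit rules other than measurement: the tokens of address `𝒢` on all inputs of an operator
move to its outputs. -/
inductive Fire (π : Derivation 𝒬) (𝒢 : Addr) : Set Token → Circ 𝒬 → Set Token → Prop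
  | zero {M : Set Token} {p : List ℕ} :
      π.opAt p = some .zero → (opIn p, 𝒢) ∈ M →
      Fire π 𝒢 M (.zero (opOut p)) (moveToken 𝒢 (opIn p) (opOut p) M)
  | one {M : Set Token} {p : List ℕ} :
      π.opAt p = some .one → (opIn p, 𝒢) ∈ M →
      Fire π 𝒢 M (.one (opOut p)) (moveToken 𝒢 (opIn p) (opOut p) M)
  | discard {M : Set Token} {p : List ℕ} :
      π.opAt p = some .discard → (opIn p, 𝒢) ∈ M →
      Fire π 𝒢 M (.discard (opIn p)) (moveToken 𝒢 (opIn p) (opOut p) M)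
  | new {M : Set Token} {p : List ℕ} :
      π.opAt p = some .new → (opIn p, 𝒢) ∈ M →
      Fire π 𝒢 M (.new (opIn p) (opOut p)) (moveToken 𝒢 (opIn p) (opOut p) M)
  | gate {M : Set Token} {p : List ℕ} {g : 𝒬.Gate} :
      π.opAt p = some (.gate g) → (∀ i, (gateIn p (𝒬.arity g) i, 𝒢) ∈ M) →
      Fire π 𝒢 M (.gate g (gateIn p (𝒬.arity g)) (gateOut p (𝒬.arity g)))
        ((M \ {t | ∃ i, t = (gateIn p (𝒬.arity g) i, 𝒢)}) ∪
          {t | ∃ i, t = (gateOut p (𝒬.arity g) i, 𝒢)})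

/-- Reduction types: tuples of sets of tokens, of deterministic, choice or pseudo-deterministic
kind, with the gates, the index and labels of the measurement, or the label of the guard. -/
inductive RedType (𝒬 : GateSet)
  | det (M₀ M₁ : Set Token) (c : Circ 𝒬)
  | choice (M₀ M₁ : Set Token) (α : ℕ) (l r : Pos)
  | pseudo (M₀ M₁ M₂ : Set Token) (l : Pos)

/-- The set `M₀`. -/
def RedType.source : RedType 𝒬 → Set Token
  | .det M₀ _ _ => M₀
  | .choice M₀ _ _ _ _ => M₀
  | .pseudo M₀ _ _ _ => M₀

/-- The union of the sets `M₁, …, Mₙ`. -/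
def RedType.target : RedType 𝒬 → Set Token
  | .det _ M₁ _ => M₁
  | .choice _ M₁ _ _ _ => M₁
  | .pseudo _ M₁ M₂ _ => M₁ ∪ M₂

/-- The transformation of the circuit `E@𝒢` associated with a reduction type. -/
def RedType.update : RedType 𝒬 → Circ 𝒬 → ExtCirc 𝒬
  | .det _ _ c, C => .leaf (.seq C c)
  | .choice _ _ α l r, C => .leaf (.seq C (.meas α l r))
  | .pseudo _ _ _ l, C => .node C l (.leaf .id) (.leaf .id)

/-- The tuple is a reduction type for `π` whose tokens `M₀` are at address `𝒢`. -/
def RedType.IsType (π : Derivation 𝒬) (𝒢 : Addr) (a : RedType 𝒬) : Prop :=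
  (∀ t ∈ a.source, t.2 = 𝒢) ∧
  match a with
  | .det M₀ M₁ c => Structural π 𝒢 M₀ c M₁ ∨ Fire π 𝒢 M₀ c M₁
  | .choice M₀ M₁ _ l r =>
      ∃ p, π.opAt p = some .meas ∧ l = opIn p ∧ r = opOut p ∧ (l, 𝒢) ∈ M₀ ∧
        M₁ = moveToken 𝒢 l r M₀
  | .pseudo M₀ M₁ M₂ l =>
      (∃ p ρ, π.subAt p = some ρ ∧ ρ.IsIte ∧ l = guardPos p) ∧ (l, 𝒢) ∈ M₀ ∧ 𝒢 l = none ∧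
        M₁ = (fun t => (t.1, 𝒢.add l false)) '' M₀ ∧ M₂ = (fun t => (t.1, 𝒢.add l true)) '' M₀

/-- The index of a new measurement does not occur in `E`. -/
def RedType.Fresh (E : ExtCirc 𝒬) : RedType 𝒬 → Prop
  | .choice _ _ α _ _ => α ∉ E.measList
  | _ => True

/-! ## The machine QCSIAM -/

/-- The tokens of address `𝒢`. -/
def tokensAt (M : Set Token) (𝒢 : Addr) : Set Token := {t ∈ M | t.2 = 𝒢}

/-- Configurations `(π, M, E)` of the QCSIAM. -/
structure QCConf (π : Derivation 𝒬) where
  tokens : Set Token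
  circ : ExtCirc 𝒬
  occ_ne : ∀ t ∈ tokens, π.occ t.1 ≠ none
  addr_mem : ∀ t ∈ tokens, t.2 ∈ circ.addrs
  wf : circ.WF
  typed : circ.Typed π.inputEnv fun 𝒢 => π.env (tokensAt tokens 𝒢)

/-- The reduction `C →ᵃ_𝒢 D` of the QCSIAM. -/
def QCConf.Step {π : Derivation 𝒬} (a : RedType 𝒬) (𝒢 : Addr) (C D : QCConf π) : Prop :=
  a.IsType π 𝒢 ∧ a.Fresh C.circ ∧ 𝒢 ∈ C.circ.addrs ∧
  tokensAt C.tokens 𝒢 = a.source ∧ D.tokens = (C.tokens \ a.source) ∪ a.target ∧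
  D.circ = C.circ.replaceAt 𝒢 a.update

/-! ## The machine QMSIAM and its parallel reduction -/

/-- Configurations `(π, M, m)` of the QMSIAM: all tokens have the same address, and the register
holds the bits and qubits of the tokens. -/
structure QMConf (π : Derivation 𝒬) where
  tokens : Set Token
  reg : Reg
  occ_ne : ∀ t ∈ tokens, π.occ t.1 ≠ none
  sliced : ∃ 𝒢, ∀ t ∈ tokens, t.2 = 𝒢
  env_eq : reg.env = π.env tokens

/-- Coherent pseudo-distributions of configurations indexed by the super-addresses of `E`. -/
structure CohDist (π : Derivation 𝒬) (E : ExtCirc 𝒬) where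
  conf : E.superAddrs → QMConf π
  prob : E.superAddrs → ℝ
  prob_nonneg : ∀ s, 0 ≤ prob s
  prob_le_one : ∀ s, prob s ≤ 1
  prob_sum : ∑ᶠ s, prob s = 1
  addr_eq : ∀ s, ∀ t ∈ (conf s).tokens, t.2 = s.1.addr
  coherent : ∀ s t, s.1.addr = t.1.addr → (conf s).tokens = (conf t).tokens

/-- The parallel reduction `μ ⇉ᵃ_𝒢 ν` of the QMSIAM. -/
def CohDist.Step {π : Derivation 𝒬} {E F : ExtCirc 𝒬} (a : RedType 𝒬) (𝒢 : Addr)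
    (μ : CohDist π E) (ν : CohDist π F) : Prop :=
  a.IsType π 𝒢 ∧ a.Fresh E ∧ 𝒢 ∈ E.addrs ∧ F = E.replaceAt 𝒢 a.update ∧
  (∀ s (h : s ∈ E.superAddrs), ¬ 𝒢.Sub s.addr →
    ∃ h' : s ∈ F.superAddrs, ν.conf ⟨s, h'⟩ = μ.conf ⟨s, h⟩ ∧ ν.prob ⟨s, h'⟩ = μ.prob ⟨s, h⟩) ∧
  (∀ s (h' : s ∈ F.superAddrs), ¬ 𝒢.Sub s.addr →
    ∃ h : s ∈ E.superAddrs, ν.conf ⟨s, h'⟩ = μ.conf ⟨s, h⟩ ∧ ν.prob ⟨s, h'⟩ = μ.prob ⟨s, h⟩) ∧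
  match a with
  | .det M₀ M₁ c =>
      F.superAddrs = E.superAddrs ∧
      ∀ s (h : s ∈ E.superAddrs), s.addr = 𝒢 → ∃ h' : s ∈ F.superAddrs,
        (μ.conf ⟨s, h⟩).tokens = M₀ ∧ (ν.conf ⟨s, h'⟩).tokens = M₁ ∧
        RegStep c (μ.conf ⟨s, h⟩).reg (ν.conf ⟨s, h'⟩).reg ∧
        ν.prob ⟨s, h'⟩ = μ.prob ⟨s, h⟩
  | .choice M₀ M₁ α l r =>
      F.superAddrs = superExt E.superAddrs 𝒢 (Sum.inr α) ∧
      ∀ s (h : s ∈ E.superAddrs), s.addr = 𝒢 →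
        ∃ (h' : ∀ b, s.add (Sum.inr α) b ∈ F.superAddrs) (pr : Bool → ℝ),
          (μ.conf ⟨s, h⟩).tokens = M₀ ∧ (∀ b, (ν.conf ⟨_, h' b⟩).tokens = M₁) ∧
          RegMeas l r (μ.conf ⟨s, h⟩).reg (fun b => (ν.conf ⟨_, h' b⟩).reg) pr ∧
          ∀ b, ν.prob ⟨_, h' b⟩ = pr b * μ.prob ⟨s, h⟩
  | .pseudo M₀ M₁ M₂ l =>
      F.superAddrs = superExt E.superAddrs 𝒢 (Sum.inl l) ∧
      ∀ s (h : s ∈ E.superAddrs), s.addr = 𝒢 →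
        ∃ (h' : ∀ b, s.add (Sum.inl l) b ∈ F.superAddrs) (b' : Bool),
          (μ.conf ⟨s, h⟩).tokens = M₀ ∧
          (∀ b, (ν.conf ⟨_, h' b⟩).tokens = cond b M₂ M₁) ∧
          (∀ b, RegRead l b' (μ.conf ⟨s, h⟩).reg (ν.conf ⟨_, h' b⟩).reg) ∧
          ∀ b, ν.prob ⟨_, h' b⟩ = if b = b' then μ.prob ⟨s, h⟩ else 0

/-! ## The relation between the two machines -/

/-- The relation `μ ℛ^m_π C`, for a register `m` of the initial state over `π`. -/
structure Rel {π : Derivation 𝒬} {E : ExtCirc 𝒬} (m : Reg) (μ : CohDist π E) (C : QCConf π) :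
    Prop where
  initial : m.env = π.inputEnv
  index : E = C.circ
  token : ∀ s : E.superAddrs, (μ.conf s).tokens = tokensAt C.tokens s.1.addr
  mixed : ∀ s : E.superAddrs,
    (μ.prob s : ℂ) • (μ.conf s).reg.env.embed (μ.conf s).reg.mix = E.slice s.1 (m.env.embed m.mix)

end QSIAM

/-! A reduction acts on one leaf of the extended circuit and on the registers over that leaf. The
heart of the matter is a local commutation. Transforming the leaf at `𝒢` composes `E.slice s` with
the map of the new gate, the projected measurement or the guard projection (`slice_append`,
`slice_meas`, `slice_branch`), and the machine step composes the mixed state of a register with the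
same map. The latter is a pointwise computation: by `Reg.embed_mix` a mixed state is `amp x * conj
(amp y)` on the valuations that agree with the classical register and zero elsewhere, which gives
`RegStep.mix_eq`, `RegMeas.mix_eq` and `RegRead.mix_eq`. Since slices are homogeneous, the weight
`μ_s` is carried along, and an outcome probability is exactly the scalar lost by normalizing.

From circuits to registers, the new registers must be shown to exist. Typing of circuits is
functional, so comparing the typings of the old and new extended circuits types the added gate
between the environments of the tokens before and after (`ExtCirc.Typed.exists_leaf`). A register
over the input of a well-typed gate can always be stepped (`RegStep.exists_of_typed`,
`RegMeas.exists_of_typed`, `Reg.exists_read`); normalization is a sum over qubit labels, preserved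
by renamings, by initialization and by unitaries, and split in two by a measurement.

From registers to circuits, the new extended circuit must be shown to be well typed. Here the
register step itself types the gate (`RegStep.typed`, `RegMeas.typed`, `RegRead.typed`), and one
super-address over `𝒢`, which exists by `ExtCirc.exists_superAddr`, supplies all that is needed.

The rest is bookkeeping of addresses. The addresses of an extended circuit form an antichain
(`ExtCirc.eq_of_sub`), so nothing changes away from `𝒢`, and over `𝒢` each super-address is kept or
split into two whose weights add up to the old one (`finsum_superExt`). -/

namespace QSIAM

variable {𝒬 : GateSet}

/-! ## Sums over the values of finitely many labels -/

/-- The sum of `f` over all assignments of values to the labels in `S`, the other labels having the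
value `false`. -/
def labelSum {R : Type*} [AddCommMonoid R] (S : Finset Pos) (f : (Pos → Bool) → R) : R :=
  ∑ t ∈ S.powerset, f fun l => decide (l ∈ t)

theorem setAt_apply {n : ℕ} {ls : Fin n → Pos} (h : Function.Injective ls) (a : Fin n → Bool)
    (x : Pos → Bool) (i : Fin n) : setAt ls a x (ls i) = a i := by
  have hi : ∃ j, ls j = ls i := ⟨i, rfl⟩
  simp only [setAt, dif_pos hi]
  rw [h hi.choose_spec]

theorem setAt_of_notMem {n : ℕ} {ls : Fin n → Pos} (a : Fin n → Bool) (x : Pos → Bool) {l : Pos}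
    (h : ∀ i, ls i ≠ l) : setAt ls a x l = x l := by
  simp [setAt, h]

theorem labelSum_congr {R : Type*} [AddCommMonoid R] {S : Finset Pos} {f g : (Pos → Bool) → R}
    (h : ∀ x, f x = g x) : labelSum S f = labelSum S g :=
  Finset.sum_congr rfl fun _ _ => h _

theorem labelSum_insert {R : Type*} [AddCommMonoid R] {S : Finset Pos} {r : Pos} (h : r ∉ S)
    (f : (Pos → Bool) → R) :
    labelSum (insert r S) f =
      labelSum S fun x => f (Function.update x r false) + f (Function.update x r true) := by
  unfold labelSum
  rw [Finset.sum_powerset_insert h, ← Finset.sum_add_distrib]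
  refine Finset.sum_congr rfl fun t ht => ?_
  have hr : r ∉ t := fun hr => h (Finset.mem_powerset.1 ht hr)
  congr 2
  · funext l
    by_cases hl : l = r
    · subst hl; simp [hr]
    · simp [hl]
  · funext l
    by_cases hl : l = r
    · subst hl; simp
    · simp [hl]

/-- A subset of the enlarged label set is a subset of `S` together with a bit string along `rs`.
This isolates the block of qubits on which a gate acts. -/
theorem labelSum_union_image {R : Type*} [AddCommMonoid R] {n : ℕ} {S : Finset Pos}
    {rs : Fin n → Pos} (hrs : Function.Injective rs) (hS : ∀ i, rs i ∉ S)
    (f : (Pos → Bool) → R) :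
    labelSum (S ∪ Finset.univ.image rs) f =
      labelSum S fun x => ∑ b : Fin n → Bool, f (setAt rs b x) := by
  unfold labelSum
  rw [← Finset.sum_product']
  symm
  refine Finset.sum_nbij' (fun q => q.1 ∪ (Finset.univ.filter fun i => q.2 i = true).image rs)
    (fun u => (u ∩ S, fun i => decide (rs i ∈ u))) ?_ ?_ ?_ ?_ ?_
  · rintro ⟨t, b⟩ h
    simp only [Finset.mem_product, Finset.mem_powerset, Finset.mem_univ, and_true] at h
    exact Finset.mem_powerset.2 (Finset.union_subset_union h
      (Finset.image_subset_image (Finset.filter_subset _ _)))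
  · intro u _
    simp [Finset.inter_subset_right]
  · rintro ⟨t, b⟩ h
    simp only [Finset.mem_product, Finset.mem_powerset, Finset.mem_univ, and_true] at h
    ext z
    · simp only [Finset.mem_inter, Finset.mem_union, Finset.mem_image, Finset.mem_filter,
        Finset.mem_univ, true_and]
      constructor
      · rintro ⟨hz | ⟨i, -, rfl⟩, hz'⟩
        · exact hz
        · exact absurd hz' (hS i)
      · exact fun hz => ⟨Or.inl hz, h hz⟩
    · have : rs z ∉ t := fun hz => hS z (h hz)
      simp [this, hrs.eq_iff]
  · intro u hu
    have hu := Finset.mem_powerset.1 hu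
    ext z
    simp only [Finset.mem_inter, Finset.mem_union, Finset.mem_image, Finset.mem_filter,
        Finset.mem_univ, true_and, decide_eq_true_eq]
    constructor
    · rintro (hz | ⟨i, hi, rfl⟩)
      · exact hz.1
      · exact hi
    · intro hz
      rcases Finset.mem_union.1 (hu hz) with h | h
      · exact Or.inl ⟨hz, h⟩
      · obtain ⟨i, -, rfl⟩ := Finset.mem_image.1 h
        exact Or.inr ⟨i, hz, rfl⟩
  · rintro ⟨t, b⟩ h
    simp only [Finset.mem_product, Finset.mem_powerset, Finset.mem_univ, and_true] at h
    congr 1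
    funext l
    by_cases hl : ∃ i, rs i = l
    · obtain ⟨i, rfl⟩ := hl
      have : rs i ∉ t := fun hz => hS i (h hz)
      rw [setAt_apply hrs]
      simp [this, hrs.eq_iff]
    · push Not at hl
      rw [setAt_of_notMem _ _ hl]
      simp [hl]

theorem labelSum_image {R : Type*} [AddCommMonoid R] {n : ℕ} {rs : Fin n → Pos}
    (hrs : Function.Injective rs) (f : (Pos → Bool) → R) :
    labelSum (Finset.univ.image rs) f = ∑ b : Fin n → Bool, f (setAt rs b fun _ => false) := by
  have h := labelSum_union_image (S := ∅) hrs (fun i => Finset.notMem_empty _) f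
  rw [Finset.empty_union] at h
  rw [h]
  simp [labelSum]

/-- The squared norm is `φ†φ`, and `U†U = 1` cancels in the middle. It is applied to the qubits
touched by a gate while all others are held fixed. -/
theorem sum_norm_sq_unitary {n : Type*} [Fintype n] [DecidableEq n]
    (U : Matrix.unitaryGroup n ℂ) (ψ : n → ℂ) :
    ∑ b, ‖∑ a, U.1 b a * ψ a‖ ^ 2 = ∑ a, ‖ψ a‖ ^ 2 := by
  have key : ∀ φ : n → ℂ, ((∑ a, ‖φ a‖ ^ 2 : ℝ) : ℂ) = star φ ⬝ᵥ φ := by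
    intro φ
    simp only [dotProduct, Pi.star_apply, RCLike.star_def, Complex.conj_mul']
    push_cast
    rfl
  have h := key (U.1.mulVec ψ)
  rw [Matrix.star_mulVec, Matrix.dotProduct_mulVec, Matrix.vecMul_vecMul,
    ← Matrix.star_eq_conjTranspose, Matrix.UnitaryGroup.star_mul_self, Matrix.vecMul_one,
    ← key] at h
  exact_mod_cast h

/-! ## Registers in terms of labels -/

theorem mem_labelsOf {L : List (Pos × Base)} {B : Base} {l : Pos} :
    l ∈ labelsOf L B ↔ (l, B) ∈ L := by
  simp [labelsOf]

theorem nodup_labelsOf {L : List (Pos × Base)} (h : (L.map Prod.fst).Nodup) (B : Base) :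
    (labelsOf L B).Nodup :=
  h.sublist (List.filter_sublist.map _)

theorem Reg.env_eq_some_iff (m : Reg) {l : Pos} {B : Base} : m.env l = some B ↔ (l, B) ∈ m.L := by
  refine ⟨fun h => ?_, m.env_of_mem⟩
  unfold Reg.env at h
  split_ifs at h with h1 h2
  · cases h; exact h1
  · cases h; exact h2

theorem Reg.amp_congr (m : Reg) {x y : Pos → Bool} (h : ∀ l, (l, Base.qbit) ∈ m.L → x l = y l) :
    m.amp x = m.amp y := by
  unfold Reg.amp
  congr 1
  funext i
  exact h _ (m.mem_L_of_labelsOf _ i)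

theorem Reg.amp_update (m : Reg) {l : Pos} (h : (l, Base.qbit) ∉ m.L) (x : Pos → Bool) (b : Bool) :
    m.amp (Function.update x l b) = m.amp x := by
  refine m.amp_congr fun k hk => ?_
  rw [Function.update_of_ne]
  rintro rfl
  exact h hk

/-- The qubit labels of a list of assignments. -/
def qubits (L : List (Pos × Base)) : Finset Pos := (labelsOf L .qbit).toFinset

theorem mem_qubits {L : List (Pos × Base)} {l : Pos} : l ∈ qubits L ↔ (l, Base.qbit) ∈ L := by
  simp [qubits, mem_labelsOf]

theorem labelSum_qubits {L : List (Pos × Base)} (hL : (L.map Prod.fst).Nodup)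
    (f : (Pos → Bool) → ℝ) :
    labelSum (qubits L) f = ∑ z, f (setAt (labelsOf L .qbit).get z fun _ => false) := by
  rw [← labelSum_image (List.nodup_iff_injective_get.1 (nodup_labelsOf hL _))]
  congr 1
  ext l
  simp [qubits, List.mem_iff_get]

theorem Reg.labelSum_amp (m : Reg) : labelSum (qubits m.L) (fun x => ‖m.amp x‖ ^ 2) = 1 := by
  rw [labelSum_qubits m.nodup, ← m.norm_eq]
  refine Finset.sum_congr rfl fun z _ => ?_
  unfold Reg.amp
  congr 3
  funext i
  rw [setAt_apply (List.nodup_iff_injective_get.1 (nodup_labelsOf m.nodup _))]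

/-- The labels of a register are distinct, so its classical part is the graph of a function on the
bit labels. This turns later operations on bits into updates of `V`. -/
theorem Reg.exists_bits (m : Reg) :
    ∃ V : Pos → Bool, m.bits = {e | (e.1, Base.bit) ∈ m.L ∧ e.2 = V e.1} := by
  have inj := List.nodup_iff_injective_get.1 (nodup_labelsOf m.nodup .bit)
  refine ⟨setAt (labelsOf m.L .bit).get m.v fun _ => false, ?_⟩
  ext ⟨l, b⟩
  simp only [Reg.bits, Set.mem_ofPred_eq]
  constructor
  · rintro ⟨i, rfl, rfl⟩
    exact ⟨m.mem_L_of_labelsOf _ i, (setAt_apply inj _ _ i).symm⟩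
  · rintro ⟨h, rfl⟩
    obtain ⟨i, rfl⟩ := List.mem_iff_get.1 (mem_labelsOf.2 h)
    exact ⟨i, rfl, (setAt_apply inj _ _ i).symm⟩

/-- Every new register is built from this: once amplitudes are functions of labels, the order of the
list matters no more, and only dependence on the qubit labels and total norm 1 have to be checked.
-/
theorem Reg.exists_of_amp {L : List (Pos × Base)} (hL : (L.map Prod.fst).Nodup)
    {A : (Pos → Bool) → ℂ} (hA : ∀ x y, (∀ l, (l, Base.qbit) ∈ L → x l = y l) → A x = A y)
    (hN : labelSum (qubits L) (fun x => ‖A x‖ ^ 2) = 1) (V : Pos → Bool) :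
    ∃ m : Reg, m.L = L ∧ (∀ x, m.amp x = A x) ∧
      m.bits = {e | (e.1, Base.bit) ∈ L ∧ e.2 = V e.1} := by
  have inj := List.nodup_iff_injective_get.1 (nodup_labelsOf hL .qbit)
  refine ⟨⟨L, hL, fun z => A (setAt (labelsOf L .qbit).get z fun _ => false), ?_,
    fun i => V ((labelsOf L .bit).get i)⟩, rfl, ?_, ?_⟩
  · rw [← labelSum_qubits hL fun x => ‖A x‖ ^ 2, hN]
  · intro x
    refine hA _ _ fun l hl => ?_
    obtain ⟨i, rfl⟩ := List.mem_iff_get.1 (mem_labelsOf.2 hl)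
    exact setAt_apply inj _ _ i
  · ext ⟨l, b⟩
    simp only [Reg.bits, Set.mem_ofPred_eq]
    constructor
    · rintro ⟨i, rfl, rfl⟩
      exact ⟨mem_labelsOf.1 (List.get_mem _ i), rfl⟩
    · rintro ⟨h, rfl⟩
      obtain ⟨i, rfl⟩ := List.mem_iff_get.1 (mem_labelsOf.2 h)
      exact ⟨i, rfl, rfl⟩

/-- The condition `P` is left free up to equivalence, so that each use can state agreement with the
classical register in the shape in which the map of the gate produces it. -/
theorem Reg.embed_mix (m : Reg) (v x y : Pos → Bool) {P : Prop} [Decidable P]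
    (hP : P ↔ ∀ e ∈ m.bits, v e.1 = e.2) :
    m.env.embed m.mix v x y = if P then m.amp x * starRingEnd ℂ (m.amp y) else 0 := by
  have h : (∀ e ∈ m.bits, v e.1 = e.2) ↔ (fun i => v ((labelsOf m.L .bit).get i)) = m.v := by
    constructor
    · intro h
      funext i
      exact h ((labelsOf m.L .bit).get i, m.v i) ⟨i, rfl, rfl⟩
    · rintro h ⟨l, b⟩ ⟨i, rfl, rfl⟩
      exact congrFun h i
  rw [if_congr (hP.trans h) rfl rfl]
  unfold Env.embed Reg.mix Reg.amp
  simp only [Matrix.smul_apply, Matrix.submatrix_apply, Matrix.vecMulVec_apply, Pi.star_apply,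
    smul_eq_mul, Reg.label, RCLike.star_def]
  rw [Pi.single_apply, ite_mul, one_mul, zero_mul]

/-! ## Typing of gates -/

theorem Env.IsUnion.left_unique {Γ Θ Θ' : Env} {xs : List (Pos × Base)} (h : Γ.IsUnion Θ xs)
    (h' : Γ.IsUnion Θ' xs) : Θ = Θ' := by
  funext l
  by_cases hl : l ∈ xs.map Prod.fst
  · obtain ⟨e, he, rfl⟩ := List.mem_map.1 hl
    rw [(h.2.1 e he).1, (h'.2.1 e he).1]
  · rw [← h.2.2 l hl, h'.2.2 l hl]

theorem Env.IsUnion.unique {Γ Γ' Θ : Env} {xs : List (Pos × Base)} (h : Γ.IsUnion Θ xs)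
    (h' : Γ'.IsUnion Θ xs) : Γ = Γ' := by
  funext l
  by_cases hl : l ∈ xs.map Prod.fst
  · obtain ⟨e, he, rfl⟩ := List.mem_map.1 hl
    rw [(h.2.1 e he).2, (h'.2.1 e he).2]
  · rw [h.2.2 l hl, h'.2.2 l hl]

theorem GateTyped.unique {Γ Δ Δ' : Env} {ins outs : List (Pos × Base)}
    (h : GateTyped Γ ins outs Δ) (h' : GateTyped Γ ins outs Δ') : Δ = Δ' := by
  obtain ⟨Θ, h1, h2⟩ := h
  obtain ⟨Θ', h1', h2'⟩ := h'
  obtain rfl := h1.left_unique h1'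
  exact h2.unique h2'

/-- The untouched part `Θ` is determined by the input environment, and it determines the output.
Hence the environment of a stepped register never has to be computed: it is whatever the typing
says. -/
theorem Circ.Typed.unique {C : Circ 𝒬} {Γ Δ Δ' : Env} (h : C.Typed Γ Δ) (h' : C.Typed Γ Δ') :
    Δ = Δ' := by
  induction C generalizing Γ Δ Δ' with
  | id => exact h.trans h'.symm
  | seq C D ihC ihD =>
    obtain ⟨Ψ, h1, h2⟩ := h
    obtain ⟨Ψ', h1', h2'⟩ := h'
    obtain rfl := ihC h1 h1'
    exact ihD h2 h2'
  | _ => exact GateTyped.unique h h'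

theorem isUnion_of_perm {m : Reg} {xs K : List (Pos × Base)} (h : m.L.Perm (xs ++ K)) {Θ : Env}
    (hΘ : ∀ l B, Θ l = some B ↔ (l, B) ∈ K) : m.env.IsUnion Θ xs := by
  have hn : ((xs ++ K).map Prod.fst).Nodup := (h.map Prod.fst).nodup_iff.1 m.nodup
  rw [List.map_append, List.nodup_append'] at hn
  have hd : ∀ l B, (l, B) ∈ K → l ∉ xs.map Prod.fst := fun l B hl hx =>
    hn.2.2 hx (List.mem_map.2 ⟨_, hl, rfl⟩)
  refine ⟨hn.1, fun e he => ⟨?_, ?_⟩, fun l hl => ?_⟩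
  · rw [Option.eq_none_iff_forall_ne_some]
    intro B hB
    exact hd _ _ ((hΘ _ _).1 hB) (List.mem_map.2 ⟨e, he, rfl⟩)
  · exact m.env_eq_some_iff.2 (h.mem_iff.2 (List.mem_append.2 (Or.inl he)))
  · refine Option.ext fun B => ?_
    rw [m.env_eq_some_iff, hΘ, h.mem_iff, List.mem_append]
    exact or_iff_right fun hx => hl (List.mem_map.2 ⟨_, hx, rfl⟩)

theorem gateTyped_of_perm {m m' : Reg} {ins outs K : List (Pos × Base)}
    (h : m.L.Perm (ins ++ K)) (h' : m'.L.Perm (outs ++ K)) :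
    GateTyped m.env ins outs m'.env := by
  have hn : (K.map Prod.fst).Nodup := by
    have := (h.map Prod.fst).nodup_iff.1 m.nodup
    rw [List.map_append, List.nodup_append'] at this
    exact this.2.1
  -- The environment of the untouched entries `K`, common to both registers; it serves as the `Θ` of
  -- the gate typing.
  let m₀ : Env := fun l =>
    if (l, Base.qbit) ∈ K then some .qbit else if (l, Base.bit) ∈ K then some .bit else none
  have hm₀ : ∀ l B, m₀ l = some B ↔ (l, B) ∈ K := by
    intro l B
    have : ¬ ((l, Base.qbit) ∈ K ∧ (l, Base.bit) ∈ K) := by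
      rintro ⟨h1, h2⟩
      simpa using List.inj_on_of_nodup_map hn h1 h2 rfl
    simp only [m₀]
    cases B <;> split_ifs <;> simp_all
  exact ⟨m₀, isUnion_of_perm h hm₀, isUnion_of_perm h' hm₀⟩

/-! ### Label lists before and after a gate -/

/-- The entries of a list of assignments with a label other than those in `xs`. -/
def others (xs L : List (Pos × Base)) : List (Pos × Base) :=
  L.filter fun e => e.1 ∉ xs.map Prod.fst

theorem perm_append_others {L xs : List (Pos × Base)} (hL : (L.map Prod.fst).Nodup)
    (hn : (xs.map Prod.fst).Nodup) (h : ∀ e ∈ xs, e ∈ L) : L.Perm (xs ++ others xs L) := by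
  rw [List.perm_ext_iff_of_nodup hL.of_map]
  · intro e
    simp only [others, List.mem_append, List.mem_filter, decide_eq_true_eq]
    constructor
    · intro he
      by_cases hx : e.1 ∈ xs.map Prod.fst
      · obtain ⟨e', he', hee⟩ := List.mem_map.1 hx
        obtain rfl := List.inj_on_of_nodup_map hL (h _ he') he hee
        exact Or.inl he'
      · exact Or.inr ⟨he, hx⟩
    · rintro (he | he)
      · exact h _ he
      · exact he.1
  · rw [List.nodup_append']
    refine ⟨hn.of_map, hL.of_map.filter _, fun e he he' => ?_⟩
    simp only [others, List.mem_filter, decide_eq_true_eq] at he'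
    exact he'.2 (List.mem_map.2 ⟨e, he, rfl⟩)

/-- Typing translated into lists: the inputs can be brought to the front, and the outputs clash with
none of the remaining entries. This freshness is what makes the new list of labels legal. -/
theorem GateTyped.perm {m : Reg} {ins outs : List (Pos × Base)} {Δ : Env}
    (h : GateTyped m.env ins outs Δ) :
    m.L.Perm (ins ++ others ins m.L) ∧ ((outs ++ others ins m.L).map Prod.fst).Nodup := by
  obtain ⟨Θ, h1, h2⟩ := h
  have hp := perm_append_others m.nodup h1.1 fun e he => m.env_eq_some_iff.1 (h1.2.1 e he).2
  refine ⟨hp, ?_⟩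
  have hn := (hp.map Prod.fst).nodup_iff.1 m.nodup
  rw [List.map_append, List.nodup_append'] at hn ⊢
  refine ⟨h2.1, hn.2.1, fun l hl hl' => ?_⟩
  obtain ⟨e, he, rfl⟩ := List.mem_map.1 hl
  obtain ⟨k, hk, hke⟩ := List.mem_map.1 hl'
  simp only [others, List.mem_filter, decide_eq_true_eq] at hk
  -- An output carrying the label of an untouched entry is impossible: `Θ` is undefined on outputs,
  -- yet agrees with the register away from the inputs.
  have := h1.2.2 _ hk.2
  rw [hke, (h2.2.1 e he).1, ← hke, m.env_of_mem hk.1] at this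
  simp at this

theorem substEntry_perm {L K : List (Pos × Base)} {l : Pos} {B : Base} (e : Pos × Base)
    (hL : (L.map Prod.fst).Nodup) (h : L.Perm ([(l, B)] ++ K)) :
    (substEntry l e L).Perm ([e] ++ K) := by
  have hn := (h.map Prod.fst).nodup_iff.1 hL
  simp only [List.cons_append, List.nil_append, List.map_cons, List.nodup_cons] at hn
  refine (h.map _).trans ?_
  simp only [List.cons_append, List.nil_append, List.map_cons, if_true]
  refine List.Perm.cons _ (List.Perm.of_eq ?_)
  conv_rhs => rw [← List.map_id K]
  refine List.map_congr_left fun k hk => if_neg ?_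
  rintro rfl
  exact hn.1 (List.mem_map.2 ⟨k, hk, rfl⟩)

theorem filter_ne_perm {L K : List (Pos × Base)} {l : Pos} {B : Base}
    (hL : (L.map Prod.fst).Nodup) (h : L.Perm ([(l, B)] ++ K)) :
    (L.filter fun e => e.1 ≠ l).Perm K := by
  have hn := (h.map Prod.fst).nodup_iff.1 hL
  simp only [List.cons_append, List.nil_append, List.map_cons, List.nodup_cons] at hn
  refine (h.filter _).trans (List.Perm.of_eq ?_)
  simp only [List.cons_append, List.nil_append]
  rw [List.filter_cons_of_neg (by simp), List.filter_eq_self]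
  intro k hk
  simp only [ne_eq, decide_eq_true_eq]
  rintro rfl
  exact hn.1 (List.mem_map.2 ⟨k, hk, rfl⟩)

open Classical in
theorem gateEntries_perm {n : ℕ} {ls rs : Fin n → Pos} (hls : Function.Injective ls)
    {L K : List (Pos × Base)} (hL : (L.map Prod.fst).Nodup)
    (h : L.Perm ((List.ofFn fun i => (ls i, Base.qbit)) ++ K)) :
    (L.map fun q => if h : ∃ i, ls i = q.1 then (rs h.choose, Base.qbit) else q).Perm
      ((List.ofFn fun i => (rs i, Base.qbit)) ++ K) := by
  have hn := (h.map Prod.fst).nodup_iff.1 hL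
  rw [List.map_append, List.nodup_append'] at hn
  refine (h.map _).trans (List.Perm.of_eq ?_)
  rw [List.map_append, List.map_ofFn]
  congr 1
  · congr 1
    funext i
    have hi : ∃ j, ls j = ls i := ⟨i, rfl⟩
    simp only [Function.comp, dif_pos hi]
    rw [hls hi.choose_spec]
  · conv_rhs => rw [← List.map_id K]
    refine List.map_congr_left fun k hk => dif_neg ?_
    rintro ⟨i, hi⟩
    have hmem : k.1 ∈ (List.ofFn fun i => (ls i, Base.qbit)).map Prod.fst := by
      rw [List.map_ofFn, List.mem_ofFn]
      exact ⟨i, hi⟩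
    exact hn.2.2 hmem (List.mem_map.2 ⟨k, hk, rfl⟩)

theorem nodup_of_perm {L M : List (Pos × Base)} (h : L.Perm M) (hM : (M.map Prod.fst).Nodup) :
    (L.map Prod.fst).Nodup :=
  (h.map Prod.fst).nodup_iff.2 hM

theorem Reg.perm_single (m : Reg) {l : Pos} {B : Base} (h : (l, B) ∈ m.L) :
    m.L.Perm ([(l, B)] ++ others [(l, B)] m.L) :=
  perm_append_others m.nodup (by simp) (by simpa using h)

/-- All gates of a circuit have pairwise distinct inputs. -/
def Circ.InputsInjective : Circ 𝒬 → Prop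
  | .gate _ ls _ => Function.Injective ls
  | .seq C D => C.InputsInjective ∧ D.InputsInjective
  | _ => True

/-- Freshness of the outputs comes for free, because `m'` is a register and its labels are distinct.
Distinctness of the inputs of a gate does not, whence the hypothesis `hc`. -/
theorem RegStep.typed {c : Circ 𝒬} {m m' : Reg} (hc : c.InputsInjective) (h : RegStep c m m') :
    c.Typed m.env m'.env := by
  induction c generalizing m m' with
  | id => exact congrArg Reg.env h
  | wire B l r =>
    have hp := m.perm_single h.1
    exact gateTyped_of_perm hp (h.2.1 ▸ substEntry_perm _ m.nodup hp)
  | zero r => exact gateTyped_of_perm (K := m.L) (.refl _) (h.1 ▸ List.perm_append_comm)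
  | one r => exact gateTyped_of_perm (K := m.L) (.refl _) (h.1 ▸ List.perm_append_comm)
  | discard l =>
    have hp := m.perm_single h.1
    exact gateTyped_of_perm hp (h.2.1 ▸ filter_ne_perm m.nodup hp)
  | new l r =>
    have hp := m.perm_single h.1
    exact gateTyped_of_perm hp (h.2.1 ▸ substEntry_perm _ m.nodup hp)
  | meas α l r => exact h.elim
  | gate g ls rs =>
    have hn : ((List.ofFn fun i => (ls i, Base.qbit)).map Prod.fst).Nodup := by
      rw [List.map_ofFn, List.nodup_ofFn]
      exact hc
    have hp := perm_append_others m.nodup hn fun e he => by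
      obtain ⟨i, rfl⟩ := List.mem_ofFn.1 he
      exact h.1 i
    exact gateTyped_of_perm hp (h.2.1 ▸ gateEntries_perm hc m.nodup hp)
  | seq C D ihC ihD =>
    obtain ⟨m₁, h1, h2⟩ := h
    exact ⟨_, ihC hc.1 h1, ihD hc.2 h2⟩

theorem RegMeas.typed {l r : Pos} {m : Reg} {m' : Bool → Reg} {pr : Bool → ℝ}
    (h : RegMeas l r m m' pr) (b : Bool) :
    GateTyped m.env [(l, .qbit)] [(r, .bit)] (m' b).env := by
  have hp := m.perm_single h.1
  obtain ⟨c, hc⟩ := h.2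
  exact gateTyped_of_perm hp ((hc b).1 ▸ substEntry_perm _ m.nodup hp)

theorem Reg.mem_of_mem_bits {m : Reg} {l : Pos} {b : Bool} (h : (l, b) ∈ m.bits) :
    (l, Base.bit) ∈ m.L := by
  obtain ⟨V, hV⟩ := m.exists_bits
  rw [hV] at h
  exact h.1

theorem RegRead.typed {l : Pos} {b : Bool} {m m' : Reg} (h : RegRead l b m m') :
    GateTyped m.env [(l, .bit)] [] m'.env := by
  have hp := m.perm_single (Reg.mem_of_mem_bits h.1)
  exact gateTyped_of_perm hp (h.2.1 ▸ filter_ne_perm m.nodup hp)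

theorem RegRead.env_eq {l : Pos} {b : Bool} {m m' : Reg} (h : RegRead l b m m') :
    m'.env = m.env.remove l := by
  obtain ⟨Θ, h1, h2⟩ := h.typed
  funext k
  rw [h2.2.2 k (by simp)]
  by_cases hk : k = l
  · subst hk
    rw [(h1.2.1 (k, .bit) (by simp)).1, Env.remove, Function.update_self]
  · rw [Env.remove, Function.update_of_ne hk, h1.2.2 k (by simpa using hk)]

/-! ## Registers and completely positive maps -/

/-- Homogeneity is the only part of linearity needed: it lets the probability of a configuration
pass through the gate. -/
theorem Circ.slice_smul (s : SAddr) (C : Circ 𝒬) (c : ℂ) (ρ : St) :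
    C.slice s (c • ρ) = c • C.slice s ρ := by
  induction C generalizing ρ with
  | wire B l r => cases B <;> rfl
  | seq C D ihC ihD => simp only [Circ.slice, ihC, ihD]
  | id => rfl
  | gate g ls rs =>
    funext v x y
    simp only [Circ.slice, Pi.smul_apply, smul_eq_mul, Finset.mul_sum]
    refine Finset.sum_congr rfl fun a _ => Finset.sum_congr rfl fun b _ => ?_
    ring
  | discard l =>
    funext v x y
    simp only [Circ.slice, Pi.smul_apply, smul_eq_mul]
    ring
  | meas α l r =>
    funext v x y
    simp only [Circ.slice, Pi.smul_apply, smul_eq_mul]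
    split <;> simp
  | _ =>
    funext v x y
    simp only [Circ.slice, Pi.smul_apply, smul_eq_mul, mul_ite, mul_zero]

/-- The values `v` agree with the classical register of `m`. -/
def Reg.Agrees (m : Reg) (v : Pos → Bool) : Prop := ∀ e ∈ m.bits, v e.1 = e.2

theorem forall_mem_insert_iff {S : Set (Pos × Bool)} {r : Pos} {b : Bool} {v : Pos → Bool} :
    (∀ e ∈ insert (r, b) S, v e.1 = e.2) ↔ v r = b ∧ ∀ e ∈ S, v e.1 = e.2 := by
  simp

/-- A label holds only one value in the classical register. This is the common computation behind
discarding a bit, initializing a qubit and reading a guard. -/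
theorem Reg.agrees_update_iff {m : Reg} {l : Pos} {b : Bool} (h : (l, b) ∈ m.bits)
    (v : Pos → Bool) (b' : Bool) :
    m.Agrees (Function.update v l b') ↔ b' = b ∧ ∀ e ∈ m.bits \ {(l, b)}, v e.1 = e.2 := by
  have huniq : ∀ e ∈ m.bits, e.1 = l → e = (l, b) := by
    obtain ⟨V, hV⟩ := m.exists_bits
    rw [hV] at h ⊢
    rintro ⟨k, c⟩ ⟨-, h2⟩ rfl
    exact Prod.ext rfl (h2.trans h.2.symm)
  constructor
  · intro H
    refine ⟨by simpa using H _ h, fun e he => ?_⟩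
    have := H e he.1
    rwa [Function.update_of_ne] at this
    exact fun hl => he.2 (huniq e he.1 hl)
  · rintro ⟨rfl, H⟩ e he
    by_cases hl : e.1 = l
    · rw [huniq e he hl]; simp
    · rw [Function.update_of_ne hl]
      exact H e ⟨he, fun h => hl (by rw [h])⟩

theorem Reg.exists_mem_bits {m : Reg} {l : Pos} (h : (l, Base.bit) ∈ m.L) :
    ∃ b, (l, b) ∈ m.bits := by
  obtain ⟨V, hV⟩ := m.exists_bits
  exact ⟨V l, by rw [hV]; exact ⟨h, rfl⟩⟩

theorem Reg.bits_ne {m : Reg} {l : Pos} {b : Bool} (h : (l, b) ∈ m.bits) :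
    {e ∈ m.bits | e.1 ≠ l} = m.bits \ {(l, b)} := by
  obtain ⟨V, hV⟩ := m.exists_bits
  rw [hV] at h ⊢
  ext ⟨k, c⟩
  simp only [Set.mem_ofPred_eq, Set.mem_sdiff, Set.mem_singleton_iff, Prod.mk.injEq] at h ⊢
  constructor
  · rintro ⟨h1, h2⟩
    exact ⟨h1, fun h => h2 h.1⟩
  · rintro ⟨h1, h2⟩
    refine ⟨h1, ?_⟩
    rintro rfl
    exact h2 ⟨rfl, h1.2.trans h.2.symm⟩

theorem not_both_types {m : Reg} {l : Pos} (h : (l, Base.qbit) ∈ m.L) : (l, Base.bit) ∉ m.L := by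
  intro h'
  simpa using List.inj_on_of_nodup_map m.nodup h h' rfl

/-- Both sides are compared at each valuation, row and column; typing plays no role. For a gate, the
amplitude formula for the row and its conjugate for the column multiply to the double sum of
conjugation by the unitary. -/
theorem RegStep.mix_eq {c : Circ 𝒬} {m m' : Reg} (h : RegStep c m m') (s : SAddr) :
    m'.env.embed m'.mix = c.slice s (m.env.embed m.mix) := by
  classical
  induction c generalizing m m' with
  | id => rw [show m' = m from h]; rfl
  | wire B l r =>
    obtain ⟨hl, -, hA, hb⟩ := h
    funext v x y
    -- One condition serves both types of wire: for a bit the change of rows and columns at `l` is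
    -- void, for a qubit the change of `v` at `l` is void.
    rw [m'.embed_mix v x y (P := m.Agrees (Function.update v l (v r))), hA, hA]
    · cases B with
      | bit =>
        have hq : (l, Base.qbit) ∉ m.L := fun h => not_both_types h hl
        rw [m.amp_update hq, m.amp_update hq]
        exact (m.embed_mix _ _ _ Iff.rfl).symm
      | qbit =>
        refine (m.embed_mix _ _ _ ?_).symm
        refine forall₂_congr fun e he => ?_
        rw [Function.update_of_ne]
        rintro rfl
        exact not_both_types hl (Reg.mem_of_mem_bits he)
    · rw [hb, Set.forall_mem_image]
      refine forall₂_congr fun e he => ?_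
      by_cases hl : e.1 = l
      · simp [hl]
      · simp [hl]
  | zero r =>
    obtain ⟨-, hA, hb⟩ := h
    funext v x y
    rw [m'.embed_mix v x y (P := v r = false ∧ m.Agrees v) (by
      rw [hb, forall_mem_insert_iff]; rfl), hA, hA, ite_and]
    simp only [Circ.slice]
    rw [m.embed_mix v x y (P := m.Agrees v) Iff.rfl]
  | one r =>
    obtain ⟨-, hA, hb⟩ := h
    funext v x y
    rw [m'.embed_mix v x y (P := v r = true ∧ m.Agrees v) (by
      rw [hb, forall_mem_insert_iff]; rfl), hA, hA, ite_and]
    simp only [Circ.slice]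
    rw [m.embed_mix v x y (P := m.Agrees v) Iff.rfl]
  | discard l =>
    obtain ⟨hl, -, hA, hb⟩ := h
    obtain ⟨b, hlb⟩ := Reg.exists_mem_bits hl
    rw [Reg.bits_ne hlb] at hb
    funext v x y
    simp only [Circ.slice]
    rw [m'.embed_mix v x y (P := ∀ e ∈ m.bits \ {(l, b)}, v e.1 = e.2) (by rw [hb]), hA, hA,
      m.embed_mix _ x y (Reg.agrees_update_iff hlb v _).symm,
      m.embed_mix _ x y (Reg.agrees_update_iff hlb v _).symm]
    -- Of the two summands only the one for the stored value `b` survives.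
    cases b <;> simp
  | new l r =>
    obtain ⟨hl, -, b, hlb, hA, hb⟩ := h
    funext v x y
    simp only [Circ.slice]
    rw [m'.embed_mix v x y (P := ∀ e ∈ m.bits \ {(l, b)}, v e.1 = e.2) (by rw [hb]), hA, hA,
      m.embed_mix _ x y (Reg.agrees_update_iff hlb v _).symm]
    -- The map asks for `x r = y r` with the stored bit equal to `x r`; the amplitudes ask for `x r
    -- = b` and `y r = b`.
    by_cases hxy : x r = y r
    · rw [hxy]
      by_cases hy : y r = b <;> simp [hy]
    · rw [if_neg hxy]
      by_cases hx : x r = b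
      · have : y r ≠ b := fun h => hxy (hx.trans h.symm)
        simp [this]
      · simp [hx]
  | meas α l r => exact h.elim
  | gate g ls rs =>
    obtain ⟨-, -, hA, hb⟩ := h
    funext v x y
    simp only [Circ.slice]
    rw [m'.embed_mix v x y (P := m.Agrees v) (by rw [hb]; rfl), hA, hA]
    simp only [m.embed_mix v _ _ (P := m.Agrees v) Iff.rfl]
    split_ifs
    · rw [map_sum, Finset.sum_mul_sum]
      refine Finset.sum_congr rfl fun a _ => Finset.sum_congr rfl fun b _ => ?_
      rw [map_mul]
      ring
    · simp
  | seq C D ihC ihD =>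
    obtain ⟨m₁, h1, h2⟩ := h
    rw [ihD h2, ihC h1]
    rfl

/-- The factor `c b` occurs once in the row and once, conjugated, in the column, so the projected
state is `‖c b‖ ^ 2` times the normalized one. No case distinction on a vanishing probability is
needed. -/
theorem RegMeas.mix_eq {l r : Pos} {m : Reg} {m' : Bool → Reg} {pr : Bool → ℝ}
    (h : RegMeas l r m m' pr) (b : Bool) {s : SAddr} {α : ℕ} (hs : s (Sum.inr α) = some b) :
    (pr b : ℂ) • (m' b).env.embed (m' b).mix =
      (Circ.meas (𝒬 := 𝒬) α l r).slice s (m.env.embed m.mix) := by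
  classical
  obtain ⟨-, c, hc⟩ := h
  obtain ⟨-, hA, hb, hpr⟩ := hc b
  funext v x y
  simp only [Circ.slice, hs, Pi.smul_apply, smul_eq_mul]
  rw [(m' b).embed_mix v x y (P := v r = b ∧ m.Agrees v) (by
      rw [hb, forall_mem_insert_iff]; rfl), m.embed_mix v _ _ (P := m.Agrees v) Iff.rfl, ite_and]
  by_cases hv : v r = b
  · rw [hv, hA, hA, hpr, map_mul, Complex.ofReal_pow, ← Complex.mul_conj']
    by_cases hm : m.Agrees v
    · simp only [if_true, hm]
      ring
    · simp [hm]
  · simp [hv]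

/-- Projection to a value that the register does not hold gives zero. This is what permits a branch
of probability zero to hold an arbitrary register. -/
theorem RegRead.mix_eq {l : Pos} {b : Bool} {m m' : Reg} (h : RegRead l b m m') (b' : Bool) :
    projBit l b' (m.env.embed m.mix) = if b' = b then m'.env.embed m'.mix else 0 := by
  classical
  obtain ⟨hlb, -, hA, hb⟩ := h
  funext v x y
  simp only [projBit]
  rw [m.embed_mix _ x y (Reg.agrees_update_iff hlb v _).symm]
  by_cases hbb : b' = b
  · simp only [hbb, if_true, true_and]
    rw [m'.embed_mix v x y (P := ∀ e ∈ m.bits \ {(l, b)}, v e.1 = e.2) (by rw [hb]), hA, hA]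
  · simp [hbb]

/-! ## Registers after a well-typed gate -/

theorem Circ.Typed.inputsInjective {C : Circ 𝒬} {Γ Δ : Env} (h : C.Typed Γ Δ) :
    C.InputsInjective := by
  induction C generalizing Γ Δ with
  | gate g ls rs =>
    obtain ⟨Θ, h1, -⟩ := h
    have := h1.1
    rwa [List.map_ofFn, List.nodup_ofFn] at this
  | seq C D ihC ihD =>
    obtain ⟨Ψ, h1, h2⟩ := h
    exact ⟨ihC h1, ihD h2⟩
  | _ => trivial

theorem qubits_perm {L M : List (Pos × Base)} (h : L.Perm M) : qubits L = qubits M := by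
  ext l
  rw [mem_qubits, mem_qubits, h.mem_iff]

theorem qubits_cons_qbit (l : Pos) (K : List (Pos × Base)) :
    qubits ([(l, .qbit)] ++ K) = insert l (qubits K) := by
  ext k
  simp [mem_qubits]

theorem qubits_cons_bit (l : Pos) (K : List (Pos × Base)) :
    qubits ([(l, .bit)] ++ K) = qubits K := by
  ext k
  simp [mem_qubits]

theorem qubits_append_gate {n : ℕ} (ls : Fin n → Pos) (K : List (Pos × Base)) :
    qubits ((List.ofFn fun i => (ls i, Base.qbit)) ++ K) =
      qubits K ∪ Finset.univ.image ls := by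
  ext k
  simp [mem_qubits, or_comm]

theorem notMem_qubits_of_nodup {l : Pos} {B : Base} {K : List (Pos × Base)}
    (h : (([(l, B)] ++ K).map Prod.fst).Nodup) : ∀ B', (l, B') ∉ K := by
  intro B' hl
  simp only [List.cons_append, List.nil_append, List.map_cons, List.nodup_cons] at h
  exact h.1 (List.mem_map.2 ⟨_, hl, rfl⟩)

/-- A bit of the classical register is not entangled with the qubits, so the amplitudes are kept
without renormalization. -/
theorem Reg.exists_read {m : Reg} {l : Pos} (h : (l, Base.bit) ∈ m.L) :
    ∃ (b : Bool) (m' : Reg), RegRead l b m m' := by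
  obtain ⟨b, hb⟩ := Reg.exists_mem_bits h
  obtain ⟨V, hV⟩ := m.exists_bits
  have hp := m.perm_single h
  have hq : ∀ k, (k, Base.qbit) ∈ m.L ↔ (k, Base.qbit) ∈ m.L.filter fun e => e.1 ≠ l := by
    intro k
    simp only [List.mem_filter, ne_eq, decide_eq_true_eq]
    refine ⟨fun hk => ⟨hk, ?_⟩, And.left⟩
    rintro rfl
    exact not_both_types hk h
  obtain ⟨m', hL, hA, hb'⟩ := Reg.exists_of_amp (L := m.L.filter fun e => e.1 ≠ l) (A := m.amp)
    (m.nodup.sublist (List.filter_sublist.map _))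
    (fun x y hxy => m.amp_congr fun k hk => hxy k ((hq k).1 hk))
    (by
      rw [← m.labelSum_amp]
      congr 1
      ext k
      rw [mem_qubits, mem_qubits, hq]) V
  refine ⟨b, m', hb, hL, hA, ?_⟩
  rw [← Reg.bits_ne hb, hb', hV]
  ext e
  simp only [List.mem_filter, ne_eq, decide_eq_true_eq, Set.mem_ofPred_eq]
  tauto

theorem Reg.exists_wire {m : Reg} {Δ : Env} (B : Base) (l r : Pos)
    (h : (Circ.wire (𝒬 := 𝒬) B l r).Typed m.env Δ) : ∃ m', RegStep (.wire (𝒬 := 𝒬) B l r) m m' := by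
  obtain ⟨hp, hn⟩ := GateTyped.perm h
  have hlm : (l, B) ∈ m.L := hp.mem_iff.2 (by simp)
  have hl := notMem_qubits_of_nodup (nodup_of_perm hp.symm m.nodup)
  have hr := notMem_qubits_of_nodup hn
  have hp' := substEntry_perm (r, B) m.nodup hp
  set K := others [(l, B)] m.L
  obtain ⟨V, hV⟩ := m.exists_bits
  have hcongr : ∀ x y : Pos → Bool, (∀ k, (k, Base.qbit) ∈ substEntry l (r, B) m.L → x k = y k) →
      m.amp (Function.update x l (x r)) = m.amp (Function.update y l (y r)) := by
    intro x y hxy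
    refine m.amp_congr fun k hk => ?_
    by_cases hkl : k = l
    · subst hkl
      cases B with
      | bit => exact absurd hlm (not_both_types hk)
      | qbit => simpa using hxy r (hp'.mem_iff.2 (by simp))
    · rw [Function.update_of_ne hkl, Function.update_of_ne hkl]
      refine hxy k (hp'.mem_iff.2 ?_)
      have := hp.mem_iff.1 hk
      simp only [List.cons_append, List.nil_append, List.mem_cons, Prod.mk.injEq, hkl,
        false_and, false_or] at this ⊢
      exact Or.inr this
  obtain ⟨m', hL, hA, hb⟩ := Reg.exists_of_amp (nodup_of_perm hp' hn) hcongr (by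
    rw [← m.labelSum_amp, qubits_perm hp, qubits_perm hp']
    cases B with
    | bit =>
      have hlq : (l, Base.qbit) ∉ m.L := fun h => not_both_types h hlm
      rw [qubits_cons_bit, qubits_cons_bit]
      exact labelSum_congr fun x => by rw [m.amp_update hlq]
    | qbit =>
      rw [qubits_cons_qbit, qubits_cons_qbit, labelSum_insert (by rw [mem_qubits]; exact hr _),
        labelSum_insert (by rw [mem_qubits]; exact hl _)]
      -- Summation over the value at the new label `r` becomes summation over the value at the old
      -- label `l`.
      have : ∀ x b, m.amp (Function.update (Function.update x r b) l (Function.update x r b r)) =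
          m.amp (Function.update x l b) := by
        intro x b
        refine m.amp_congr fun k hk => ?_
        by_cases hkl : k = l
        · subst hkl; simp
        · rw [Function.update_of_ne hkl, Function.update_of_ne hkl, Function.update_of_ne]
          rintro rfl
          refine hr .qbit ?_
          simpa [hkl] using hp.mem_iff.1 hk
      -- The value at `l` is copied to `r`. For a qubit wire this has no effect, since `r` is then
      -- not a bit label.
      exact labelSum_congr fun x => by rw [this, this]) (Function.update V r (V l))
  refine ⟨m', hlm, hL, hA, ?_⟩
  rw [hb, hV]
  ext ⟨k, c⟩
  simp only [Set.mem_ofPred_eq, Set.mem_image, Prod.mk.injEq, Prod.exists, hp'.mem_iff,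
    hp.mem_iff]
  simp only [List.cons_append, List.nil_append, List.mem_cons, Prod.mk.injEq]
  constructor
  · rintro ⟨⟨rfl, hB⟩ | hk, rfl⟩
    · exact ⟨l, V l, ⟨Or.inl ⟨rfl, hB⟩, rfl⟩, by simp, by simp⟩
    · have hkr : k ≠ r := by rintro rfl; exact hr _ hk
      have hkl : k ≠ l := by rintro rfl; exact hl _ hk
      exact ⟨k, V k, ⟨Or.inr hk, rfl⟩, by simp [hkl], by simp [hkr]⟩
  · rintro ⟨k', c', ⟨⟨rfl, hB⟩ | hk, rfl⟩, h1, h2⟩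
    · rw [if_pos rfl] at h1
      subst h1 h2
      exact ⟨Or.inl ⟨rfl, hB⟩, by simp⟩
    · have hkr : k' ≠ r := by rintro rfl; exact hr _ hk
      have hkl : k' ≠ l := by rintro rfl; exact hl _ hk
      rw [if_neg hkl] at h1
      subst h1 h2
      exact ⟨Or.inr hk, by simp [hkr]⟩

theorem Reg.exists_insert_bit {m : Reg} {Δ : Env} {r : Pos} (b : Bool)
    (h : GateTyped m.env [] [(r, .bit)] Δ) :
    ∃ m' : Reg, m'.L = m.L ++ [(r, .bit)] ∧ (∀ x, m'.amp x = m.amp x) ∧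
      m'.bits = insert (r, b) m.bits := by
  obtain ⟨hp, hn⟩ := GateTyped.perm h
  have hn' : (([(r, Base.bit)] ++ m.L).map Prod.fst).Nodup :=
    nodup_of_perm (List.Perm.append_left _ hp) hn
  have hr := notMem_qubits_of_nodup hn'
  have hp' : (m.L ++ [(r, Base.bit)]).Perm ([(r, Base.bit)] ++ m.L) := List.perm_append_comm
  obtain ⟨V, hV⟩ := m.exists_bits
  obtain ⟨m', hL, hA, hb⟩ := Reg.exists_of_amp (nodup_of_perm hp' hn') (A := m.amp)
    (fun x y hxy => m.amp_congr fun k hk => hxy k (List.mem_append.2 (Or.inl hk)))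
    (by rw [← m.labelSum_amp, qubits_perm hp', qubits_cons_bit]) (Function.update V r b)
  refine ⟨m', hL, hA, ?_⟩
  rw [hb, hV]
  ext ⟨k, c⟩
  simp only [Set.mem_ofPred_eq, Set.mem_insert_iff, Prod.mk.injEq, List.mem_append,
    List.mem_singleton, and_true]
  constructor
  · rintro ⟨hk | rfl, rfl⟩
    · have hkr : k ≠ r := by rintro rfl; exact hr _ hk
      exact Or.inr ⟨hk, by simp [hkr]⟩
    · exact Or.inl ⟨rfl, by simp⟩
  · rintro (⟨rfl, rfl⟩ | ⟨hk, rfl⟩)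
    · exact ⟨Or.inr rfl, by simp⟩
    · have hkr : k ≠ r := by rintro rfl; exact hr _ hk
      exact ⟨Or.inl hk, by simp [hkr]⟩

theorem Reg.exists_new {m : Reg} {Δ : Env} (l r : Pos)
    (h : (Circ.new (𝒬 := 𝒬) l r).Typed m.env Δ) : ∃ m', RegStep (.new (𝒬 := 𝒬) l r) m m' := by
  obtain ⟨hp, hn⟩ := GateTyped.perm h
  have hlm : (l, Base.bit) ∈ m.L := hp.mem_iff.2 (by simp)
  have hlq : (l, Base.qbit) ∉ m.L := fun h => not_both_types h hlm
  have hl := notMem_qubits_of_nodup (nodup_of_perm hp.symm m.nodup)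
  have hr := notMem_qubits_of_nodup hn
  have hp' := substEntry_perm (r, .qbit) m.nodup hp
  set K := others [(l, Base.bit)] m.L
  obtain ⟨V, hV⟩ := m.exists_bits
  obtain ⟨b, hb⟩ := Reg.exists_mem_bits hlm
  have hmem : ∀ k, (k, Base.qbit) ∈ m.L ↔ (k, Base.qbit) ∈ K := by
    intro k
    rw [hp.mem_iff]
    simp
  have hrm : (r, Base.qbit) ∉ m.L := fun h => hr _ ((hmem r).1 h)
  obtain ⟨m', hL, hA, hb'⟩ := Reg.exists_of_amp (nodup_of_perm hp' hn)
    (A := fun x => if x r = b then m.amp x else 0)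
    (fun x y hxy => by
      rw [hxy r (hp'.mem_iff.2 (by simp)), m.amp_congr fun k hk => hxy k (hp'.mem_iff.2
        (List.mem_append.2 (Or.inr ((hmem k).1 hk))))])
    (by
      rw [← m.labelSum_amp, qubits_perm hp, qubits_perm hp', qubits_cons_qbit, qubits_cons_bit,
        labelSum_insert (by rw [mem_qubits]; exact hr _)]
      refine labelSum_congr fun x => ?_
      -- Of the two values at `r` only `b` contributes, and the old amplitude does not see `r`.
      simp only [Function.update_self, m.amp_update hrm]
      cases b <;> simp) V
  refine ⟨m', hlm, hL, b, hb, hA, ?_⟩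
  rw [← Reg.bits_ne hb, hb', hV]
  ext ⟨k, c⟩
  simp only [Set.mem_ofPred_eq, hp.mem_iff, hp'.mem_iff]
  simp only [List.cons_append, List.nil_append, List.mem_cons, Prod.mk.injEq, and_true,
    reduceCtorEq, and_false, false_or]
  constructor
  · rintro ⟨hk, rfl⟩
    exact ⟨⟨Or.inr hk, rfl⟩, by rintro rfl; exact hl _ hk⟩
  · rintro ⟨⟨hk | hk, rfl⟩, h2⟩
    · exact absurd hk h2
    · exact ⟨hk, rfl⟩

theorem Reg.exists_gate {m : Reg} {Δ : Env} (g : 𝒬.Gate) (ls rs : Fin (𝒬.arity g) → Pos)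
    (h : (Circ.gate g ls rs).Typed m.env Δ) : ∃ m', RegStep (.gate g ls rs) m m' := by
  have hls : Function.Injective ls := h.inputsInjective
  obtain ⟨hp, hn⟩ := GateTyped.perm h
  have hp' := gateEntries_perm (rs := rs) hls m.nodup hp
  have hlm : ∀ i, (ls i, Base.qbit) ∈ m.L := fun i =>
    hp.mem_iff.2 (List.mem_append.2 (Or.inl (List.mem_ofFn.2 ⟨i, rfl⟩)))
  have hn' := nodup_of_perm hp.symm m.nodup
  have hL' := nodup_of_perm hp' hn
  set K := others (List.ofFn fun i => (ls i, Base.qbit)) m.L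
  have key : ∀ {qs : Fin (𝒬.arity g) → Pos},
      (((List.ofFn fun i => (qs i, Base.qbit)) ++ K).map Prod.fst).Nodup →
      Function.Injective qs ∧ ∀ i, qs i ∉ qubits K := by
    intro qs hq
    rw [List.map_append, List.nodup_append', List.map_ofFn, List.nodup_ofFn] at hq
    refine ⟨hq.1, fun i hi => ?_⟩
    exact hq.2.2 (List.mem_ofFn.2 ⟨i, rfl⟩) (List.mem_map.2 ⟨_, mem_qubits.1 hi, rfl⟩)
  obtain ⟨-, hlK⟩ := key hn'
  obtain ⟨hrs, hrK⟩ := key hn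
  have hmem : ∀ k, (k, Base.qbit) ∈ m.L ↔ (∃ i, ls i = k) ∨ (k, Base.qbit) ∈ K := by
    intro k
    rw [hp.mem_iff]
    simp
  obtain ⟨V, hV⟩ := m.exists_bits
  obtain ⟨m', hL, hA, hb⟩ := Reg.exists_of_amp hL'
    (A := fun x => ∑ a : Fin (𝒬.arity g) → Bool,
      (𝒬.mat g).1 (fun i => x (rs i)) a * m.amp (setAt ls a x))
    (fun x y hxy => by
      have h1 : (fun i => x (rs i)) = fun i => y (rs i) := funext fun i =>
        hxy _ (hp'.mem_iff.2 (List.mem_append.2 (Or.inl (List.mem_ofFn.2 ⟨i, rfl⟩))))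
      rw [h1]
      refine Finset.sum_congr rfl fun a _ => ?_
      congr 1
      refine m.amp_congr fun k hk => ?_
      by_cases hk' : ∃ i, ls i = k
      · obtain ⟨i, rfl⟩ := hk'
        rw [setAt_apply hls, setAt_apply hls]
      · have hkK := ((hmem k).1 hk).resolve_left hk'
        push Not at hk'
        rw [setAt_of_notMem _ _ hk', setAt_of_notMem _ _ hk']
        exact hxy _ (hp'.mem_iff.2 (List.mem_append.2 (Or.inr hkK))))
    (by
      rw [← m.labelSum_amp, qubits_perm hp, qubits_perm hp', qubits_append_gate,
        qubits_append_gate, labelSum_union_image hrs hrK, labelSum_union_image hls hlK]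
      refine labelSum_congr (R := ℝ) fun x => ?_
      -- With the values outside the gate fixed by `x`, the amplitudes on the gate's inputs form a
      -- vector whose norm the unitary preserves.
      refine Eq.trans ?_ (sum_norm_sq_unitary (𝒬.mat g) fun a => m.amp (setAt ls a x))
      refine Finset.sum_congr rfl fun b _ => ?_
      refine congrArg (fun z : ℂ => ‖z‖ ^ 2) (Finset.sum_congr rfl fun a _ => ?_)
      congr 1
      · exact congrArg (fun z => (𝒬.mat g).1 z a) (funext fun i => setAt_apply hrs _ _ _)
      · refine m.amp_congr fun k hk => ?_
        by_cases hk' : ∃ i, ls i = k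
        · obtain ⟨i, rfl⟩ := hk'
          rw [setAt_apply hls, setAt_apply hls]
        · have hkK := ((hmem k).1 hk).resolve_left hk'
          push Not at hk'
          rw [setAt_of_notMem _ _ hk', setAt_of_notMem _ _ hk', setAt_of_notMem]
          rintro i rfl
          exact hrK i (mem_qubits.2 hkK)) V
  refine ⟨m', hlm, hL, hA, ?_⟩
  rw [hb, hV]
  ext ⟨k, c⟩
  simp only [Set.mem_ofPred_eq, hp.mem_iff, hp'.mem_iff]
  simp

/-- The output environment is forced by uniqueness of typing, so mere existence of a step suffices.
The induction over a composition uses this to hand the intermediate environment to the second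
factor. -/
theorem RegStep.exists_of_typed {c : Circ 𝒬} {m : Reg} {Δ : Env} (hc : c.measList = [])
    (h : c.Typed m.env Δ) : ∃ m', RegStep c m m' ∧ m'.env = Δ := by
  suffices H : ∃ m', RegStep c m m' by
    obtain ⟨m', hm'⟩ := H
    exact ⟨m', hm', (hm'.typed h.inputsInjective).unique h⟩
  induction c generalizing m Δ with
  | id => exact ⟨m, rfl⟩
  | wire B l r => exact Reg.exists_wire B l r h
  | zero r => exact Reg.exists_insert_bit false h
  | one r => exact Reg.exists_insert_bit true h
  | discard l =>
    have hl : (l, Base.bit) ∈ m.L := (GateTyped.perm h).1.mem_iff.2 (by simp)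
    obtain ⟨b, m', h1, h2, h3, h4⟩ := Reg.exists_read hl
    exact ⟨m', hl, h2, h3, h4.trans (Reg.bits_ne h1).symm⟩
  | new l r => exact Reg.exists_new l r h
  | meas α l r => simp [Circ.measList] at hc
  | gate g ls rs => exact Reg.exists_gate g ls rs h
  | seq C D ihC ihD =>
    simp only [Circ.measList, List.append_eq_nil_iff] at hc
    obtain ⟨Ψ, h1, h2⟩ := h
    obtain ⟨m₁, hm₁⟩ := ihC hc.1 h1
    obtain rfl := (hm₁.typed h1.inputsInjective).unique h1
    obtain ⟨m₂, hm₂⟩ := ihD hc.2 h2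
    exact ⟨m₂, m₁, hm₁, hm₂⟩

/-- The coefficient of an outcome is the norm of the corresponding component of the state; the two
squared norms add up to the norm of the whole. -/
theorem RegMeas.exists_of_typed {m : Reg} {l r : Pos} {Δ : Env}
    (h : GateTyped m.env [(l, .qbit)] [(r, .bit)] Δ) :
    ∃ (m' : Bool → Reg) (pr : Bool → ℝ), RegMeas l r m m' pr ∧ (∀ b, (m' b).env = Δ) ∧
      (∀ b, 0 ≤ pr b) ∧ pr false + pr true = 1 := by
  obtain ⟨hp, hn⟩ := h.perm
  have hlm : (l, Base.qbit) ∈ m.L := hp.mem_iff.2 (by simp)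
  have hl := notMem_qubits_of_nodup (nodup_of_perm hp.symm m.nodup)
  have hr := notMem_qubits_of_nodup hn
  have hp' := substEntry_perm (r, .bit) m.nodup hp
  set K := others [(l, Base.qbit)] m.L
  obtain ⟨V, hV⟩ := m.exists_bits
  -- The probability of the outcome `b`: the squared norm of the component in which the measured
  -- qubit has the value `b`.
  let N : Bool → ℝ := fun b => labelSum (qubits K) fun x => ‖m.amp (Function.update x l b)‖ ^ 2
  have hN0 : ∀ b, 0 ≤ N b := fun b => Finset.sum_nonneg fun _ _ => by positivity
  have hN1 : N false + N true = 1 := by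
    rw [← m.labelSum_amp, qubits_perm hp, qubits_cons_qbit,
      labelSum_insert (by rw [mem_qubits]; exact hl _)]
    exact Finset.sum_add_distrib.symm
  have hdep : ∀ (b : Bool) (x y : Pos → Bool), (∀ k, (k, Base.qbit) ∈ K → x k = y k) →
      m.amp (Function.update x l b) = m.amp (Function.update y l b) := by
    intro b x y hxy
    refine m.amp_congr fun k hk => ?_
    by_cases hkl : k = l
    · subst hkl; simp
    · rw [Function.update_of_ne hkl, Function.update_of_ne hkl]
      refine hxy k ?_
      simpa [hkl] using hp.mem_iff.1 hk
  have hex : ∀ b, ∃ (c : ℂ) (m' : Reg), m'.L = substEntry l (r, .bit) m.L ∧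
      (∀ x, m.amp (Function.update x l b) = c * m'.amp x) ∧
      m'.bits = insert (r, b) m.bits ∧ N b = ‖c‖ ^ 2 := by
    intro b
    have hqK : ∀ k, (k, Base.qbit) ∈ substEntry l (r, .bit) m.L ↔ (k, Base.qbit) ∈ K := by
      intro k
      rw [hp'.mem_iff]
      simp
    have hS : qubits (substEntry l (r, .bit) m.L) = qubits K := by
      rw [qubits_perm hp', qubits_cons_bit]
    have hbits : {e : Pos × Bool | (e.1, Base.bit) ∈ substEntry l (r, .bit) m.L ∧
        e.2 = Function.update V r b e.1} = insert (r, b) m.bits := by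
      rw [hV]
      ext ⟨k, c⟩
      simp only [Set.mem_ofPred_eq, Set.mem_insert_iff, hp.mem_iff, hp'.mem_iff]
      simp only [List.cons_append, List.nil_append, List.mem_cons, Prod.mk.injEq, and_true,
        reduceCtorEq, and_false, false_or]
      constructor
      · rintro ⟨rfl | hk, rfl⟩
        · exact Or.inl ⟨rfl, by simp⟩
        · have hkr : k ≠ r := by rintro rfl; exact hr _ hk
          exact Or.inr ⟨hk, by simp [hkr]⟩
      · rintro (⟨rfl, rfl⟩ | ⟨hk, rfl⟩)
        · exact ⟨Or.inl rfl, by simp⟩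
        · have hkr : k ≠ r := by rintro rfl; exact hr _ hk
          exact ⟨Or.inr hk, by simp [hkr]⟩
    by_cases h0 : N b = 0
    -- An outcome of probability zero still needs a normalized state; the basis vector with all
    -- remaining qubits `false` is taken.
    · obtain ⟨m', hL, -, hb⟩ := Reg.exists_of_amp (nodup_of_perm hp' hn)
        (A := fun x => if ∀ k ∈ qubits K, x k = false then (1 : ℂ) else 0)
        (fun x y hxy => by
          have : (∀ k ∈ qubits K, x k = false) ↔ ∀ k ∈ qubits K, y k = false :=
            forall₂_congr fun k hk => by rw [hxy k ((hqK k).2 (mem_qubits.1 hk))]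
          simp only [this])
        (by
          rw [hS]
          unfold labelSum
          rw [Finset.sum_eq_single_of_mem ∅ (Finset.empty_mem_powerset _)]
          · simp
          · intro t ht hne
            obtain ⟨k, hk⟩ := Finset.nonempty_iff_ne_empty.2 hne
            beta_reduce
            rw [if_neg]
            · simp
            · intro H
              simpa [hk] using H k (Finset.mem_powerset.1 ht hk)) (Function.update V r b)
      refine ⟨0, m', hL, fun x => ?_, hb.trans hbits, by simp [h0]⟩
      -- A vanishing sum of nonnegative terms vanishes termwise; the term chosen is the one that
      -- agrees with `x` on the remaining qubits.
      have h1 := (Finset.sum_eq_zero_iff_of_nonneg (fun _ _ => by positivity)).1 h0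
        ((qubits K).filter fun k => x k = true)
        (Finset.mem_powerset.2 (Finset.filter_subset _ _))
      rw [zero_mul, ← norm_eq_zero, ← sq_eq_zero_iff, ← h1]
      congr 2
      refine hdep b _ _ fun k hk => ?_
      simp [mem_qubits, hk]
    · have hpos : 0 < N b := lt_of_le_of_ne (hN0 b) (Ne.symm h0)
      have hc : ((Real.sqrt (N b) : ℝ) : ℂ) ≠ 0 := by
        exact_mod_cast (Real.sqrt_pos.2 hpos).ne'
      obtain ⟨m', hL, hA, hb⟩ := Reg.exists_of_amp (nodup_of_perm hp' hn)
        (A := fun x => ((Real.sqrt (N b) : ℝ) : ℂ)⁻¹ * m.amp (Function.update x l b))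
        (fun x y hxy => by
          rw [hdep b x y fun k hk => hxy k ((hqK k).2 hk)])
        (by
          rw [hS]
          simp only [norm_mul, mul_pow, norm_inv, Complex.norm_real, Real.norm_eq_abs, inv_pow,
            sq_abs, Real.sq_sqrt (hN0 b)]
          unfold labelSum
          rw [← Finset.mul_sum]
          exact inv_mul_cancel₀ h0) (Function.update V r b)
      refine ⟨(Real.sqrt (N b) : ℝ), m', hL, fun x => ?_, hb.trans hbits, ?_⟩
      · rw [hA, mul_inv_cancel_left₀ hc]
      · rw [Complex.norm_real, Real.norm_eq_abs, sq_abs, Real.sq_sqrt (hN0 b)]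
  choose c m' hm' using hex
  have hmeas : RegMeas l r m m' N := ⟨hlm, c, hm'⟩
  exact ⟨m', N, hmeas, fun b => (hmeas.typed b).unique h, hN0, hN1⟩

/-! ## Extended circuits and their addresses -/

theorem Addr.add_self (𝒢 : Addr) (l : Pos) (b : Bool) : 𝒢.add l b l = some b :=
  Function.update_self ..

theorem Addr.add_of_ne (𝒢 : Addr) {l k : Pos} (b : Bool) (h : k ≠ l) : 𝒢.add l b k = 𝒢 k :=
  Function.update_of_ne h ..

theorem Addr.Sub.refl (𝒢 : Addr) : 𝒢.Sub 𝒢 := fun _ _ h => h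

theorem Addr.sub_add {𝒢 : Addr} {l : Pos} (h : 𝒢 l = none) (b : Bool) : 𝒢.Sub (𝒢.add l b) := by
  intro k c hk
  rw [Addr.add_of_ne _ _ (by rintro rfl; simp [h] at hk)]
  exact hk

theorem Addr.add_injective {𝒢 ℋ : Addr} {l : Pos} {b c : Bool} (h𝒢 : 𝒢 l = none)
    (hℋ : ℋ l = none) (h : 𝒢.add l b = ℋ.add l c) : b = c ∧ 𝒢 = ℋ := by
  refine ⟨by simpa [Addr.add_self] using congrFun h l, funext fun k => ?_⟩
  by_cases hk : k = l
  · rw [hk, h𝒢, hℋ]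
  · simpa [Addr.add_of_ne _ _ hk] using congrFun h k

/-- The union of two addresses, the first one having priority. -/
def Addr.union (𝒢 ℋ : Addr) : Addr := fun l => (𝒢 l).or (ℋ l)

theorem Addr.union_empty (𝒢 : Addr) : 𝒢.union Addr.empty = 𝒢 :=
  funext fun _ => Option.or_none

theorem Addr.empty_union (𝒢 : Addr) : Addr.empty.union 𝒢 = 𝒢 :=
  funext fun _ => Option.none_or

theorem Addr.add_union (𝒢 ℋ : Addr) (l : Pos) (b : Bool) :
    (𝒢.add l b).union ℋ = (𝒢.union ℋ).add l b := by
  funext k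
  by_cases hk : k = l
  · subst hk; simp [Addr.union, Addr.add_self]
  · simp [Addr.union, Addr.add_of_ne _ _ hk]

theorem Addr.union_single {𝒢 : Addr} {l : Pos} (h : 𝒢 l = none) (b : Bool) :
    𝒢.union (Addr.empty.add l b) = 𝒢.add l b := by
  funext k
  by_cases hk : k = l
  · subst hk; simp [Addr.union, Addr.add_self, h]
  · simp [Addr.union, Addr.add_of_ne _ _ hk, Addr.empty]

/-- Both addresses are defined on all guards that they meet in `E`, and lead to the same leaf. -/
def ExtCirc.Meets (𝒢 ℋ : Addr) : ExtCirc 𝒬 → Prop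
  | .leaf _ => True
  | .node _ l E F =>
      (𝒢 l = some false ∧ ℋ l = some false ∧ E.Meets 𝒢 ℋ) ∨
        (𝒢 l = some true ∧ ℋ l = some true ∧ F.Meets 𝒢 ℋ)

theorem ExtCirc.Meets.mono {E : ExtCirc 𝒬} {𝒢 𝒢' ℋ ℋ' : Addr} (h : E.Meets 𝒢 ℋ)
    (h𝒢 : 𝒢.Sub 𝒢') (hℋ : ℋ.Sub ℋ') : E.Meets 𝒢' ℋ' := by
  induction E with
  | leaf C => trivial
  | node C l E F ihE ihF =>
    exact h.imp (fun h => ⟨h𝒢 _ _ h.1, hℋ _ _ h.2.1, ihE h.2.2⟩)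
      fun h => ⟨h𝒢 _ _ h.1, hℋ _ _ h.2.1, ihF h.2.2⟩

/-- The way back from `Meets.mono`: two extended addresses leading to the same leaf make the smaller
ones do so too, provided that these reach leaves themselves. It removes a guard added at the root.
-/
theorem ExtCirc.Meets.of_sub {E : ExtCirc 𝒬} {𝒢 𝒢' ℋ ℋ' : Addr} (h : E.Meets 𝒢' ℋ')
    (h𝒢 : 𝒢.Sub 𝒢') (hℋ : ℋ.Sub ℋ') (h1 : E.Meets 𝒢 𝒢) (h2 : E.Meets ℋ ℋ) : E.Meets 𝒢 ℋ := by
  induction E with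
  | leaf C => trivial
  | node C l E F ihE ihF =>
    rcases h1 with h1 | h1 <;> rcases h2 with h2 | h2
    · refine Or.inl ⟨h1.1, h2.1, ihE ?_ h1.2.2 h2.2.2⟩
      rcases h with h | h
      · exact h.2.2
      · simpa [h.1] using h𝒢 _ _ h1.1
    · have h3 := h𝒢 _ _ h1.1
      have h4 := hℋ _ _ h2.1
      rcases h with h | h <;> simp [h3, h4] at h
    · have h3 := h𝒢 _ _ h1.1
      have h4 := hℋ _ _ h2.1
      rcases h with h | h <;> simp [h3, h4] at h
    · refine Or.inr ⟨h1.1, h2.1, ihF ?_ h1.2.2 h2.2.2⟩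
      rcases h with h | h
      · simpa [h.1] using h𝒢 _ _ h1.1
      · exact h.2.2

theorem ExtCirc.GuardsDistinct.eq_none {C : Circ 𝒬} {l : Pos} {E F : ExtCirc 𝒬}
    (h : (ExtCirc.node C l E F).GuardsDistinct) :
    (∀ 𝒢 ∈ E.addrs, 𝒢 l = none) ∧ ∀ 𝒢 ∈ F.addrs, 𝒢 l = none :=
  ⟨fun _ h𝒢 => h.1 _ (Or.inl h𝒢), fun _ h𝒢 => h.1 _ (Or.inr h𝒢)⟩

theorem ExtCirc.meets_self {E : ExtCirc 𝒬} (hE : E.GuardsDistinct) {𝒢 : Addr}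
    (h : 𝒢 ∈ E.addrs) : E.Meets 𝒢 𝒢 := by
  induction E generalizing 𝒢 with
  | leaf C => trivial
  | node C l E F ihE ihF =>
    rcases h with ⟨ℋ, hℋ, rfl⟩ | ⟨ℋ, hℋ, rfl⟩
    · have hs := Addr.sub_add (hE.eq_none.1 _ hℋ) false
      exact Or.inl ⟨Addr.add_self .., Addr.add_self .., (ihE hE.2.1 hℋ).mono hs hs⟩
    · have hs := Addr.sub_add (hE.eq_none.2 _ hℋ) true
      exact Or.inr ⟨Addr.add_self .., Addr.add_self .., (ihF hE.2.2 hℋ).mono hs hs⟩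

/-- An address contains no labels besides the guards on its path, so the leaf that it reaches
determines it. -/
theorem ExtCirc.Meets.eq {E : ExtCirc 𝒬} (hE : E.GuardsDistinct) {𝒢 ℋ : Addr}
    (h𝒢 : 𝒢 ∈ E.addrs) (hℋ : ℋ ∈ E.addrs) (h : E.Meets 𝒢 ℋ) : 𝒢 = ℋ := by
  induction E generalizing 𝒢 ℋ with
  | leaf C => exact (show 𝒢 = _ from h𝒢).trans (show ℋ = _ from hℋ).symm
  | node C l E F ihE ihF =>
    rcases h𝒢 with ⟨𝒢, h𝒢, rfl⟩ | ⟨𝒢, h𝒢, rfl⟩ <;> rcases hℋ with ⟨ℋ, hℋ, rfl⟩ | ⟨ℋ, hℋ, rfl⟩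
    · simp only [Meets, Addr.add_self, true_and, Option.some.injEq, Bool.false_eq_true, false_and,
        or_false] at h
      rw [ihE hE.2.1 h𝒢 hℋ (h.of_sub (Addr.sub_add (hE.eq_none.1 _ h𝒢) _)
        (Addr.sub_add (hE.eq_none.1 _ hℋ) _) (meets_self hE.2.1 h𝒢) (meets_self hE.2.1 hℋ))]
    · simp [Meets, Addr.add_self] at h
    · simp [Meets, Addr.add_self] at h
    · simp only [Meets, Addr.add_self, true_and, Option.some.injEq, Bool.true_eq_false, false_and,
        false_or] at h
      rw [ihF hE.2.2 h𝒢 hℋ (h.of_sub (Addr.sub_add (hE.eq_none.2 _ h𝒢) _)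
        (Addr.sub_add (hE.eq_none.2 _ hℋ) _) (meets_self hE.2.2 h𝒢) (meets_self hE.2.2 hℋ))]

/-- The addresses form an antichain. This reconciles the two ways of delimiting a reduction: for
super-addresses of `E`, containing `𝒢` is the same as lying over `𝒢`. -/
theorem ExtCirc.eq_of_sub {E : ExtCirc 𝒬} (hE : E.GuardsDistinct) {𝒢 ℋ : Addr}
    (h𝒢 : 𝒢 ∈ E.addrs) (hℋ : ℋ ∈ E.addrs) (h : 𝒢.Sub ℋ) : 𝒢 = ℋ :=
  ((meets_self hE h𝒢).mono (.refl _) h).eq hE h𝒢 hℋ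

theorem ExtCirc.add_notMem_addrs {E : ExtCirc 𝒬} (hE : E.GuardsDistinct) {𝒢 : Addr}
    (h𝒢 : 𝒢 ∈ E.addrs) {l : Pos} (hl : 𝒢 l = none) (b : Bool) : 𝒢.add l b ∉ E.addrs := by
  intro h
  have := congrFun (eq_of_sub hE h𝒢 h (Addr.sub_add hl b)) l
  simp [hl, Addr.add_self] at this

/-! ## Replacement of a leaf -/

theorem ExtCirc.Meets.replaceAt_eq {E : ExtCirc 𝒬} {𝒢 ℋ : Addr} (h : E.Meets 𝒢 ℋ)
    (f : Circ 𝒬 → ExtCirc 𝒬) : E.replaceAt 𝒢 f = E.replaceAt ℋ f := by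
  induction E with
  | leaf C => rfl
  | node C l E F ihE ihF =>
    rcases h with h | h
    · simp only [replaceAt, h.1, h.2.1, ihE h.2.2]
    · simp only [replaceAt, h.1, h.2.1, ihF h.2.2]

theorem ExtCirc.replaceAt_add_left {C : Circ 𝒬} {l : Pos} {E F : ExtCirc 𝒬}
    (hE : (ExtCirc.node C l E F).GuardsDistinct) {𝒢 : Addr} (h𝒢 : 𝒢 ∈ E.addrs)
    (f : Circ 𝒬 → ExtCirc 𝒬) :
    (ExtCirc.node C l E F).replaceAt (𝒢.add l false) f = .node C l (E.replaceAt 𝒢 f) F := by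
  simp only [replaceAt, Addr.add_self]
  rw [((meets_self hE.2.1 h𝒢).mono (.refl _) (Addr.sub_add (hE.eq_none.1 _ h𝒢) false)).replaceAt_eq]

theorem ExtCirc.replaceAt_add_right {C : Circ 𝒬} {l : Pos} {E F : ExtCirc 𝒬}
    (hE : (ExtCirc.node C l E F).GuardsDistinct) {𝒢 : Addr} (h𝒢 : 𝒢 ∈ F.addrs)
    (f : Circ 𝒬 → ExtCirc 𝒬) :
    (ExtCirc.node C l E F).replaceAt (𝒢.add l true) f = .node C l E (F.replaceAt 𝒢 f) := by
  simp only [replaceAt, Addr.add_self]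
  rw [((meets_self hE.2.2 h𝒢).mono (.refl _) (Addr.sub_add (hE.eq_none.2 _ h𝒢) true)).replaceAt_eq]

theorem ExtCirc.mem_addrs_node {C : Circ 𝒬} {l : Pos} {E F : ExtCirc 𝒬} {𝒢 : Addr} :
    𝒢 ∈ (ExtCirc.node C l E F).addrs ↔
      (∃ ℋ ∈ E.addrs, 𝒢 = ℋ.add l false) ∨ ∃ ℋ ∈ F.addrs, 𝒢 = ℋ.add l true :=
  Iff.rfl

/-- Only the address of the replaced leaf changes, the paths inside its image being attached to `𝒢`.
Absence of the root guard from all paths of the branches keeps the addresses from the two sides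
apart. -/
theorem ExtCirc.mem_addrs_replaceAt {E : ExtCirc 𝒬} (hE : E.GuardsDistinct) {𝒢 : Addr}
    (h𝒢 : 𝒢 ∈ E.addrs) {f : Circ 𝒬 → ExtCirc 𝒬} {S : Set Addr} (hf : ∀ C, (f C).addrs = S)
    {ℋ : Addr} :
    ℋ ∈ (E.replaceAt 𝒢 f).addrs ↔ (ℋ ∈ E.addrs ∧ ℋ ≠ 𝒢) ∨ ∃ 𝒦 ∈ S, ℋ = 𝒢.union 𝒦 := by
  induction E generalizing 𝒢 ℋ with
  | leaf C =>
    obtain rfl : 𝒢 = Addr.empty := h𝒢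
    simp only [replaceAt, hf, addrs, Set.mem_singleton_iff, Addr.empty_union, exists_eq_right']
    tauto
  | node C l E F ihE ihF =>
    rcases h𝒢 with ⟨𝒢, h𝒢, rfl⟩ | ⟨𝒢, h𝒢, rfl⟩
    · rw [replaceAt_add_left hE h𝒢, mem_addrs_node, mem_addrs_node]
      simp only [ihE hE.2.1 h𝒢, Addr.add_union]
      constructor
      · rintro (⟨ℋ, ⟨hℋ, hne⟩ | ⟨𝒦, h𝒦, rfl⟩, rfl⟩ | ⟨ℋ, hℋ, rfl⟩)
        · exact Or.inl ⟨Or.inl ⟨_, hℋ, rfl⟩, fun h =>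
            hne (Addr.add_injective (hE.eq_none.1 _ hℋ) (hE.eq_none.1 _ h𝒢) h).2⟩
        · exact Or.inr ⟨𝒦, h𝒦, rfl⟩
        · exact Or.inl ⟨Or.inr ⟨_, hℋ, rfl⟩, fun h => by
            simpa using (Addr.add_injective (hE.eq_none.2 _ hℋ) (hE.eq_none.1 _ h𝒢) h).1⟩
      · rintro (⟨⟨ℋ, hℋ, rfl⟩ | ⟨ℋ, hℋ, rfl⟩, hne⟩ | ⟨𝒦, h𝒦, rfl⟩)
        · exact Or.inl ⟨ℋ, Or.inl ⟨hℋ, fun h => hne (by rw [h])⟩, rfl⟩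
        · exact Or.inr ⟨_, hℋ, rfl⟩
        · exact Or.inl ⟨_, Or.inr ⟨𝒦, h𝒦, rfl⟩, rfl⟩
    · rw [replaceAt_add_right hE h𝒢, mem_addrs_node, mem_addrs_node]
      simp only [ihF hE.2.2 h𝒢, Addr.add_union]
      constructor
      · rintro (⟨ℋ, hℋ, rfl⟩ | ⟨ℋ, ⟨hℋ, hne⟩ | ⟨𝒦, h𝒦, rfl⟩, rfl⟩)
        · exact Or.inl ⟨Or.inl ⟨_, hℋ, rfl⟩, fun h => by
            simpa using (Addr.add_injective (hE.eq_none.1 _ hℋ) (hE.eq_none.2 _ h𝒢) h).1⟩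
        · exact Or.inl ⟨Or.inr ⟨_, hℋ, rfl⟩, fun h =>
            hne (Addr.add_injective (hE.eq_none.2 _ hℋ) (hE.eq_none.2 _ h𝒢) h).2⟩
        · exact Or.inr ⟨𝒦, h𝒦, rfl⟩
      · rintro (⟨⟨ℋ, hℋ, rfl⟩ | ⟨ℋ, hℋ, rfl⟩, hne⟩ | ⟨𝒦, h𝒦, rfl⟩)
        · exact Or.inl ⟨_, hℋ, rfl⟩
        · exact Or.inr ⟨ℋ, Or.inl ⟨hℋ, fun h => hne (by rw [h])⟩, rfl⟩
        · exact Or.inr ⟨_, Or.inr ⟨𝒦, h𝒦, rfl⟩, rfl⟩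

/-! ### The two kinds of leaf transformation: appending a gate and adding a guard -/

/-- The circuit of the leaf is followed by `c`. -/
def Circ.append (c C : Circ 𝒬) : ExtCirc 𝒬 := .leaf (.seq C c)

/-- The circuit of the leaf is followed by a guard, with empty branches. -/
def Circ.branch (l : Pos) (C : Circ 𝒬) : ExtCirc 𝒬 := .node C l (.leaf .id) (.leaf .id)

theorem ExtCirc.addrs_append {E : ExtCirc 𝒬} (c : Circ 𝒬) (𝒢 : Addr) :
    (E.replaceAt 𝒢 c.append).addrs = E.addrs := by
  induction E with
  | leaf C => rfl
  | node C l E F ihE ihF =>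
    simp only [replaceAt]
    split <;> simp only [addrs, ihE, ihF]

theorem ExtCirc.GuardsDistinct.append {E : ExtCirc 𝒬} (hE : E.GuardsDistinct) (c : Circ 𝒬)
    (𝒢 : Addr) : (E.replaceAt 𝒢 c.append).GuardsDistinct := by
  induction E with
  | leaf C => trivial
  | node C l E F ihE ihF =>
    simp only [replaceAt]
    split
    · exact ⟨by rw [addrs_append]; exact hE.1, ihE hE.2.1, hE.2.2⟩
    · exact ⟨by rw [addrs_append]; exact hE.1, hE.2.1, ihF hE.2.2⟩
    · exact hE

theorem ExtCirc.mem_addrs_branch {E : ExtCirc 𝒬} (hE : E.GuardsDistinct) {𝒢 : Addr}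
    (h𝒢 : 𝒢 ∈ E.addrs) {l : Pos} (hl : 𝒢 l = none) {ℋ : Addr} :
    ℋ ∈ (E.replaceAt 𝒢 (Circ.branch l)).addrs ↔
      (ℋ ∈ E.addrs ∧ ℋ ≠ 𝒢) ∨ ∃ b, ℋ = 𝒢.add l b := by
  rw [mem_addrs_replaceAt hE h𝒢 (f := Circ.branch l)
    (S := {𝒦 | ∃ b, 𝒦 = Addr.empty.add l b})]
  · refine or_congr Iff.rfl ⟨?_, ?_⟩
    · rintro ⟨_, ⟨b, rfl⟩, rfl⟩
      exact ⟨b, Addr.union_single hl b⟩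
    · rintro ⟨b, rfl⟩
      exact ⟨_, ⟨b, rfl⟩, (Addr.union_single hl b).symm⟩
  · intro C
    ext 𝒦
    simp [Circ.branch, addrs, or_comm]

theorem ExtCirc.GuardsDistinct.branch {E : ExtCirc 𝒬} (hE : E.GuardsDistinct) {𝒢 : Addr}
    (h𝒢 : 𝒢 ∈ E.addrs) {l : Pos} (hl : 𝒢 l = none) :
    (E.replaceAt 𝒢 (Circ.branch l)).GuardsDistinct := by
  induction E generalizing 𝒢 with
  | leaf C =>
    refine ⟨?_, trivial, trivial⟩
    rintro ℋ (rfl | rfl) <;> rfl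
  | node C k E F ihE ihF =>
    rcases h𝒢 with ⟨𝒢, h𝒢, rfl⟩ | ⟨𝒢, h𝒢, rfl⟩
    all_goals
      -- The guard `k` is on the path to the leaf, where `l` has no value; hence adding `l` does not
      -- repeat a guard.
      have hkl : l ≠ k := by rintro rfl; simp [Addr.add_self] at hl
      rw [Addr.add_of_ne _ _ hkl] at hl
    · rw [replaceAt_add_left hE h𝒢]
      refine ⟨?_, ihE hE.2.1 h𝒢 hl, hE.2.2⟩
      rintro ℋ (hℋ | hℋ)
      · rcases (mem_addrs_branch hE.2.1 h𝒢 hl).1 hℋ with hℋ | ⟨b, rfl⟩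
        · exact hE.eq_none.1 _ hℋ.1
        · rw [Addr.add_of_ne _ _ hkl.symm]
          exact hE.eq_none.1 _ h𝒢
      · exact hE.eq_none.2 _ hℋ
    · rw [replaceAt_add_right hE h𝒢]
      refine ⟨?_, hE.2.1, ihF hE.2.2 h𝒢 hl⟩
      rintro ℋ (hℋ | hℋ)
      · exact hE.eq_none.1 _ hℋ
      · rcases (mem_addrs_branch hE.2.2 h𝒢 hl).1 hℋ with hℋ | ⟨b, rfl⟩
        · exact hE.eq_none.2 _ hℋ.1
        · rw [Addr.add_of_ne _ _ hkl.symm]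
          exact hE.eq_none.2 _ h𝒢

/-! ### Measurement indices after a replacement -/

theorem ExtCirc.Meets.measList_replaceAt {E : ExtCirc 𝒬} {𝒢 : Addr} (h : E.Meets 𝒢 𝒢)
    {f : Circ 𝒬 → ExtCirc 𝒬} {xs : List ℕ} (hf : ∀ C, (f C).measList = C.measList ++ xs) :
    (E.replaceAt 𝒢 f).measList.Perm (E.measList ++ xs) := by
  induction E with
  | leaf C => rw [replaceAt, hf]; exact .refl _
  | node C l E F ihE ihF =>
    rcases h with h | h
    · simp only [replaceAt, h.1, measList, List.append_assoc]
      refine List.Perm.append_left _ ?_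
      refine (List.Perm.append_right _ (ihE h.2.2)).trans ?_
      rw [List.append_assoc]
      exact List.Perm.append_left _ List.perm_append_comm
    · simp only [replaceAt, h.1, measList, List.append_assoc]
      exact List.Perm.append_left _ (List.Perm.append_left _ (ihF h.2.2))

theorem ExtCirc.restrict_replaceAt_of_not_meets {E : ExtCirc 𝒬} {𝒢 ℋ : Addr} (h𝒢 : E.Meets 𝒢 𝒢)
    (hℋ : E.Meets ℋ ℋ) (h : ¬ E.Meets 𝒢 ℋ) (f : Circ 𝒬 → ExtCirc 𝒬) :
    (E.replaceAt 𝒢 f).restrict ℋ = E.restrict ℋ := by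
  induction E with
  | leaf C => exact absurd trivial h
  | node C l E F ihE ihF =>
    rcases h𝒢 with h1 | h1 <;> rcases hℋ with h2 | h2
    · simp only [replaceAt, restrict, h1.1, h2.1]
      rw [ihE h1.2.2 h2.2.2 fun h' => h (Or.inl ⟨h1.1, h2.1, h'⟩)]
    · simp only [replaceAt, restrict, h1.1, h2.1]
    · simp only [replaceAt, restrict, h1.1, h2.1]
    · simp only [replaceAt, restrict, h1.1, h2.1]
      rw [ihF h1.2.2 h2.2.2 fun h' => h (Or.inr ⟨h1.1, h2.1, h'⟩)]

theorem ExtCirc.Meets.measList_restrict_replaceAt {E : ExtCirc 𝒬} {𝒢 ℋ : Addr}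
    (h : E.Meets 𝒢 ℋ) {f : Circ 𝒬 → ExtCirc 𝒬} {xs : List ℕ}
    (hf : ∀ C, ((f C).restrict ℋ).measList = C.measList ++ xs) :
    ((E.replaceAt 𝒢 f).restrict ℋ).measList = (E.restrict ℋ).measList ++ xs := by
  induction E with
  | leaf C => exact hf C
  | node C l E F ihE ihF =>
    rcases h with h | h
    · simp only [replaceAt, restrict, h.1, h.2.1, Circ.measList, ihE h.2.2, List.append_assoc]
    · simp only [replaceAt, restrict, h.1, h.2.1, Circ.measList, ihF h.2.2, List.append_assoc]

theorem ExtCirc.Meets.restrict_eq {E : ExtCirc 𝒬} {𝒢 ℋ : Addr} (h : E.Meets 𝒢 ℋ) :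
    E.restrict 𝒢 = E.restrict ℋ := by
  induction E with
  | leaf C => rfl
  | node C l E F ihE ihF =>
    rcases h with h | h
    · simp only [restrict, h.1, h.2.1, ihE h.2.2]
    · simp only [restrict, h.1, h.2.1, ihF h.2.2]

theorem ExtCirc.measList_restrict_subset (E : ExtCirc 𝒬) (𝒢 : Addr) :
    (E.restrict 𝒢).measList ⊆ E.measList := by
  induction E with
  | leaf C => exact fun _ h => h
  | node C l E F ihE ihF =>
    intro α hα
    simp only [restrict] at hα
    split at hα <;> simp only [Circ.measList, measList, List.append_nil, List.mem_append] at hα ⊢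
    · exact hα.imp id fun h => Or.inl (ihE h)
    · exact hα.imp id fun h => Or.inr (ihF h)
    · exact Or.inl hα

/-! ## Slices of extended circuits -/

theorem Circ.slice_congr {s t : SAddr} {C : Circ 𝒬}
    (h : ∀ α ∈ C.measList, s (Sum.inr α) = t (Sum.inr α)) : C.slice s = C.slice t := by
  funext ρ
  induction C generalizing ρ with
  | meas α l r => simp only [slice, h α (List.mem_singleton.2 rfl)]
  | seq C D ihC ihD =>
    simp only [slice]
    rw [ihC fun α hα => h α (List.mem_append.2 (Or.inl hα)),
      ihD fun α hα => h α (List.mem_append.2 (Or.inr hα))]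
  | wire B l r => cases B <;> rfl
  | _ => rfl

/-- A slice consults only the guards on the path and the measurement indices of `E`. This is why a
value for a new guard or index leaves the old slice unchanged. -/
theorem ExtCirc.Meets.slice_congr {E : ExtCirc 𝒬} {s t : SAddr} (h : E.Meets s.addr t.addr)
    (hm : ∀ α ∈ E.measList, s (Sum.inr α) = t (Sum.inr α)) : E.slice s = E.slice t := by
  funext ρ
  induction E generalizing ρ with
  | leaf C => exact congrFun (Circ.slice_congr hm) ρ
  | node C l E F ihE ihF =>
    simp only [measList, List.mem_append] at hm
    have hC := Circ.slice_congr fun α hα => hm α (Or.inl hα)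
    simp only [Meets, SAddr.addr] at h
    rcases h with h | h
    · simp only [slice, h.1, h.2.1, hC, ihE h.2.2 fun α hα => hm α (Or.inr (Or.inl hα))]
    · simp only [slice, h.1, h.2.1, hC, ihF h.2.2 fun α hα => hm α (Or.inr (Or.inr hα))]

theorem ExtCirc.slice_replaceAt_of_not_meets {E : ExtCirc 𝒬} {𝒢 : Addr} {s : SAddr}
    (h𝒢 : E.Meets 𝒢 𝒢) (hs : E.Meets s.addr s.addr) (h : ¬ E.Meets 𝒢 s.addr)
    (f : Circ 𝒬 → ExtCirc 𝒬) : (E.replaceAt 𝒢 f).slice s = E.slice s := by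
  funext ρ
  induction E generalizing ρ with
  | leaf C => exact absurd trivial h
  | node C l E F ihE ihF =>
    simp only [Meets, SAddr.addr] at hs h
    rcases h𝒢 with h1 | h1 <;> rcases hs with h2 | h2
    · simp only [replaceAt, slice, h1.1, h2.1]
      rw [ihE h1.2.2 h2.2.2 fun h' => h (Or.inl ⟨h1.1, h2.1, h'⟩)]
    · simp only [replaceAt, slice, h1.1, h2.1]
    · simp only [replaceAt, slice, h1.1, h2.1]
    · simp only [replaceAt, slice, h1.1, h2.1]
      rw [ihF h1.2.2 h2.2.2 fun h' => h (Or.inr ⟨h1.1, h2.1, h'⟩)]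

/-- The leaf is the last stage along its path, so a transformation of it acts by composition on the
outside. -/
theorem ExtCirc.Meets.slice_replaceAt {E : ExtCirc 𝒬} {𝒢 : Addr} {s : SAddr}
    (h : E.Meets 𝒢 s.addr) {f : Circ 𝒬 → ExtCirc 𝒬} {g : St → St}
    (hf : ∀ C ρ, (f C).slice s ρ = g (C.slice s ρ)) (ρ : St) :
    (E.replaceAt 𝒢 f).slice s ρ = g (E.slice s ρ) := by
  induction E generalizing ρ with
  | leaf C => exact hf C ρ
  | node C l E F ihE ihF =>
    simp only [Meets, SAddr.addr] at h
    rcases h with h | h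
    · simp only [replaceAt, slice, h.1, h.2.1, ihE h.2.2]
    · simp only [replaceAt, slice, h.1, h.2.1, ihF h.2.2]

/-! ## Typing of extended circuits -/

theorem ExtCirc.Typed.congr {E : ExtCirc 𝒬} {Γ : Env} {𝒥 𝒥' : Addr → Env} (h : E.Typed Γ 𝒥)
    (h𝒥 : ∀ 𝒢 ∈ E.addrs, 𝒥 𝒢 = 𝒥' 𝒢) : E.Typed Γ 𝒥' := by
  induction E generalizing Γ 𝒥 𝒥' with
  | leaf C =>
    change C.Typed Γ _
    rw [← h𝒥 _ rfl]
    exact h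
  | node C l E F ihE ihF =>
    obtain ⟨Ψ, h1, h2, h3, h4⟩ := h
    exact ⟨Ψ, h1, h2, ihE h3 fun 𝒢 h𝒢 => h𝒥 _ (Or.inl ⟨𝒢, h𝒢, rfl⟩),
      ihF h4 fun 𝒢 h𝒢 => h𝒥 _ (Or.inr ⟨𝒢, h𝒢, rfl⟩)⟩

theorem ExtCirc.Typed.replaceAt {E : ExtCirc 𝒬} (hE : E.GuardsDistinct) {𝒢 : Addr}
    (h𝒢 : 𝒢 ∈ E.addrs) {Γ : Env} {𝒥 𝒥' : Addr → Env} (h : E.Typed Γ 𝒥)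
    (h𝒥 : ∀ ℋ ∈ E.addrs, ℋ ≠ 𝒢 → 𝒥 ℋ = 𝒥' ℋ) {f : Circ 𝒬 → ExtCirc 𝒬}
    (hf : ∀ C Γ, C.Typed Γ (𝒥 𝒢) → (f C).Typed Γ fun ℋ => 𝒥' (𝒢.union ℋ)) :
    (E.replaceAt 𝒢 f).Typed Γ 𝒥' := by
  induction E generalizing Γ 𝒢 𝒥 𝒥' with
  | leaf C =>
    obtain rfl : 𝒢 = Addr.empty := h𝒢
    have h' := hf C Γ h
    simp only [Addr.empty_union] at h'
    exact h'
  | node C l E F ihE ihF =>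
    obtain ⟨Ψ, h1, h2, h3, h4⟩ := h
    rcases h𝒢 with ⟨𝒢, h𝒢, rfl⟩ | ⟨𝒢, h𝒢, rfl⟩
    · rw [replaceAt_add_left hE h𝒢]
      refine ⟨Ψ, h1, h2, ihE hE.2.1 h𝒢 h3 (fun ℋ hℋ hne => h𝒥 _ (Or.inl ⟨ℋ, hℋ, rfl⟩) fun h =>
        hne (Addr.add_injective (hE.eq_none.1 _ hℋ) (hE.eq_none.1 _ h𝒢) h).2) ?_,
        h4.congr fun ℋ hℋ => h𝒥 _ (Or.inr ⟨ℋ, hℋ, rfl⟩) fun h => by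
          simpa using (Addr.add_injective (hE.eq_none.2 _ hℋ) (hE.eq_none.1 _ h𝒢) h).1⟩
      simpa only [Addr.add_union] using hf
    · rw [replaceAt_add_right hE h𝒢]
      refine ⟨Ψ, h1, h2, h3.congr fun ℋ hℋ => h𝒥 _ (Or.inl ⟨ℋ, hℋ, rfl⟩) fun h => by
          simpa using (Addr.add_injective (hE.eq_none.1 _ hℋ) (hE.eq_none.2 _ h𝒢) h).1,
        ihF hE.2.2 h𝒢 h4 (fun ℋ hℋ hne => h𝒥 _ (Or.inr ⟨ℋ, hℋ, rfl⟩) fun h =>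
          hne (Addr.add_injective (hE.eq_none.2 _ hℋ) (hE.eq_none.2 _ h𝒢) h).2) ?_⟩
      simpa only [Addr.add_union] using hf

/-- The two typings share every circuit on the path to the leaf, and each of these circuits has only
one output environment. So the leaf is typed from the same environment before and after. -/
theorem ExtCirc.Typed.exists_leaf {E : ExtCirc 𝒬} (hE : E.GuardsDistinct) {𝒢 : Addr}
    (h𝒢 : 𝒢 ∈ E.addrs) {Γ : Env} {𝒥 𝒥' : Addr → Env} {f : Circ 𝒬 → ExtCirc 𝒬}
    (h : E.Typed Γ 𝒥) (h' : (E.replaceAt 𝒢 f).Typed Γ 𝒥') :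
    ∃ C Γ, C.Typed Γ (𝒥 𝒢) ∧ (f C).Typed Γ fun ℋ => 𝒥' (𝒢.union ℋ) := by
  induction E generalizing Γ 𝒢 𝒥 𝒥' with
  | leaf C =>
    obtain rfl : 𝒢 = Addr.empty := h𝒢
    refine ⟨C, Γ, h, ?_⟩
    simp only [Addr.empty_union]
    exact h'
  | node C l E F ihE ihF =>
    obtain ⟨Ψ, h1, h2, h3, h4⟩ := h
    rcases h𝒢 with ⟨𝒢, h𝒢, rfl⟩ | ⟨𝒢, h𝒢, rfl⟩
    · rw [replaceAt_add_left hE h𝒢] at h'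
      obtain ⟨Ψ', h1', h2', h3', h4'⟩ := h'
      obtain rfl := h1.unique h1'
      simpa only [Addr.add_union] using ihE hE.2.1 h𝒢 h3 h3'
    · rw [replaceAt_add_right hE h𝒢] at h'
      obtain ⟨Ψ', h1', h2', h3', h4'⟩ := h'
      obtain rfl := h1.unique h1'
      simpa only [Addr.add_union] using ihF hE.2.2 h𝒢 h4 h4'

theorem ExtCirc.Typed.leaf_append {E : ExtCirc 𝒬} (hE : E.GuardsDistinct) {𝒢 : Addr}
    (h𝒢 : 𝒢 ∈ E.addrs) {Γ : Env} {𝒥 𝒥' : Addr → Env} {c : Circ 𝒬}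
    (h : E.Typed Γ 𝒥) (h' : (E.replaceAt 𝒢 c.append).Typed Γ 𝒥') : c.Typed (𝒥 𝒢) (𝒥' 𝒢) := by
  obtain ⟨C, Γ, h1, Ψ, h2, h3⟩ := h.exists_leaf hE h𝒢 h'
  rw [h1.unique h2]
  simpa only [Addr.union_empty] using h3

theorem ExtCirc.Typed.append {E : ExtCirc 𝒬} (hE : E.GuardsDistinct) {𝒢 : Addr}
    (h𝒢 : 𝒢 ∈ E.addrs) {Γ : Env} {𝒥 𝒥' : Addr → Env} {c : Circ 𝒬} (h : E.Typed Γ 𝒥)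
    (h𝒥 : ∀ ℋ ∈ E.addrs, ℋ ≠ 𝒢 → 𝒥 ℋ = 𝒥' ℋ) (hc : c.Typed (𝒥 𝒢) (𝒥' 𝒢)) :
    (E.replaceAt 𝒢 c.append).Typed Γ 𝒥' := by
  refine h.replaceAt hE h𝒢 h𝒥 fun C Γ hC => ⟨_, hC, ?_⟩
  simpa only [Addr.union_empty] using hc

/-- Typing of the new guard says that its token carries a bit, and typing of the two empty branches
says that just this bit disappears from the environment. -/
theorem ExtCirc.Typed.leaf_branch {E : ExtCirc 𝒬} (hE : E.GuardsDistinct) {𝒢 : Addr}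
    (h𝒢 : 𝒢 ∈ E.addrs) {Γ : Env} {𝒥 𝒥' : Addr → Env} {l : Pos} (hl : 𝒢 l = none)
    (h : E.Typed Γ 𝒥) (h' : (E.replaceAt 𝒢 (Circ.branch l)).Typed Γ 𝒥') :
    𝒥 𝒢 l = some .bit ∧ ∀ b, 𝒥' (𝒢.add l b) = (𝒥 𝒢).remove l := by
  obtain ⟨C, Γ, h1, Ψ, h2, h3, h4, h5⟩ := h.exists_leaf hE h𝒢 h'
  rw [h1.unique h2]
  refine ⟨h3, fun b => ?_⟩
  cases b with
  | false => rw [← Addr.union_single hl]; exact h4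
  | true => rw [← Addr.union_single hl]; exact h5

theorem ExtCirc.Typed.branch {E : ExtCirc 𝒬} (hE : E.GuardsDistinct) {𝒢 : Addr}
    (h𝒢 : 𝒢 ∈ E.addrs) {Γ : Env} {𝒥 𝒥' : Addr → Env} {l : Pos} (hl : 𝒢 l = none)
    (h : E.Typed Γ 𝒥) (h𝒥 : ∀ ℋ ∈ E.addrs, ℋ ≠ 𝒢 → 𝒥 ℋ = 𝒥' ℋ) (hb : 𝒥 𝒢 l = some .bit)
    (hr : ∀ b, 𝒥' (𝒢.add l b) = (𝒥 𝒢).remove l) :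
    (E.replaceAt 𝒢 (Circ.branch l)).Typed Γ 𝒥' := by
  refine h.replaceAt hE h𝒢 h𝒥 fun C Γ hC => ⟨_, hC, hb, ?_, ?_⟩
  · change 𝒥' (𝒢.union (Addr.empty.add l false)) = _
    rw [Addr.union_single hl, hr]
  · change 𝒥' (𝒢.union (Addr.empty.add l true)) = _
    rw [Addr.union_single hl, hr]

/-! ## Super-addresses -/

/-- The super-address `s` without a value for `ℓ`. -/
def SAddr.erase (s : SAddr) (ℓ : Pos ⊕ ℕ) : SAddr := Function.update s ℓ none

theorem SAddr.erase_add {s : SAddr} {ℓ : Pos ⊕ ℕ} (h : s ℓ = none) (b : Bool) :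
    (s.add ℓ b).erase ℓ = s := by
  rw [SAddr.erase, SAddr.add, Function.update_idem, ← h, Function.update_eq_self]

theorem SAddr.add_erase {s : SAddr} {ℓ : Pos ⊕ ℕ} {b : Bool} (h : s ℓ = some b) :
    (s.erase ℓ).add ℓ b = s := by
  rw [SAddr.erase, SAddr.add, Function.update_idem, ← h, Function.update_eq_self]

theorem SAddr.addr_add_inr (s : SAddr) (α : ℕ) (b : Bool) : (s.add (Sum.inr α) b).addr = s.addr :=
  rfl

theorem SAddr.addr_erase_inr (s : SAddr) (α : ℕ) : (s.erase (Sum.inr α)).addr = s.addr :=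
  rfl

theorem SAddr.addr_add_inl (s : SAddr) (l : Pos) (b : Bool) :
    (s.add (Sum.inl l) b).addr = s.addr.add l b := by
  funext k
  by_cases hk : k = l
  · subst hk; simp [SAddr.addr, SAddr.add, Addr.add_self]
  · simp [SAddr.addr, SAddr.add, Addr.add_of_ne _ _ hk, hk]

theorem ExtCirc.finite_addrs (E : ExtCirc 𝒬) : E.addrs.Finite := by
  induction E with
  | leaf C => exact Set.finite_singleton _
  | node C l E F ihE ihF =>
    refine ((ihE.image fun ℋ => ℋ.add l false).union (ihF.image fun ℋ => ℋ.add l true)).subset ?_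
    rintro 𝒢 (⟨ℋ, hℋ, rfl⟩ | ⟨ℋ, hℋ, rfl⟩)
    · exact Or.inl ⟨ℋ, hℋ, rfl⟩
    · exact Or.inr ⟨ℋ, hℋ, rfl⟩

/-- The address fixes which measurement indices are defined, so a super-address is determined by its
address and the set of indices with value `true`. Finiteness makes the sums of probabilities
genuine. -/
theorem ExtCirc.finite_superAddrs (E : ExtCirc 𝒬) : E.superAddrs.Finite := by
  refine Set.Finite.of_finite_image (f := fun s : SAddr =>
    (s.addr, E.measList.toFinset.filter fun α => s (Sum.inr α) = some true)) ?_ ?_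
  · refine (E.finite_addrs.prod E.measList.toFinset.powerset.finite_toSet).subset ?_
    rintro _ ⟨s, hs, rfl⟩
    exact ⟨hs.1, Finset.mem_coe.2 (Finset.mem_powerset.2 (Finset.filter_subset _ _))⟩
  · intro s hs t ht hst
    simp only [Prod.mk.injEq] at hst
    obtain ⟨h1, h2⟩ := hst
    funext ℓ
    rcases ℓ with l | α
    · exact congrFun h1 l
    · have hs' := hs.2 α
      have ht' := ht.2 α
      rw [← h1] at ht'
      by_cases hα : α ∈ (E.restrict s.addr).measList
      · have h3 := Finset.ext_iff.1 h2 α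
        simp only [Finset.mem_filter, List.mem_toFinset, E.measList_restrict_subset _ hα,
          true_and] at h3
        obtain ⟨b, hb⟩ := Option.isSome_iff_exists.1 (hs'.2 hα)
        obtain ⟨c, hc⟩ := Option.isSome_iff_exists.1 (ht'.2 hα)
        rw [hb, hc] at h3 ⊢
        cases b <;> cases c <;> simp_all
      · have h3 := mt hs'.1 hα
        have h4 := mt ht'.1 hα
        rw [Option.not_isSome_iff_eq_none] at h3 h4
        rw [h3, h4]

/-- Without this, conditions on the super-addresses over `𝒢` could be vacuous and reveal nothing
about tokens or types. -/
theorem ExtCirc.exists_superAddr {E : ExtCirc 𝒬} {𝒢 : Addr} (h : 𝒢 ∈ E.addrs) :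
    ∃ s ∈ E.superAddrs, s.addr = 𝒢 := by
  refine ⟨Sum.elim 𝒢 fun α => if α ∈ (E.restrict 𝒢).measList then some false else none,
    ⟨h, fun α => ?_⟩, rfl⟩
  change (if α ∈ (E.restrict 𝒢).measList then some false else none).isSome = true ↔
    α ∈ (E.restrict 𝒢).measList
  split_ifs with h <;> simp [h]

theorem ExtCirc.not_meets {E : ExtCirc 𝒬} (hE : E.GuardsDistinct) {𝒢 ℋ : Addr}
    (h𝒢 : 𝒢 ∈ E.addrs) (hℋ : ℋ ∈ E.addrs) (h : ℋ ≠ 𝒢) : ¬ E.Meets 𝒢 ℋ :=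
  fun h' => h (h'.eq hE h𝒢 hℋ).symm

theorem ExtCirc.mem_superAddrs_replaceAt_of_ne {E : ExtCirc 𝒬} (hE : E.GuardsDistinct) {𝒢 : Addr}
    (h𝒢 : 𝒢 ∈ E.addrs) {f : Circ 𝒬 → ExtCirc 𝒬} {s : SAddr} (hs : s.addr ∈ E.addrs)
    (hne : s.addr ≠ 𝒢) (hs' : s.addr ∈ (E.replaceAt 𝒢 f).addrs) :
    s ∈ (E.replaceAt 𝒢 f).superAddrs ↔ s ∈ E.superAddrs := by
  simp only [superAddrs, Set.mem_ofPred_eq, hs, hs', true_and]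
  rw [restrict_replaceAt_of_not_meets (meets_self hE h𝒢) (meets_self hE hs)
    (not_meets hE h𝒢 hs hne)]

theorem ExtCirc.superAddrs_append {E : ExtCirc 𝒬} (hE : E.GuardsDistinct) {𝒢 : Addr}
    (h𝒢 : 𝒢 ∈ E.addrs) {c : Circ 𝒬} (hc : c.measList = []) :
    (E.replaceAt 𝒢 c.append).superAddrs = E.superAddrs := by
  ext s
  by_cases hs : s.addr ∈ E.addrs
  · by_cases hne : s.addr = 𝒢
    · simp only [superAddrs, Set.mem_ofPred_eq, addrs_append, hs, true_and]
      rw [← hne, (meets_self hE hs).measList_restrict_replaceAt (f := c.append) (xs := []) (by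
        simp [Circ.append, restrict, Circ.measList, hc]), List.append_nil]
    · exact mem_superAddrs_replaceAt_of_ne hE h𝒢 hs hne (by rwa [addrs_append])
  · refine iff_of_false (fun h => hs ?_) fun h => hs h.1
    have := h.1
    rwa [addrs_append] at this

theorem ExtCirc.eq_none_of_mem_superAddrs {E : ExtCirc 𝒬} {s : SAddr} (hs : s ∈ E.superAddrs)
    {α : ℕ} (hα : α ∉ E.measList) : s (Sum.inr α) = none := by
  rw [← Option.not_isSome_iff_eq_none, hs.2]
  exact fun h => hα (E.measList_restrict_subset _ h)

/-- The index `α` is fresh, so erasing its value from a new super-address over `𝒢` gives an old one.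
-/
theorem ExtCirc.superAddrs_meas {E : ExtCirc 𝒬} (hE : E.GuardsDistinct) {𝒢 : Addr}
    (h𝒢 : 𝒢 ∈ E.addrs) {α : ℕ} (hα : α ∉ E.measList) (l r : Pos) :
    (E.replaceAt 𝒢 (Circ.meas α l r).append).superAddrs =
      superExt E.superAddrs 𝒢 (Sum.inr α) := by
  have hm : ∀ β, β ∈ ((E.replaceAt 𝒢 (Circ.meas α l r).append).restrict 𝒢).measList ↔
      β ∈ (E.restrict 𝒢).measList ∨ β = α := by
    intro β
    rw [(meets_self hE h𝒢).measList_restrict_replaceAt (xs := [α]) (fun C => rfl)]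
    simp
  have hα' : α ∉ (E.restrict 𝒢).measList := fun h => hα (E.measList_restrict_subset _ h)
  ext s
  constructor
  · intro hs
    have hs1 := hs.1
    rw [addrs_append] at hs1
    by_cases hne : s.addr = 𝒢
    · have hs2 := hs.2
      simp only [hne, hm] at hs2
      obtain ⟨b, hb⟩ := Option.isSome_iff_exists.1 ((hs2 α).2 (Or.inr rfl))
      refine Or.inl ⟨s.erase (Sum.inr α), ⟨hs1, fun β => ?_⟩, hne, b, (SAddr.add_erase hb).symm⟩
      rw [SAddr.addr_erase_inr, hne]
      by_cases hβ : β = α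
      · subst hβ
        simp [SAddr.erase, hα']
      · simpa [SAddr.erase, hβ] using hs2 β
    · exact Or.inr ⟨(mem_superAddrs_replaceAt_of_ne hE h𝒢 hs1 hne hs.1).1 hs, hne⟩
  · rintro (⟨s, hs, hne, b, rfl⟩ | ⟨hs, hne⟩)
    · refine ⟨by rw [addrs_append, SAddr.addr_add_inr]; exact hs.1, fun β => ?_⟩
      rw [SAddr.addr_add_inr, hne, hm]
      by_cases hβ : β = α
      · subst hβ
        simp [SAddr.add]
      · simpa [SAddr.add, hβ, hne] using hs.2 β
    · exact (mem_superAddrs_replaceAt_of_ne hE h𝒢 hs.1 hne (by rw [addrs_append]; exact hs.1)).2 hs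

theorem ExtCirc.superAddrs_branch {E : ExtCirc 𝒬} (hE : E.GuardsDistinct) {𝒢 : Addr}
    (h𝒢 : 𝒢 ∈ E.addrs) {l : Pos} (hl : 𝒢 l = none) :
    (E.replaceAt 𝒢 (Circ.branch l)).superAddrs = superExt E.superAddrs 𝒢 (Sum.inl l) := by
  have hm : ∀ b, ((E.replaceAt 𝒢 (Circ.branch l)).restrict (𝒢.add l b)).measList =
      (E.restrict 𝒢).measList := by
    intro b
    have hM := (meets_self hE h𝒢).mono (.refl _) (Addr.sub_add hl b)
    rw [hM.measList_restrict_replaceAt (xs := []), List.append_nil, hM.restrict_eq]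
    intro C
    cases b <;> simp [Circ.branch, restrict, Addr.add_self, Circ.measList]
  ext s
  constructor
  · intro hs
    rcases (mem_addrs_branch hE h𝒢 hl).1 hs.1 with ⟨hs1, hne⟩ | ⟨b, hb⟩
    · exact Or.inr ⟨(mem_superAddrs_replaceAt_of_ne hE h𝒢 hs1 hne hs.1).1 hs, hne⟩
    · have hb' : s (Sum.inl l) = some b := by
        change s.addr l = _
        rw [hb, Addr.add_self]
      -- The erased address and `𝒢` are both undefined at `l` and become equal once `(l, b)` is
      -- added.
      have he : (s.erase (Sum.inl l)).addr = 𝒢 := by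
        have h1 := SAddr.addr_add_inl (s.erase (Sum.inl l)) l b
        rw [SAddr.add_erase hb', hb] at h1
        refine (Addr.add_injective ?_ hl h1.symm).2
        simp [SAddr.addr, SAddr.erase]
      refine Or.inl ⟨s.erase (Sum.inl l), ⟨by rwa [he], fun β => ?_⟩, he, b,
        (SAddr.add_erase hb').symm⟩
      have := hs.2 β
      rw [hb, hm] at this
      rw [he, ← this]
      simp [SAddr.erase]
  · rintro (⟨s, hs, hne, b, rfl⟩ | ⟨hs, hne⟩)
    · have ha : (s.add (Sum.inl l) b).addr = 𝒢.add l b := by rw [SAddr.addr_add_inl, hne]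
      refine ⟨(mem_addrs_branch hE h𝒢 hl).2 (Or.inr ⟨b, ha⟩), fun β => ?_⟩
      rw [ha, hm, ← hne, ← hs.2 β]
      simp [SAddr.add]
    · exact (mem_superAddrs_replaceAt_of_ne hE h𝒢 hs.1 hne
        ((mem_addrs_branch hE h𝒢 hl).2 (Or.inl ⟨hs.1, hne⟩))).2 hs

/-! ## Families indexed by an extension of a set of super-addresses -/

/-- An extended super-address remembers its origin: erasing `ℓ` recovers `s`, and its value at `ℓ`
is `b`. By `hd` it cannot be mistaken for an old super-address off `𝒢`. -/
theorem exists_superExt_family {X : Type*} {S : Set SAddr} {𝒢 : Addr} {ℓ : Pos ⊕ ℕ}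
    (hS : ∀ s ∈ S, s.addr = 𝒢 → s ℓ = none)
    (hd : ∀ s ∈ S, s.addr = 𝒢 → ∀ b, ¬ (s.add ℓ b ∈ S ∧ (s.add ℓ b).addr ≠ 𝒢))
    (g : S → X) (h : S → Bool → X) :
    ∃ k : superExt S 𝒢 ℓ → X,
      (∀ s (hs : s ∈ S) (ht : s ∈ superExt S 𝒢 ℓ), s.addr ≠ 𝒢 → k ⟨s, ht⟩ = g ⟨s, hs⟩) ∧
      ∀ s (hs : s ∈ S) b (ht : s.add ℓ b ∈ superExt S 𝒢 ℓ), s.addr = 𝒢 →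
        k ⟨s.add ℓ b, ht⟩ = h ⟨s, hs⟩ b := by
  classical
  have he : ∀ t : superExt S 𝒢 ℓ, ¬ (t.1 ∈ S ∧ t.1.addr ≠ 𝒢) → t.1.erase ℓ ∈ S := by
    rintro ⟨t, ⟨s, hs, hne, b, rfl⟩ | ht⟩ h
    · change (s.add ℓ b).erase ℓ ∈ S
      rwa [SAddr.erase_add (hS s hs hne)]
    · exact absurd ht h
  -- The default of `getD` is never read: an extended super-address has a value at `ℓ`.
  refine ⟨fun t => if ht : t.1 ∈ S ∧ t.1.addr ≠ 𝒢 then g ⟨t.1, ht.1⟩ else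
    h ⟨t.1.erase ℓ, he t ht⟩ ((t.1 ℓ).getD false), ?_, ?_⟩
  · intro s hs ht hne
    exact dif_pos ⟨hs, hne⟩
  · intro s hs b ht hne
    refine (dif_neg (hd s hs hne b)).trans ?_
    have h1 : s.add ℓ b ℓ = some b := Function.update_self ..
    simp only [h1, Option.getD_some, SAddr.erase_add (hS s hs hne)]

/-- The extended index set consists of two disjoint copies of the part over `𝒢` and one copy of the
rest, which gives conservation of total probability. -/
theorem finsum_superExt {S : Set SAddr} (hfin : S.Finite) {𝒢 : Addr} {ℓ : Pos ⊕ ℕ}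
    (hS : ∀ s ∈ S, s.addr = 𝒢 → s ℓ = none)
    (hd : ∀ s ∈ S, s.addr = 𝒢 → ∀ b, ¬ (s.add ℓ b ∈ S ∧ (s.add ℓ b).addr ≠ 𝒢))
    {p : superExt S 𝒢 ℓ → ℝ} {q : S → ℝ}
    (h1 : ∀ s (hs : s ∈ S) (ht : s ∈ superExt S 𝒢 ℓ), s.addr ≠ 𝒢 → p ⟨s, ht⟩ = q ⟨s, hs⟩)
    (h2 : ∀ s (hs : s ∈ S) (ht : ∀ b, s.add ℓ b ∈ superExt S 𝒢 ℓ), s.addr = 𝒢 →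
      p ⟨_, ht false⟩ + p ⟨_, ht true⟩ = q ⟨s, hs⟩) :
    ∑ᶠ t, p t = ∑ᶠ s, q s := by
  classical
  -- Extension by zero replaces families on two different subtypes by functions on all
  -- super-addresses, so that sums over subsets can be cut and reindexed.
  let P : SAddr → ℝ := fun t => if h : t ∈ superExt S 𝒢 ℓ then p ⟨t, h⟩ else 0
  let R : SAddr → ℝ := fun s => if h : s ∈ S then q ⟨s, h⟩ else 0
  have hP : ∀ t, P t.1 = p t := fun t => dif_pos t.2
  have hR : ∀ s, R s.1 = q s := fun s => dif_pos s.2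
  rw [← finsum_congr hP, ← finsum_congr hR, finsum_set_coe_eq_finsum_mem,
    finsum_set_coe_eq_finsum_mem]
  set A : Set SAddr := {s ∈ S | s.addr = 𝒢} with hA
  set B : Set SAddr := {s ∈ S | s.addr ≠ 𝒢} with hB
  have hAf : A.Finite := hfin.subset fun s hs => hs.1
  have hBf : B.Finite := hfin.subset fun s hs => hs.1
  have hSAB : S = A ∪ B := by
    ext s
    simp only [hA, hB, Set.mem_union, Set.mem_ofPred_eq]
    tauto
  have hTAB : superExt S 𝒢 ℓ =
      ((fun s : SAddr => s.add ℓ false) '' A ∪ (fun s : SAddr => s.add ℓ true) '' A) ∪ B := by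
    ext t
    constructor
    · rintro (⟨s, hs, hne, b, rfl⟩ | ht)
      · cases b with
        | false => exact Or.inl (Or.inl ⟨s, ⟨hs, hne⟩, rfl⟩)
        | true => exact Or.inl (Or.inr ⟨s, ⟨hs, hne⟩, rfl⟩)
      · exact Or.inr ht
    · rintro ((⟨s, ⟨hs, hne⟩, rfl⟩ | ⟨s, ⟨hs, hne⟩, rfl⟩) | ht)
      · exact Or.inl ⟨s, hs, hne, _, rfl⟩
      · exact Or.inl ⟨s, hs, hne, _, rfl⟩
      · exact Or.inr ht
  have hinj : ∀ b, Set.InjOn (fun s : SAddr => s.add ℓ b) A := by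
    intro b s hs t ht hst
    simp only at hst
    rw [← SAddr.erase_add (hS s hs.1 hs.2) b, hst, SAddr.erase_add (hS t ht.1 ht.2)]
  have hd1 : Disjoint A B := Set.disjoint_left.2 fun s hs hs' => hs'.2 hs.2
  have hd2 : Disjoint ((fun s : SAddr => s.add ℓ false) '' A)
      ((fun s : SAddr => s.add ℓ true) '' A) := by
    rw [Set.disjoint_left]
    rintro _ ⟨s, hs, rfl⟩ ⟨t, ht, hst⟩
    have := congrFun hst ℓ
    simp [SAddr.add] at this
  have hd3 : Disjoint ((fun s : SAddr => s.add ℓ false) '' A ∪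
      (fun s : SAddr => s.add ℓ true) '' A) B := by
    rw [Set.disjoint_left]
    rintro _ (⟨s, hs, rfl⟩ | ⟨s, hs, rfl⟩) ht
    · exact hd s hs.1 hs.2 _ ht
    · exact hd s hs.1 hs.2 _ ht
  have hBT : B ⊆ superExt S 𝒢 ℓ := fun s hs => Or.inr hs
  rw [hTAB, finsum_mem_union hd3 ((hAf.image _).union (hAf.image _)) hBf,
    finsum_mem_union hd2 (hAf.image _) (hAf.image _), finsum_mem_image (hinj false),
    finsum_mem_image (hinj true), ← finsum_mem_add_distrib hAf]
  conv_rhs => rw [hSAB, finsum_mem_union hd1 hAf hBf]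
  congr 1
  · refine finsum_mem_congr rfl fun s hs => ?_
    have ht : ∀ b, s.add ℓ b ∈ superExt S 𝒢 ℓ := fun b => Or.inl ⟨s, hs.1, hs.2, b, rfl⟩
    simp only [P, R, dif_pos (ht _), dif_pos hs.1]
    exact h2 s hs.1 ht hs.2
  · refine finsum_mem_congr rfl fun s hs => ?_
    simp only [P, R, dif_pos (hBT hs), dif_pos hs.1]
    exact h1 s hs.1 _ hs.2

/-! ## Tokens of a reduction -/

/-- For `i < j < n` the paths differ at index `i`: the first turns left there, which needs `i + 1 <
n`, while the second still goes right. -/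
theorem tensorPath_injective {n i j : ℕ} (hi : i < n) (hj : j < n)
    (h : tensorPath n i = tensorPath n j) : i = j := by
  have key : ∀ {i j : ℕ}, i < j → j < n → tensorPath n i ≠ tensorPath n j := by
    intro i j hij hj h
    have h1 : (tensorPath n i)[i]? = some false := by
      simp [tensorPath, show i + 1 < n by omega]
    have h2 : (tensorPath n j)[i]? = some true := by
      rw [tensorPath, List.getElem?_append_left (by simpa using hij)]
      simp [hij]
    rw [h, h2] at h1
    simp at h1
  rcases lt_trichotomy i j with hij | hij | hij
  · exact absurd h (key hij hj)
  · exact hij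
  · exact absurd h.symm (key hij hi)

theorem gateIn_injective (p : List ℕ) (n : ℕ) : Function.Injective (gateIn p n) := by
  intro i j h
  simp only [gateIn, Pos.mk.injEq, List.cons.injEq, true_and] at h
  exact Fin.ext (tensorPath_injective i.2 j.2 h)

theorem moveToken_addr {𝒢 : Addr} {σ τ : Pos} {M : Set Token} (hM : ∀ t ∈ M, t.2 = 𝒢) :
    ∀ t ∈ moveToken 𝒢 σ τ M, t.2 = 𝒢 := by
  rintro t (ht | rfl)
  · exact hM t ht.1
  · rfl

/-- All that the argument uses of structural moves: the circuit measures nothing, it can be typed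
from a register step, and the tokens stay at `𝒢`. -/
theorem Structural.properties {π : Derivation 𝒬} {𝒢 : Addr} {M M' : Set Token} {c : Circ 𝒬}
    (h : Structural π 𝒢 M c M') :
    c.measList = [] ∧ c.InputsInjective ∧ ((∀ t ∈ M, t.2 = 𝒢) → ∀ t ∈ M', t.2 = 𝒢) := by
  induction h with
  | data _ _ => exact ⟨rfl, trivial, moveToken_addr⟩
  | unit _ _ => exact ⟨rfl, trivial, moveToken_addr⟩
  | trans _ _ ih1 ih2 =>
    exact ⟨by rw [Circ.measList, ih1.1, ih2.1]; rfl, ⟨ih1.2.1, ih2.2.1⟩,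
      fun hM => ih2.2.2 (ih1.2.2 hM)⟩

theorem Fire.properties {π : Derivation 𝒬} {𝒢 : Addr} {M M' : Set Token} {c : Circ 𝒬}
    (h : Fire π 𝒢 M c M') :
    c.measList = [] ∧ c.InputsInjective ∧ ((∀ t ∈ M, t.2 = 𝒢) → ∀ t ∈ M', t.2 = 𝒢) := by
  cases h with
  | gate _ _ =>
    refine ⟨rfl, gateIn_injective _ _, fun hM => ?_⟩
    rintro t (ht | ⟨i, rfl⟩)
    · exact hM t ht.1
    · rfl
  | _ => exact ⟨rfl, trivial, moveToken_addr⟩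

theorem mem_tokensAt {M : Set Token} {𝒢 : Addr} {t : Token} :
    t ∈ tokensAt M 𝒢 ↔ t ∈ M ∧ t.2 = 𝒢 := Iff.rfl

theorem tokensAt_step_of_ne {M S T : Set Token} {𝒢 ℋ : Addr} (hS : ∀ t ∈ S, t.2 = 𝒢)
    (hne : ℋ ≠ 𝒢) (hT : ∀ t ∈ T, t.2 ≠ ℋ) : tokensAt ((M \ S) ∪ T) ℋ = tokensAt M ℋ := by
  ext t
  simp only [mem_tokensAt, Set.mem_union, Set.mem_sdiff]
  constructor
  · rintro ⟨⟨h1, -⟩ | h1, h2⟩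
    · exact ⟨h1, h2⟩
    · exact absurd h2 (hT t h1)
  · rintro ⟨h1, h2⟩
    exact ⟨Or.inl ⟨h1, fun h => hne (h2.symm.trans (hS t h))⟩, h2⟩

theorem tokensAt_step_target {M S T : Set Token} {ℋ : Addr}
    (hM : ∀ t ∈ M, t.2 = ℋ → t ∈ S) : tokensAt ((M \ S) ∪ T) ℋ = tokensAt T ℋ := by
  ext t
  simp only [mem_tokensAt, Set.mem_union, Set.mem_sdiff]
  constructor
  · rintro ⟨⟨h1, h3⟩ | h1, h2⟩
    · exact absurd (hM t h1 h2) h3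
    · exact ⟨h1, h2⟩
  · rintro ⟨h1, h2⟩
    exact ⟨Or.inr h1, h2⟩

theorem tokensAt_eq_self {M : Set Token} {𝒢 : Addr} (h : ∀ t ∈ M, t.2 = 𝒢) : tokensAt M 𝒢 = M :=
  Set.ext fun t => ⟨And.left, fun ht => ⟨ht, h t ht⟩⟩

/-! ### Configurations and tokens after a reduction -/

variable {π : Derivation 𝒬} {m : Reg} {𝒢 : Addr}

/-- The configuration of the QMSIAM on the tokens of an address. -/
def QCConf.slice (C : QCConf π) (𝒢 : Addr) (r : Reg) (h : r.env = π.env (tokensAt C.tokens 𝒢)) :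
    QMConf π where
  tokens := tokensAt C.tokens 𝒢
  reg := r
  occ_ne := fun t ht => C.occ_ne t ht.1
  sliced := ⟨𝒢, fun _ ht => ht.2⟩
  env_eq := h

/-- Coherence is automatic when the tokens are read off from a circuit configuration, since they
then depend only on the address; the bound by 1 follows from the total. -/
theorem CohDist.exists_of {E : ExtCirc 𝒬} (C : QCConf π) (k : E.superAddrs → QMConf π × ℝ)
    (hk : ∀ s, (k s).1.tokens = tokensAt C.tokens s.1.addr ∧ 0 ≤ (k s).2)
    (hsum : ∑ᶠ s, (k s).2 = 1) :
    ∃ μ : CohDist π E, (∀ s, μ.conf s = (k s).1) ∧ ∀ s, μ.prob s = (k s).2 := by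
  have : Finite E.superAddrs := E.finite_superAddrs
  exact ⟨{
    conf := fun s => (k s).1
    prob := fun s => (k s).2
    prob_nonneg := fun s => (hk s).2
    prob_le_one := fun s => by
      rw [← hsum]
      exact single_le_finsum s (Set.toFinite _) fun t => (hk t).2
    prob_sum := hsum
    addr_eq := fun s t ht => by
      rw [(hk s).1] at ht
      exact ht.2
    coherent := fun s t hst => by rw [(hk s).1, (hk t).1, hst] }, fun _ => rfl, fun _ => rfl⟩

theorem Rel.env_eq {C : QCConf π} {μ : CohDist π C.circ} (hR : Rel m μ C)
    (s : C.circ.superAddrs) :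
    (μ.conf s).reg.env = π.env (tokensAt C.tokens s.1.addr) := by
  rw [(μ.conf s).env_eq, hR.token]

theorem tokensAt_append {C : QCConf π} {M₀ M₁ : Set Token} (h0 : ∀ t ∈ M₀, t.2 = 𝒢)
    (h1 : ∀ t ∈ M₁, t.2 = 𝒢) (hM : tokensAt C.tokens 𝒢 = M₀) :
    tokensAt ((C.tokens \ M₀) ∪ M₁) 𝒢 = M₁ ∧
      ∀ ℋ, ℋ ≠ 𝒢 → tokensAt ((C.tokens \ M₀) ∪ M₁) ℋ = tokensAt C.tokens ℋ := by
  refine ⟨?_, fun ℋ hne => tokensAt_step_of_ne h0 hne fun t ht h => hne (h.symm.trans (h1 t ht))⟩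
  rw [tokensAt_step_target fun t ht h => hM ▸ ⟨ht, h⟩, tokensAt_eq_self h1]

/-- The extended addresses are not addresses of the old circuit, so no old token is already there;
the two values of the guard keep the two copies apart. -/
theorem tokensAt_branch {C : QCConf π} {M₀ : Set Token} {l : Pos} (hl : 𝒢 l = none)
    (h0 : ∀ t ∈ M₀, t.2 = 𝒢) (h𝒢 : 𝒢 ∈ C.circ.addrs) (M : Bool → Set Token)
    (hM : ∀ b, M b = (fun t => (t.1, 𝒢.add l b)) '' M₀) :
    (∀ b, tokensAt ((C.tokens \ M₀) ∪ (M false ∪ M true)) (𝒢.add l b) = M b) ∧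
      ∀ ℋ ∈ C.circ.addrs, ℋ ≠ 𝒢 →
        tokensAt ((C.tokens \ M₀) ∪ (M false ∪ M true)) ℋ = tokensAt C.tokens ℋ := by
  have hMa : ∀ b, ∀ t ∈ M b, t.2 = 𝒢.add l b := by
    intro b t ht
    rw [hM] at ht
    obtain ⟨_, _, rfl⟩ := ht
    rfl
  have hn := fun b => ExtCirc.add_notMem_addrs C.wf.1 h𝒢 hl b
  have hbb : ∀ {b c}, 𝒢.add l b = 𝒢.add l c → b = c := fun h => (Addr.add_injective hl hl h).1
  constructor
  · intro b
    rw [tokensAt_step_target fun t ht h => absurd (C.addr_mem t ht) (by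
      rw [h]; exact hn b)]
    ext t
    simp only [mem_tokensAt, Set.mem_union]
    constructor
    · rintro ⟨ht | ht, h⟩
      · rwa [← hbb ((hMa _ _ ht).symm.trans h)]
      · rwa [← hbb ((hMa _ _ ht).symm.trans h)]
    · intro ht
      refine ⟨?_, hMa _ _ ht⟩
      cases b
      · exact Or.inl ht
      · exact Or.inr ht
  · intro ℋ hℋ hne
    refine tokensAt_step_of_ne h0 hne ?_
    rintro t (ht | ht) rfl
    · exact hn _ (hMa _ _ ht ▸ hℋ)
    · exact hn _ (hMa _ _ ht ▸ hℋ)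

/-! ### Slices after a reduction -/

theorem not_sub_of_ne {E : ExtCirc 𝒬} (hE : E.GuardsDistinct) (h𝒢 : 𝒢 ∈ E.addrs) {s : SAddr}
    (hs : s ∈ E.superAddrs) (hne : s.addr ≠ 𝒢) : ¬ 𝒢.Sub s.addr :=
  fun h => hne (ExtCirc.eq_of_sub hE h𝒢 hs.1 h).symm

theorem ne_of_not_sub {s : SAddr} (h : ¬ 𝒢.Sub s.addr) : s.addr ≠ 𝒢 := by
  rintro rfl
  exact h (.refl _)

theorem slice_replaceAt_of_ne {E : ExtCirc 𝒬} (hE : E.GuardsDistinct) (h𝒢 : 𝒢 ∈ E.addrs)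
    {s : SAddr} (hs : s ∈ E.superAddrs) (hne : s.addr ≠ 𝒢) (f : Circ 𝒬 → ExtCirc 𝒬) :
    (E.replaceAt 𝒢 f).slice s = E.slice s :=
  ExtCirc.slice_replaceAt_of_not_meets (ExtCirc.meets_self hE h𝒢) (ExtCirc.meets_self hE hs.1)
    (ExtCirc.not_meets hE h𝒢 hs.1 hne) f

theorem slice_append {E : ExtCirc 𝒬} (hE : E.GuardsDistinct) (h𝒢 : 𝒢 ∈ E.addrs) {s : SAddr}
    (hs : s.addr = 𝒢) (c : Circ 𝒬) (ρ : St) :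
    (E.replaceAt 𝒢 c.append).slice s ρ = c.slice s (E.slice s ρ) :=
  ExtCirc.Meets.slice_replaceAt (by rw [hs]; exact ExtCirc.meets_self hE h𝒢) (f := c.append)
    (fun _ _ => rfl) ρ

theorem slice_meas {E : ExtCirc 𝒬} (hE : E.GuardsDistinct) (h𝒢 : 𝒢 ∈ E.addrs) {s : SAddr}
    (hs : s.addr = 𝒢) {α : ℕ} (hα : α ∉ E.measList) (l r : Pos) (b : Bool) (ρ : St) :
    (E.replaceAt 𝒢 (Circ.meas α l r).append).slice (s.add (Sum.inr α) b) ρ =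
      (Circ.meas (𝒬 := 𝒬) α l r).slice (s.add (Sum.inr α) b) (E.slice s ρ) := by
  rw [slice_append hE h𝒢 (s := s.add (Sum.inr α) b) hs]
  congr 1
  refine congrFun (ExtCirc.Meets.slice_congr ?_ fun β hβ => ?_) ρ
  · rw [SAddr.addr_add_inr, hs]
    exact ExtCirc.meets_self hE h𝒢
  · have : β ≠ α := by rintro rfl; exact hα hβ
    simp [SAddr.add, this]

theorem slice_branch {E : ExtCirc 𝒬} (hE : E.GuardsDistinct) (h𝒢 : 𝒢 ∈ E.addrs) {s : SAddr}
    (hs : s.addr = 𝒢) {l : Pos} (hl : 𝒢 l = none) (b : Bool) (ρ : St) :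
    (E.replaceAt 𝒢 (Circ.branch l)).slice (s.add (Sum.inl l) b) ρ =
      projBit l b (E.slice s ρ) := by
  have ha : (s.add (Sum.inl l) b).addr = 𝒢.add l b := by rw [SAddr.addr_add_inl, hs]
  have hm : E.Meets 𝒢 (s.add (Sum.inl l) b).addr := by
    rw [ha]
    exact (ExtCirc.meets_self hE h𝒢).mono (.refl _) (Addr.sub_add hl b)
  rw [hm.slice_replaceAt (f := Circ.branch l) (g := projBit l b)]
  · congr 1
    refine congrFun (ExtCirc.Meets.slice_congr ?_ fun β _ => by simp [SAddr.add]) ρ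
    rw [ha, hs]
    exact (ExtCirc.meets_self hE h𝒢).mono (Addr.sub_add hl b) (.refl _)
  · intro C ρ
    have hb : (s.add (Sum.inl l) b) (Sum.inl l) = some b := Function.update_self ..
    cases b <;> simp only [Circ.branch, ExtCirc.slice, hb, Circ.slice]

/-! ## Mixed states after a reduction -/

theorem mixed_append {E : ExtCirc 𝒬} (hE : E.GuardsDistinct) (h𝒢 : 𝒢 ∈ E.addrs) {s : SAddr}
    (hs : s.addr = 𝒢) {ρ : St} {p : ℝ} {r r' : Reg} {c : Circ 𝒬}
    (h : (p : ℂ) • r.env.embed r.mix = E.slice s ρ) (hr : RegStep c r r') :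
    (p : ℂ) • r'.env.embed r'.mix = (E.replaceAt 𝒢 c.append).slice s ρ := by
  rw [slice_append hE h𝒢 hs, ← h, Circ.slice_smul, hr.mix_eq s]

theorem mixed_meas {E : ExtCirc 𝒬} (hE : E.GuardsDistinct) (h𝒢 : 𝒢 ∈ E.addrs) {s : SAddr}
    (hs : s.addr = 𝒢) {ρ : St} {p : ℝ} {R : Reg} {R' : Bool → Reg} {pr : Bool → ℝ} {α : ℕ}
    (hα : α ∉ E.measList) {l r : Pos} (h : (p : ℂ) • R.env.embed R.mix = E.slice s ρ)
    (hr : RegMeas l r R R' pr) (b : Bool) :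
    ((pr b * p : ℝ) : ℂ) • (R' b).env.embed (R' b).mix =
      (E.replaceAt 𝒢 (Circ.meas α l r).append).slice (s.add (Sum.inr α) b) ρ := by
  have hb : (s.add (Sum.inr α) b) (Sum.inr α) = some b := Function.update_self ..
  rw [slice_meas hE h𝒢 hs hα, ← h, Circ.slice_smul, ← hr.mix_eq b hb, smul_smul,
    Complex.ofReal_mul, mul_comm]

/-- For the value not held by the register both sides vanish, the left one by its weight and the
right one by the projection. -/
theorem mixed_branch {E : ExtCirc 𝒬} (hE : E.GuardsDistinct) (h𝒢 : 𝒢 ∈ E.addrs) {s : SAddr}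
    (hs : s.addr = 𝒢) {ρ : St} {p : ℝ} {R R' : Reg} {l : Pos} (hl : 𝒢 l = none) {b' : Bool}
    (h : (p : ℂ) • R.env.embed R.mix = E.slice s ρ) (hr : RegRead l b' R R') (b : Bool) :
    (((if b = b' then p else 0 : ℝ)) : ℂ) • R'.env.embed R'.mix =
      (E.replaceAt 𝒢 (Circ.branch l)).slice (s.add (Sum.inl l) b) ρ := by
  rw [slice_branch hE h𝒢 hs hl, ← h]
  change _ = (p : ℂ) • projBit l b _
  rw [hr.mix_eq b]
  split_ifs <;> simp

/-! ## The relation after a reduction -/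

theorem Rel.of_superAddrs_eq {C C' : QCConf π} {μ : CohDist π C.circ} (hR : Rel m μ C)
    {F : ExtCirc 𝒬} {μ' : CohDist π F} (hF : F = C'.circ)
    (hsup : F.superAddrs = C.circ.superAddrs)
    (htok : ∀ ℋ, ℋ ≠ 𝒢 → tokensAt C'.tokens ℋ = tokensAt C.tokens ℋ)
    (hsl : ∀ s ∈ C.circ.superAddrs, s.addr ≠ 𝒢 → F.slice s = C.circ.slice s)
    (hne : ∀ s (hs : s ∈ C.circ.superAddrs) (ht : s ∈ F.superAddrs), s.addr ≠ 𝒢 →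
      μ'.conf ⟨s, ht⟩ = μ.conf ⟨s, hs⟩ ∧ μ'.prob ⟨s, ht⟩ = μ.prob ⟨s, hs⟩)
    (hat : ∀ s (_ : s ∈ C.circ.superAddrs) (ht : s ∈ F.superAddrs), s.addr = 𝒢 →
      (μ'.conf ⟨s, ht⟩).tokens = tokensAt C'.tokens 𝒢 ∧
      (μ'.prob ⟨s, ht⟩ : ℂ) • (μ'.conf ⟨s, ht⟩).reg.env.embed (μ'.conf ⟨s, ht⟩).reg.mix =
        F.slice s (m.env.embed m.mix)) : Rel m μ' C' := by
  refine ⟨hR.initial, hF, ?_, ?_⟩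
  · rintro ⟨s, ht⟩
    have hs := hsup ▸ ht
    by_cases h : s.addr = 𝒢
    · rw [(hat s hs ht h).1, h]
    · rw [(hne s hs ht h).1, hR.token, htok _ h]
  · rintro ⟨s, ht⟩
    have hs := hsup ▸ ht
    by_cases h : s.addr = 𝒢
    · exact (hat s hs ht h).2
    · rw [(hne s hs ht h).1, (hne s hs ht h).2, hR.mixed, hsl s hs h]

/-- Off `𝒢` everything is inherited from the old relation, so only the split super-addresses are
left to check. It covers measurements and guards alike. -/
theorem Rel.of_superExt {C C' : QCConf π} {μ : CohDist π C.circ} (hR : Rel m μ C)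
    {F : ExtCirc 𝒬} {μ' : CohDist π F} {ℓ : Pos ⊕ ℕ} (hF : F = C'.circ)
    (hsup : F.superAddrs = superExt C.circ.superAddrs 𝒢 ℓ)
    (htok : ∀ ℋ ∈ C.circ.addrs, ℋ ≠ 𝒢 → tokensAt C'.tokens ℋ = tokensAt C.tokens ℋ)
    (hsl : ∀ s ∈ C.circ.superAddrs, s.addr ≠ 𝒢 → F.slice s = C.circ.slice s)
    (hne : ∀ s (hs : s ∈ C.circ.superAddrs) (ht : s ∈ F.superAddrs), s.addr ≠ 𝒢 →
      μ'.conf ⟨s, ht⟩ = μ.conf ⟨s, hs⟩ ∧ μ'.prob ⟨s, ht⟩ = μ.prob ⟨s, hs⟩)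
    (hat : ∀ s (_ : s ∈ C.circ.superAddrs) b (ht : s.add ℓ b ∈ F.superAddrs), s.addr = 𝒢 →
      (μ'.conf ⟨_, ht⟩).tokens = tokensAt C'.tokens (s.add ℓ b).addr ∧
      (μ'.prob ⟨_, ht⟩ : ℂ) • (μ'.conf ⟨_, ht⟩).reg.env.embed (μ'.conf ⟨_, ht⟩).reg.mix =
        F.slice (s.add ℓ b) (m.env.embed m.mix)) : Rel m μ' C' := by
  refine ⟨hR.initial, hF, ?_, ?_⟩
  · rintro ⟨t, ht⟩
    have ht' := ht
    rw [hsup] at ht'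
    rcases ht' with ⟨s, hs, h, b, rfl⟩ | ⟨hs, h⟩
    · exact (hat s hs b ht h).1
    · rw [(hne t hs ht h).1, hR.token, htok _ hs.1 h]
  · rintro ⟨t, ht⟩
    have ht' := ht
    rw [hsup] at ht'
    rcases ht' with ⟨s, hs, h, b, rfl⟩ | ⟨hs, h⟩
    · exact (hat s hs b ht h).2
    · rw [(hne t hs ht h).1, (hne t hs ht h).2, hR.mixed, hsl t hs h]

/-- A coherent distribution is assembled from the old one off `𝒢` and from prescribed data `q` over
`𝒢`; the data need only match the new tokens and split each old weight into two nonnegative parts.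
-/
theorem Rel.exists_cohDist_superExt {C C' : QCConf π} {μ : CohDist π C.circ} (hR : Rel m μ C)
    {F : ExtCirc 𝒬} {ℓ : Pos ⊕ ℕ} (hsup : F.superAddrs = superExt C.circ.superAddrs 𝒢 ℓ)
    (hS : ∀ s ∈ C.circ.superAddrs, s.addr = 𝒢 → s ℓ = none)
    (hd : ∀ s ∈ C.circ.superAddrs, s.addr = 𝒢 → ∀ b,
      ¬ (s.add ℓ b ∈ C.circ.superAddrs ∧ (s.add ℓ b).addr ≠ 𝒢))
    (htok : ∀ ℋ ∈ C.circ.addrs, ℋ ≠ 𝒢 → tokensAt C'.tokens ℋ = tokensAt C.tokens ℋ)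
    (q : C.circ.superAddrs → Bool → QMConf π × ℝ)
    (hq : ∀ s b, s.1.addr = 𝒢 →
      (q s b).1.tokens = tokensAt C'.tokens (s.1.add ℓ b).addr ∧ 0 ≤ (q s b).2)
    (hq' : ∀ s, s.1.addr = 𝒢 → (q s false).2 + (q s true).2 = μ.prob s) :
    ∃ μ' : CohDist π F,
      (∀ s (hs : s ∈ C.circ.superAddrs) (ht : s ∈ F.superAddrs), s.addr ≠ 𝒢 →
        μ'.conf ⟨s, ht⟩ = μ.conf ⟨s, hs⟩ ∧ μ'.prob ⟨s, ht⟩ = μ.prob ⟨s, hs⟩) ∧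
      ∀ s (hs : s ∈ C.circ.superAddrs) b (ht : s.add ℓ b ∈ F.superAddrs), s.addr = 𝒢 →
        μ'.conf ⟨_, ht⟩ = (q ⟨s, hs⟩ b).1 ∧ μ'.prob ⟨_, ht⟩ = (q ⟨s, hs⟩ b).2 := by
  obtain ⟨k, hk1, hk2⟩ := exists_superExt_family hS hd (fun s => (μ.conf s, μ.prob s)) q
  let k' : F.superAddrs → QMConf π × ℝ := fun t => k ⟨t.1, hsup ▸ t.2⟩
  obtain ⟨μ', h1, h2⟩ := CohDist.exists_of C' k' (by
    rintro ⟨t, ht⟩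
    have ht' := ht
    rw [hsup] at ht'
    have ht'' := ht'
    rcases ht'' with ⟨s, hs, h, b, rfl⟩ | ⟨hs, h⟩
    · have : k' ⟨_, ht⟩ = q ⟨s, hs⟩ b := hk2 s hs b ht' h
      rw [this]
      exact hq ⟨s, hs⟩ b h
    · have : k' ⟨_, ht⟩ = (μ.conf ⟨t, hs⟩, μ.prob ⟨t, hs⟩) := hk1 t hs ht' h
      rw [this]
      exact ⟨(hR.token _).trans (htok _ hs.1 h).symm, μ.prob_nonneg _⟩) (by
    have h1 := finsum_comp_equiv (Equiv.setCongr hsup) (f := fun t => (k t).2)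
    have h2 := finsum_superExt (p := fun t => (k t).2) (q := μ.prob) C.circ.finite_superAddrs hS hd
      (fun s hs ht h => congrArg Prod.snd (hk1 s hs ht h)) (fun s hs ht h => by
        rw [hk2 s hs false (ht false) h, hk2 s hs true (ht true) h]
        exact hq' _ h)
    rw [μ.prob_sum] at h2
    exact h1.trans h2)
  refine ⟨μ', fun s hs ht h => ?_, fun s hs b ht h => ?_⟩
  · rw [h1, h2]
    have : k' ⟨_, ht⟩ = (μ.conf ⟨s, hs⟩, μ.prob ⟨s, hs⟩) := hk1 s hs (hsup ▸ ht) h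
    rw [this]
    exact ⟨rfl, rfl⟩
  · rw [h1, h2]
    have : k' ⟨_, ht⟩ = q ⟨s, hs⟩ b := hk2 s hs b (hsup ▸ ht) h
    rw [this]
    exact ⟨rfl, rfl⟩

/-! ## From the circuit machine to the memory machine -/

theorem Rel.forward_det {C C' : QCConf π} {μ : CohDist π C.circ} (hR : Rel m μ C)
    {M₀ M₁ : Set Token} {c : Circ 𝒬} (hS : QCConf.Step (.det M₀ M₁ c) 𝒢 C C') :
    ∃ μ' : CohDist π (C.circ.replaceAt 𝒢 c.append),
      CohDist.Step (.det M₀ M₁ c) 𝒢 μ μ' ∧ Rel m μ' C' := by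
  obtain ⟨⟨h0, hT⟩, -, h𝒢, hM, hD, hc⟩ := hS
  change ∀ t ∈ M₀, t.2 = 𝒢 at h0
  change tokensAt C.tokens 𝒢 = M₀ at hM
  change C'.tokens = (C.tokens \ M₀) ∪ M₁ at hD
  -- `RedType.update` unfolds to `Circ.append`, for which the lemmas on addresses and slices are
  -- stated.
  change C'.circ = C.circ.replaceAt 𝒢 c.append at hc
  have hT' : Structural π 𝒢 M₀ c M₁ ∨ Fire π 𝒢 M₀ c M₁ := hT
  obtain ⟨hml, -, haddr⟩ := hT'.elim Structural.properties Fire.properties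
  obtain ⟨ht1, ht2⟩ := tokensAt_append h0 (haddr h0) hM
  rw [← hD] at ht1 ht2
  -- Both configurations are well typed, and this forces the appended circuit to be typed between
  -- the environments of the tokens at `𝒢`.
  have hty : c.Typed (π.env (tokensAt C.tokens 𝒢)) (π.env (tokensAt C'.tokens 𝒢)) :=
    C.typed.leaf_append C.wf.1 h𝒢 (hc ▸ C'.typed)
  have hsup := ExtCirc.superAddrs_append C.wf.1 h𝒢 hml
  have hex : ∀ s : C.circ.superAddrs, ∃ q : QMConf π,
      q.tokens = tokensAt C'.tokens s.1.addr ∧ (s.1.addr ≠ 𝒢 → q = μ.conf s) ∧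
      (s.1.addr = 𝒢 → RegStep c (μ.conf s).reg q.reg) := by
    intro s
    by_cases h : s.1.addr = 𝒢
    · have he := hR.env_eq s
      rw [h] at he
      rw [← he] at hty
      obtain ⟨r, hr, hr'⟩ := RegStep.exists_of_typed hml hty
      exact ⟨C'.slice 𝒢 r hr', by rw [h]; rfl, fun h' => absurd h h', fun _ => hr⟩
    · exact ⟨μ.conf s, by rw [hR.token, ht2 _ h], fun _ => rfl, fun h' => absurd h' h⟩
  choose q hq1 hq2 hq3 using hex
  obtain ⟨μ', h1, h2⟩ := CohDist.exists_of (E := C.circ.replaceAt 𝒢 c.append) C'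
    (fun t => (q ⟨t.1, hsup ▸ t.2⟩, μ.prob ⟨t.1, hsup ▸ t.2⟩))
    (fun t => ⟨hq1 _, μ.prob_nonneg _⟩)
    ((finsum_comp_equiv (Equiv.setCongr hsup) (f := μ.prob)).trans μ.prob_sum)
  refine ⟨μ', ⟨⟨h0, hT⟩, trivial, h𝒢, rfl, fun s hs h => ⟨hsup ▸ hs, ?_, h2 _⟩,
    fun s ht h => ⟨hsup ▸ ht, ?_, h2 _⟩, hsup, fun s hs h => ⟨hsup ▸ hs, ?_, ?_, ?_, h2 _⟩⟩, ?_⟩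
  · exact (h1 _).trans (hq2 _ (ne_of_not_sub h))
  · exact (h1 _).trans (hq2 _ (ne_of_not_sub h))
  · rw [hR.token, h, hM]
  · rw [h1, hq1, h, ht1]
  · rw [h1]
    exact hq3 ⟨s, hs⟩ h
  · refine hR.of_superAddrs_eq hc.symm hsup ht2
      (fun s hs h => slice_replaceAt_of_ne C.wf.1 h𝒢 hs h _)
      (fun s hs ht h => ⟨(h1 _).trans (hq2 _ h), h2 _⟩) fun s hs ht h => ⟨?_, ?_⟩
    · rw [h1, hq1, h]
    · rw [h1, h2]
      exact mixed_append C.wf.1 h𝒢 h (hR.mixed ⟨s, hs⟩) (hq3 ⟨s, hs⟩ h)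

theorem Rel.forward_choice {C C' : QCConf π} {μ : CohDist π C.circ} (hR : Rel m μ C)
    {M₀ M₁ : Set Token} {α : ℕ} {l r : Pos} (hS : QCConf.Step (.choice M₀ M₁ α l r) 𝒢 C C') :
    ∃ μ' : CohDist π (C.circ.replaceAt 𝒢 (Circ.meas α l r).append),
      CohDist.Step (.choice M₀ M₁ α l r) 𝒢 μ μ' ∧ Rel m μ' C' := by
  obtain ⟨⟨h0, hT⟩, hα, h𝒢, hM, hD, hc⟩ := hS
  change ∀ t ∈ M₀, t.2 = 𝒢 at h0
  change α ∉ C.circ.measList at hα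
  change tokensAt C.tokens 𝒢 = M₀ at hM
  change C'.tokens = (C.tokens \ M₀) ∪ M₁ at hD
  change C'.circ = C.circ.replaceAt 𝒢 (Circ.meas α l r).append at hc
  have haddr : ∀ t ∈ M₁, t.2 = 𝒢 := by
    obtain ⟨p, -, -, -, -, rfl⟩ := hT
    exact moveToken_addr h0
  obtain ⟨ht1, ht2⟩ := tokensAt_append h0 haddr hM
  rw [← hD] at ht1 ht2
  have hty : (Circ.meas (𝒬 := 𝒬) α l r).Typed (π.env (tokensAt C.tokens 𝒢))
      (π.env (tokensAt C'.tokens 𝒢)) := C.typed.leaf_append C.wf.1 h𝒢 (hc ▸ C'.typed)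
  have hsup := ExtCirc.superAddrs_meas C.wf.1 h𝒢 hα l r
  have hex : ∀ s : C.circ.superAddrs, ∃ (q : Bool → QMConf π) (pr : Bool → ℝ), s.1.addr = 𝒢 →
      (∀ b, (q b).tokens = tokensAt C'.tokens 𝒢) ∧
      RegMeas l r (μ.conf s).reg (fun b => (q b).reg) pr ∧ (∀ b, 0 ≤ pr b) ∧
      pr false + pr true = 1 := by
    intro s
    by_cases h : s.1.addr = 𝒢
    · have he := hR.env_eq s
      rw [h] at he
      rw [← he] at hty
      obtain ⟨R, pr, h1, h2, h3, h4⟩ := RegMeas.exists_of_typed hty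
      exact ⟨fun b => C'.slice 𝒢 (R b) (h2 b), pr, fun _ => ⟨fun _ => rfl, h1, h3, h4⟩⟩
    · exact ⟨fun _ => μ.conf s, fun _ => 0, fun h' => absurd h' h⟩
  choose q pr hq using hex
  have htok : ∀ ℋ ∈ C.circ.addrs, ℋ ≠ 𝒢 → tokensAt C'.tokens ℋ = tokensAt C.tokens ℋ :=
    fun ℋ _ h => ht2 ℋ h
  obtain ⟨μ', h1, h2⟩ := hR.exists_cohDist_superExt hsup
    (fun s hs _ => ExtCirc.eq_none_of_mem_superAddrs hs hα) (fun s _ h b h' => h'.2 h) htok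
    (fun s b => (q s b, pr s b * μ.prob s))
    (fun s b h => ⟨by rw [SAddr.addr_add_inr, h]; exact (hq s h).1 b,
      mul_nonneg ((hq s h).2.2.1 b) (μ.prob_nonneg s)⟩)
    (fun s h => by
      simp only
      rw [← add_mul, (hq s h).2.2.2, one_mul])
  have hmem : ∀ s ∈ C.circ.superAddrs, s.addr = 𝒢 → ∀ b, s.add (Sum.inr α) b ∈
      (C.circ.replaceAt 𝒢 (Circ.meas α l r).append).superAddrs := fun s hs h b => by
    rw [hsup]
    exact Or.inl ⟨s, hs, h, b, rfl⟩
  have hmem' : ∀ s ∈ C.circ.superAddrs, s.addr ≠ 𝒢 → s ∈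
      (C.circ.replaceAt 𝒢 (Circ.meas α l r).append).superAddrs := fun s hs h => by
    rw [hsup]
    exact Or.inr ⟨hs, h⟩
  refine ⟨μ', ⟨⟨h0, hT⟩, hα, h𝒢, rfl, fun s hs h => ⟨hmem' s hs (ne_of_not_sub h),
    h1 s hs _ (ne_of_not_sub h)⟩, fun s ht h => ?_, hsup,
    fun s hs h => ⟨hmem s hs h, pr ⟨s, hs⟩, ?_, fun b => ?_, ?_, fun b => ?_⟩⟩, ?_⟩
  · have ht' := ht
    rw [hsup] at ht'
    rcases ht' with ⟨s, hs, hs', b, rfl⟩ | ⟨hs, h'⟩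
    · exact absurd hs' (ne_of_not_sub h)
    · exact ⟨hs, h1 s hs _ h'⟩
  · rw [hR.token, h, hM]
  · rw [(h2 s hs b _ h).1, (hq ⟨s, hs⟩ h).1, ht1]
  · simp only [fun b => (h2 s hs b (hmem s hs h b) h).1]
    exact (hq ⟨s, hs⟩ h).2.1
  · exact (h2 s hs b _ h).2
  · refine hR.of_superExt hc.symm hsup htok
      (fun s hs h => slice_replaceAt_of_ne C.wf.1 h𝒢 hs h _) h1 fun s hs b ht h => ⟨?_, ?_⟩
    · rw [(h2 s hs b ht h).1, SAddr.addr_add_inr, h]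
      exact (hq ⟨s, hs⟩ h).1 b
    · rw [(h2 s hs b ht h).1, (h2 s hs b ht h).2]
      exact mixed_meas C.wf.1 h𝒢 h hα (hR.mixed ⟨s, hs⟩) (hq ⟨s, hs⟩ h).2.1 b

theorem RegRead.exists_of_typed {R : Reg} {l : Pos} (h : R.env l = some .bit) :
    ∃ (b : Bool) (R' : Reg), RegRead l b R R' ∧ R'.env = R.env.remove l := by
  obtain ⟨b, R', hr⟩ := Reg.exists_read (R.env_eq_some_iff.1 h)
  exact ⟨b, R', hr, hr.env_eq⟩

theorem Rel.forward_pseudo {C C' : QCConf π} {μ : CohDist π C.circ} (hR : Rel m μ C)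
    {M₀ M₁ M₂ : Set Token} {l : Pos} (hS : QCConf.Step (.pseudo M₀ M₁ M₂ l) 𝒢 C C') :
    ∃ μ' : CohDist π (C.circ.replaceAt 𝒢 (Circ.branch l)),
      CohDist.Step (.pseudo M₀ M₁ M₂ l) 𝒢 μ μ' ∧ Rel m μ' C' := by
  obtain ⟨⟨h0, hT⟩, -, h𝒢, hM, hD, hc⟩ := hS
  change ∀ t ∈ M₀, t.2 = 𝒢 at h0
  change tokensAt C.tokens 𝒢 = M₀ at hM
  change C'.tokens = (C.tokens \ M₀) ∪ (M₁ ∪ M₂) at hD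
  change C'.circ = C.circ.replaceAt 𝒢 (Circ.branch l) at hc
  obtain ⟨-, -, hl, hM₁, hM₂⟩ := id hT
  obtain ⟨ht1, htok⟩ := tokensAt_branch hl h0 h𝒢 (fun b => cond b M₂ M₁) fun b => by
    cases b
    · exact hM₁
    · exact hM₂
  simp only [cond_false, cond_true, ← hD] at ht1 htok
  obtain ⟨hlb, hrem⟩ := C.typed.leaf_branch C.wf.1 h𝒢 hl (hc ▸ C'.typed)
  have hsup := ExtCirc.superAddrs_branch C.wf.1 h𝒢 hl
  have hex : ∀ s : C.circ.superAddrs, ∃ (q : Bool → QMConf π) (b' : Bool), s.1.addr = 𝒢 →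
      ∀ b, (q b).tokens = tokensAt C'.tokens (𝒢.add l b) ∧
        RegRead l b' (μ.conf s).reg (q b).reg := by
    intro s
    by_cases h : s.1.addr = 𝒢
    · have he := hR.env_eq s
      rw [h] at he
      rw [← he] at hlb hrem
      obtain ⟨b', R, hr, hr'⟩ := RegRead.exists_of_typed hlb
      -- Both branches get the same residual register; only the weights tell which value the guard
      -- had.
      exact ⟨fun b => C'.slice (𝒢.add l b) R (hr'.trans (hrem b).symm), b',
        fun _ b => ⟨rfl, hr⟩⟩
    · exact ⟨fun _ => μ.conf s, false, fun h' => absurd h' h⟩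
  choose q b' hq using hex
  have haddr : ∀ s : SAddr, s.addr = 𝒢 → ∀ b, (s.add (Sum.inl l) b).addr = 𝒢.add l b :=
    fun s h b => by rw [SAddr.addr_add_inl, h]
  obtain ⟨μ', h1, h2⟩ := hR.exists_cohDist_superExt hsup
    (fun s _ h => (congrFun h l).trans hl)
    (fun s _ h b h' => ExtCirc.add_notMem_addrs C.wf.1 h𝒢 hl b (haddr s h b ▸ h'.1.1)) htok
    (fun s b => (q s b, if b = b' s then μ.prob s else 0))
    (fun s b h => ⟨by rw [haddr _ h]; exact (hq s h b).1, by
      have := μ.prob_nonneg s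
      simp only
      split_ifs
      · exact this
      · exact le_rfl⟩)
    -- The whole weight goes to the value `b'`, so the two weights add up to the old one.
    (fun s h => by cases b' s <;> simp)
  have hmem : ∀ s ∈ C.circ.superAddrs, s.addr = 𝒢 → ∀ b, s.add (Sum.inl l) b ∈
      (C.circ.replaceAt 𝒢 (Circ.branch l)).superAddrs := fun s hs h b => by
    rw [hsup]
    exact Or.inl ⟨s, hs, h, b, rfl⟩
  have hmem' : ∀ s ∈ C.circ.superAddrs, s.addr ≠ 𝒢 → s ∈
      (C.circ.replaceAt 𝒢 (Circ.branch l)).superAddrs := fun s hs h => by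
    rw [hsup]
    exact Or.inr ⟨hs, h⟩
  refine ⟨μ', ⟨⟨h0, hT⟩, trivial, h𝒢, rfl, fun s hs h => ⟨hmem' s hs (ne_of_not_sub h),
    h1 s hs _ (ne_of_not_sub h)⟩, fun s ht h => ?_, hsup,
    fun s hs h => ⟨hmem s hs h, b' ⟨s, hs⟩, ?_, fun b => ?_, fun b => ?_, fun b => ?_⟩⟩, ?_⟩
  · have ht' := ht
    rw [hsup] at ht'
    rcases ht' with ⟨s, hs, hs', b, rfl⟩ | ⟨hs, h'⟩
    -- A split super-address contains `𝒢`, so it is not among those required to be unchanged.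
    · refine absurd ?_ h
      rw [haddr s hs']
      exact Addr.sub_add hl b
    · exact ⟨hs, h1 s hs _ h'⟩
  · rw [hR.token, h, hM]
  · rw [(h2 s hs b _ h).1, (hq ⟨s, hs⟩ h b).1, ht1]
  · rw [(h2 s hs b _ h).1]
    exact (hq ⟨s, hs⟩ h b).2
  · exact (h2 s hs b _ h).2
  · refine hR.of_superExt hc.symm hsup htok
      (fun s hs h => slice_replaceAt_of_ne C.wf.1 h𝒢 hs h _) h1 fun s hs b ht h => ⟨?_, ?_⟩
    · rw [(h2 s hs b ht h).1, haddr s h]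
      exact (hq ⟨s, hs⟩ h b).1
    · rw [(h2 s hs b ht h).1, (h2 s hs b ht h).2]
      exact mixed_branch C.wf.1 h𝒢 h hl (hR.mixed ⟨s, hs⟩) (hq ⟨s, hs⟩ h b).2 b

/-! ## From the memory machine to the circuit machine -/

/-- The circuit configuration depends on the registers only through the typing of `c` between the
environments of the tokens; a deterministic reduction and a measurement can therefore share this
construction. -/
theorem QCConf.exists_append (C : QCConf π) {M₀ M₁ : Set Token} {c : Circ 𝒬}
    (h𝒢 : 𝒢 ∈ C.circ.addrs) (h0 : ∀ t ∈ M₀, t.2 = 𝒢) (h1 : ∀ t ∈ M₁, t.2 = 𝒢)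
    (hM : tokensAt C.tokens 𝒢 = M₀) (hocc : ∀ t ∈ M₁, π.occ t.1 ≠ none)
    (hty : c.Typed (π.env M₀) (π.env M₁)) (hml : (C.circ.measList ++ c.measList).Nodup) :
    ∃ C' : QCConf π, C'.tokens = (C.tokens \ M₀) ∪ M₁ ∧
      C'.circ = C.circ.replaceAt 𝒢 c.append := by
  obtain ⟨ht1, ht2⟩ := tokensAt_append h0 h1 hM
  have hp := (ExtCirc.meets_self C.wf.1 h𝒢).measList_replaceAt (f := c.append)
    (xs := c.measList) fun _ => rfl
  exact ⟨{
    tokens := (C.tokens \ M₀) ∪ M₁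
    circ := C.circ.replaceAt 𝒢 c.append
    occ_ne := by
      rintro t (ht | ht)
      · exact C.occ_ne t ht.1
      · exact hocc t ht
    addr_mem := by
      rw [ExtCirc.addrs_append]
      rintro t (ht | ht)
      · exact C.addr_mem t ht.1
      · rwa [h1 t ht]
    wf := ⟨C.wf.1.append c 𝒢, hp.nodup_iff.2 hml⟩
    typed := C.typed.append C.wf.1 h𝒢 (fun ℋ _ h => by rw [ht2 ℋ h]) (by rwa [ht1, hM]) },
    rfl, rfl⟩

theorem QCConf.exists_branch (C : QCConf π) {M₀ : Set Token} {l : Pos}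
    (h𝒢 : 𝒢 ∈ C.circ.addrs) (hl : 𝒢 l = none) (h0 : ∀ t ∈ M₀, t.2 = 𝒢)
    (hM : tokensAt C.tokens 𝒢 = M₀) {M : Bool → Set Token}
    (hMb : ∀ b, M b = (fun t => (t.1, 𝒢.add l b)) '' M₀) (hlb : π.env M₀ l = some .bit)
    (hrem : ∀ b, π.env (M b) = (π.env M₀).remove l) :
    ∃ C' : QCConf π, C'.tokens = (C.tokens \ M₀) ∪ (M false ∪ M true) ∧
      C'.circ = C.circ.replaceAt 𝒢 (Circ.branch l) := by
  obtain ⟨ht1, ht2⟩ := tokensAt_branch hl h0 h𝒢 M hMb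
  have hp := (ExtCirc.meets_self C.wf.1 h𝒢).measList_replaceAt (f := Circ.branch l)
    (xs := []) fun _ => rfl
  rw [List.append_nil] at hp
  have hb : ∀ b, ∀ t ∈ M b, π.occ t.1 ≠ none ∧
      t.2 ∈ (C.circ.replaceAt 𝒢 (Circ.branch l)).addrs := by
    intro b t ht
    rw [hMb] at ht
    obtain ⟨t, ht, rfl⟩ := ht
    rw [← hM] at ht
    exact ⟨C.occ_ne t ht.1, (ExtCirc.mem_addrs_branch C.wf.1 h𝒢 hl).2 (Or.inr ⟨b, rfl⟩)⟩
  exact ⟨{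
    tokens := (C.tokens \ M₀) ∪ (M false ∪ M true)
    circ := C.circ.replaceAt 𝒢 (Circ.branch l)
    occ_ne := by
      rintro t (ht | ht | ht)
      · exact C.occ_ne t ht.1
      · exact (hb _ t ht).1
      · exact (hb _ t ht).1
    addr_mem := by
      rintro t (ht | ht | ht)
      · refine (ExtCirc.mem_addrs_branch C.wf.1 h𝒢 hl).2 (Or.inl ⟨C.addr_mem t ht.1, fun h => ?_⟩)
        exact ht.2 (hM ▸ ⟨ht.1, h⟩)
      · exact (hb _ t ht).2
      · exact (hb _ t ht).2
    wf := ⟨C.wf.1.branch h𝒢 hl, hp.nodup_iff.2 C.wf.2⟩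
    typed := C.typed.branch C.wf.1 h𝒢 hl (fun ℋ hℋ h => by rw [ht2 ℋ hℋ h]) (by rwa [hM])
      fun b => by rw [ht1, hM, hrem] }, rfl, rfl⟩

theorem Rel.backward_det {C : QCConf π} {μ : CohDist π C.circ} (hR : Rel m μ C)
    {M₀ M₁ : Set Token} {c : Circ 𝒬} {F : ExtCirc 𝒬} {μ' : CohDist π F}
    (hS : CohDist.Step (.det M₀ M₁ c) 𝒢 μ μ') :
    ∃ C' : QCConf π, QCConf.Step (.det M₀ M₁ c) 𝒢 C C' ∧ Rel m μ' C' := by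
  obtain ⟨⟨h0, hT⟩, -, h𝒢, hF, hA, -, hsup, hat⟩ := hS
  change ∀ t ∈ M₀, t.2 = 𝒢 at h0
  change F = C.circ.replaceAt 𝒢 c.append at hF
  have hT' : Structural π 𝒢 M₀ c M₁ ∨ Fire π 𝒢 M₀ c M₁ := hT
  obtain ⟨hml, hinj, haddr⟩ := hT'.elim Structural.properties Fire.properties
  -- One super-address over `𝒢` suffices: its configurations reveal the tokens before and after, and
  -- its register step types the appended circuit.
  obtain ⟨s₀, hs₀, hs₀'⟩ := ExtCirc.exists_superAddr h𝒢
  obtain ⟨ht₀, e1, e2, e3, -⟩ := hat s₀ hs₀ hs₀'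
  have hM : tokensAt C.tokens 𝒢 = M₀ := by rw [← e1, hR.token, hs₀']
  have hty := e3.typed hinj
  rw [(μ.conf _).env_eq, (μ'.conf _).env_eq, e1, e2] at hty
  obtain ⟨C', hD, hc⟩ := C.exists_append h𝒢 h0 (haddr h0) hM
    (fun t ht => (μ'.conf _).occ_ne t (e2 ▸ ht)) hty (by rw [hml, List.append_nil]; exact C.wf.2)
  obtain ⟨ht1, ht2⟩ := tokensAt_append h0 (haddr h0) hM
  rw [← hD] at ht1 ht2
  refine ⟨C', ⟨⟨h0, hT⟩, trivial, h𝒢, hM, hD, hc⟩, ?_⟩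
  refine hR.of_superAddrs_eq (hF.trans hc.symm) hsup ht2 (fun s hs h => by
    rw [hF]
    exact slice_replaceAt_of_ne C.wf.1 h𝒢 hs h _)
    (fun s hs ht h => (hA s hs (not_sub_of_ne C.wf.1 h𝒢 hs h)).2) fun s hs ht h => ?_
  obtain ⟨_, -, e2, e3, e4⟩ := hat s hs h
  refine ⟨by rw [e2, ht1], ?_⟩
  rw [e4]
  exact (mixed_append C.wf.1 h𝒢 h (hR.mixed ⟨s, hs⟩) e3).trans (by rw [hF])

theorem Rel.backward_choice {C : QCConf π} {μ : CohDist π C.circ} (hR : Rel m μ C)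
    {M₀ M₁ : Set Token} {α : ℕ} {l r : Pos} {F : ExtCirc 𝒬} {μ' : CohDist π F}
    (hS : CohDist.Step (.choice M₀ M₁ α l r) 𝒢 μ μ') :
    ∃ C' : QCConf π, QCConf.Step (.choice M₀ M₁ α l r) 𝒢 C C' ∧ Rel m μ' C' := by
  obtain ⟨⟨h0, hT⟩, hα, h𝒢, hF, hA, -, hsup, hat⟩ := hS
  change ∀ t ∈ M₀, t.2 = 𝒢 at h0
  change α ∉ C.circ.measList at hα
  change F = C.circ.replaceAt 𝒢 (Circ.meas α l r).append at hF
  have haddr : ∀ t ∈ M₁, t.2 = 𝒢 := by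
    obtain ⟨p, -, -, -, -, rfl⟩ := hT
    exact moveToken_addr h0
  obtain ⟨s₀, hs₀, hs₀'⟩ := ExtCirc.exists_superAddr h𝒢
  obtain ⟨ht₀, pr, e1, e2, e3, -⟩ := hat s₀ hs₀ hs₀'
  have hM : tokensAt C.tokens 𝒢 = M₀ := by rw [← e1, hR.token, hs₀']
  -- Either outcome would do: both resulting registers have the environment of `M₁`.
  have hty := e3.typed false
  rw [(μ.conf _).env_eq, (μ'.conf _).env_eq, e1, e2] at hty
  obtain ⟨C', hD, hc⟩ := C.exists_append (c := .meas α l r) h𝒢 h0 haddr hM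
    (fun t ht => (μ'.conf _).occ_ne t ((e2 false).symm ▸ ht)) hty (by
      rw [List.nodup_append']
      refine ⟨C.wf.2, List.nodup_singleton _, fun β hβ hβ' => hα ?_⟩
      rwa [← List.mem_singleton.1 hβ'])
  obtain ⟨ht1, ht2⟩ := tokensAt_append h0 haddr hM
  rw [← hD] at ht1 ht2
  refine ⟨C', ⟨⟨h0, hT⟩, hα, h𝒢, hM, hD, hc⟩, ?_⟩
  refine hR.of_superExt (hF.trans hc.symm) hsup (fun ℋ _ h => ht2 ℋ h) (fun s hs h => by
    rw [hF]
    exact slice_replaceAt_of_ne C.wf.1 h𝒢 hs h _)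
    (fun s hs ht h => (hA s hs (not_sub_of_ne C.wf.1 h𝒢 hs h)).2) fun s hs b ht h => ?_
  obtain ⟨_, pr, -, e2, e3, e4⟩ := hat s hs h
  refine ⟨by rw [e2, SAddr.addr_add_inr, h, ht1], ?_⟩
  rw [e4]
  exact (mixed_meas C.wf.1 h𝒢 h hα (hR.mixed ⟨s, hs⟩) e3 b).trans (by rw [hF])

theorem Rel.backward_pseudo {C : QCConf π} {μ : CohDist π C.circ} (hR : Rel m μ C)
    {M₀ M₁ M₂ : Set Token} {l : Pos} {F : ExtCirc 𝒬} {μ' : CohDist π F}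
    (hS : CohDist.Step (.pseudo M₀ M₁ M₂ l) 𝒢 μ μ') :
    ∃ C' : QCConf π, QCConf.Step (.pseudo M₀ M₁ M₂ l) 𝒢 C C' ∧ Rel m μ' C' := by
  obtain ⟨⟨h0, hT⟩, -, h𝒢, hF, hA, -, hsup, hat⟩ := hS
  change ∀ t ∈ M₀, t.2 = 𝒢 at h0
  change F = C.circ.replaceAt 𝒢 (Circ.branch l) at hF
  obtain ⟨-, -, hl, hM₁, hM₂⟩ := id hT
  have hMb : ∀ b, cond b M₂ M₁ = (fun t : Token => (t.1, 𝒢.add l b)) '' M₀ := fun b => by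
    cases b
    · exact hM₁
    · exact hM₂
  obtain ⟨s₀, hs₀, hs₀'⟩ := ExtCirc.exists_superAddr h𝒢
  obtain ⟨ht₀, b₀, e1, e2, e3, -⟩ := hat s₀ hs₀ hs₀'
  have hM : tokensAt C.tokens 𝒢 = M₀ := by rw [← e1, hR.token, hs₀']
  have henv : (μ.conf ⟨s₀, hs₀⟩).reg.env = π.env M₀ := by rw [(μ.conf _).env_eq, e1]
  obtain ⟨C', hD, hc⟩ := C.exists_branch (M := fun b => cond b M₂ M₁) h𝒢 hl h0 hM hMb (by
      rw [← henv]
      exact Reg.env_of_mem _ (Reg.mem_of_mem_bits (e3 false).1)) fun b => by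
    -- The register left after reading the guard has the old environment without `l`; this is the
    -- typing demanded of both empty branches.
    rw [← henv, ← (e3 b).env_eq, (μ'.conf _).env_eq, e2]
  obtain ⟨ht1, ht2⟩ := tokensAt_branch hl h0 h𝒢 (fun b => cond b M₂ M₁) hMb
  rw [← hD] at ht1 ht2
  refine ⟨C', ⟨⟨h0, hT⟩, trivial, h𝒢, hM, hD, hc⟩, ?_⟩
  refine hR.of_superExt (hF.trans hc.symm) hsup ht2 (fun s hs h => by
    rw [hF]
    exact slice_replaceAt_of_ne C.wf.1 h𝒢 hs h _)
    (fun s hs ht h => (hA s hs (not_sub_of_ne C.wf.1 h𝒢 hs h)).2) fun s hs b ht h => ?_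
  obtain ⟨_, b', -, e2, e3, e4⟩ := hat s hs h
  refine ⟨by rw [e2, SAddr.addr_add_inl, h, ht1], ?_⟩
  rw [e4]
  exact (mixed_branch C.wf.1 h𝒢 h hl (hR.mixed ⟨s, hs⟩) (e3 b) b).trans (by rw [hF])

end QSIAM

/-! ### The bisimulation -/

theorem mainTheorem8 (𝒬 : QSIAM.GateSet) (π : QSIAM.Derivation 𝒬) (E : QSIAM.ExtCirc 𝒬)
    (μ : QSIAM.CohDist π E) (C : QSIAM.QCConf π) (m : QSIAM.Reg) (a : QSIAM.RedType 𝒬)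
    (𝒢 : QSIAM.Addr) (h𝒢 : 𝒢 ∈ E.addrs) :
    (∀ C' : QSIAM.QCConf π, QSIAM.Rel m μ C → QSIAM.QCConf.Step a 𝒢 C C' →
      ∃ (F : QSIAM.ExtCirc 𝒬) (μ' : QSIAM.CohDist π F),
        QSIAM.CohDist.Step a 𝒢 μ μ' ∧ QSIAM.Rel m μ' C') ∧
    (∀ (F : QSIAM.ExtCirc 𝒬) (μ' : QSIAM.CohDist π F),
      QSIAM.Rel m μ C → QSIAM.CohDist.Step a 𝒢 μ μ' →
      ∃ C' : QSIAM.QCConf π, QSIAM.QCConf.Step a 𝒢 C C' ∧ QSIAM.Rel m μ' C') := by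
  constructor
  · intro C' hR hS
    obtain rfl := hR.index
    cases a with
    | det => exact ⟨_, hR.forward_det hS⟩
    | choice => exact ⟨_, hR.forward_choice hS⟩
    | pseudo => exact ⟨_, hR.forward_pseudo hS⟩
  · intro F μ' hR hS
    obtain rfl := hR.index
    cases a with
    | det => exact hR.backward_det hS
    | choice => exact hR.backward_choice hS
    | pseudo => exact hR.backward_pseudo hS
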